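/- **Setting.** Write $v=(v_1,v_2,v_3)\in\mathbb R^3$, $Rv=(-v_1,v_2,v_3)$. For $g\ge 0$ on $\mathbb R^3$ put $\rho=\int g\,dv$, $\rho U=\int g\,v\,dv$, $3\rho T=\int g|v-U|^2dv$, $\rho\Theta=\int g\,(v-U)\otimes(v-U)\,dv$, $\mathcal T_\nu=(1-\nu)T\,\mathbb I_3+\nu\Theta$ and $$\mathcal M_\nu(g)(v)=\frac{\rho}{\sqrt{\det(2\pi\mathcal T_\nu)}}\exp\Big(-\tfrac12(v-U)^\top\mathcal T_\nu^{-1}(v-U)\Big).$$ Fix wall temperatures $T_w(0),T_w(1)>0$ and the wall Maxwellians of unit flux $M_w(i,v)=\frac{1}{2\pi T_w(i)^2}e^{-|v|^2/(2T_w(i))}$, so that $\int_{v_1>0}M_w(i,v)|v_1|dv=\int_{v_1<0}M_w(i,v)|v_1|dv=1$. Consider, for $\tau>0$ and $\delta_1,\delta_2,\delta_3\ge0$ with $\delta_1+\delta_2+\delta_3=1$, the boundary value problem on $[0,1]\times\mathbb R^3$ $$v_1\partial_x f=\tfrac1\tau(\mathcal M_\nu(f)-f),$$ $$f(0,v)=\delta_1f_L(v)+\delta_2\Big(\int_{w_1<0}f(0,w)|w_1|dw\Big)M_w(0,v)+\delta_3f(0,Rv)\quad(v_1>0),$$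 $$f(1,v)=\delta_1f_R(v)+\delta_2\Big(\int_{w_1>0}f(1,w)|w_1|dw\Big)M_w(1,v)+\delta_3f(1,Rv)\quad(v_1<0).$$ A *mild solution* is a measurable $f$ with $\sup_{x\in[0,1]}\int|f(x,v)|(1+|v|^2)dv<\infty$ (in particular with traces $f(0,\cdot),f(1,\cdot)$ integrable against $(1+|v|^2)dv$) such that for a.e. $v$ the function $y\mapsto\mathcal M_\nu(f(y,\cdot))(v)$ is integrable on $[0,1]$, the boundary conditions hold, and for all $x\in[0,1]$ $$f(x,v)=e^{-\frac{x}{\tau|v_1|}}f(0,v)+\frac1{\tau|v_1|}\int_0^xe^{-\frac{x-y}{\tau|v_1|}}\mathcal M_\nu(f(y,\cdot))(v)\,dy\quad(v_1>0),$$ $$f(x,v)=e^{-\frac{1-x}{\tau|v_1|}}f(1,v)+\frac1{\tau|v_1|}\int_x^1e^{-\frac{y-x}{\tau|v_1|}}\mathcal M_\nu(f(y,\cdot))(v)\,dy\quad(v_1<0).$$ **Data.** Put $f_{LR}=f_L1_{v_1>0}+f_R1_{v_1<0}$ and $M_w(v)=M_w(0,v)1_{v_1>0}+M_w(1,v)1_{v_1<0}$.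 The conditions on the data are: * $(P_1)$ $f_{LR}\ge0$ a.e., $f_{LR}$ is not a.e. zero, and $\int f_{LR}(1+|v|^2)dv<\infty$. * $(P_2)$ $\int_{\mathbb R^2}f_L\,v_i\,dv_2dv_3=0$ for a.e. $v_1>0$ and $\int_{\mathbb R^2}f_R\,v_i\,dv_2dv_3=0$ for a.e. $v_1<0$ ($i=2,3$). For a function $h(v)$ the trace norm $\|h\|_{L^1_{\gamma,\langle v\rangle}}$ is the sum of the outward part $\int_{v_1<0}|h|(1+|v|^2)dv+\int_{v_1>0}|h|(1+|v|^2)dv$ (traces at $x=0$ and $x=1$) and the inward part $\int_{v_1>0}|h|(1+|v|^2)dv+\int_{v_1<0}|h|(1+|v|^2)dv$, that is $2\int|h|(1+|v|^2)dv$. Define $$C_{LR,1}=\|f_{LR}\|_{L^1_{\gamma,\langle v\rangle}}\|M_w\|_{L^1_{\gamma,\langle v\rangle}},\qquad a_{\ell,1}=\int e^{-\frac1{|v_1|}}f_{LR}\,dv,$$ $$\gamma_{\ell,1}=\Big(\int_{v_1>0}e^{-\frac1{|v_1|}}f_L|v_1|dv\Big)\Big(\int_{v_1<0}e^{-\frac1{|v_1|}}f_R|v_1|dv\Big),\qquad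 a_{-1/2,1}=\inf_{|\kappa|=1}\int e^{-\frac1{|v_1|}}f_{LR}\{|v|^2-(v\cdot\kappa)^2\}dv,$$ and $C^1_\nu=\min\{1-\nu,1+2\nu\}$, $C^2_\nu=\max\{1-\nu,1+2\nu\}$. **Theorem.** (1) Let $-1/2<\nu<1$. There are constants $K_1>0$, $\epsilon>0$, depending only on $\nu$, $T_w$ and, among the data, on the values of $C_{LR,1},a_{\ell,1},\gamma_{\ell,1},a_{-1/2,1}$, such that the following holds for all $f_L,f_R$ satisfying $(P_1)$ and $(P_2)$. If $\tau>K_1$ and $\delta_2+\delta_3<\epsilon$, there is a unique (up to a null set of velocities) mild solution $f\ge0$ of the boundary value problem such that for all $x\in[0,1]$ and all $|\kappa|=1$ $$\int f(x,v)dv\ge a_{\ell,1},\qquad\int f(x,v)(1+|v|^2)dv\le2C_{LR,1},$$ $$C^1_\nu\delta_1^2\frac{\gamma_{\ell,1}}{3C_{LR,1}^2}\le\kappa^\top\mathcal T_\nu(x)\kappa\le\frac{2}{3a_{\ell,1}\delta_1}C^2_\nu C_{LR,1}.$$ Moreover $\gamma_{\ell,1}>0$ if neither $f_L1_{v_1>0}$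 nor $f_R1_{v_1<0}$ is a.e. zero. (2) Let $\nu=-1/2$. There are constants $K_1,\epsilon_1,\epsilon_2>0$, depending only on $T_w$ and, among the data, on the values of $C_{LR,1},a_{\ell,1},a_{-1/2,1}$, such that the following holds for all $f_L,f_R$ satisfying $(P_1)$ and $(P_2)$. If $\tau>K_1$, $\delta_2+\delta_3<\epsilon_1$ and $$\Big|\int_{v_1>0}f_L|v_1|dv-\int_{v_1<0}f_R|v_1|dv\Big|\le\epsilon_2,$$ there is a unique (up to a null set of velocities) mild solution $f\ge0$ of the boundary value problem such that for all $x\in[0,1]$ and all $|\kappa|=1$ $$\int f(x,v)dv\ge\delta_1a_{\ell,1},\qquad\int f(x,v)|v|^2dv\le2C_{LR,1},$$ $$\delta_1\frac{a_{-1/2,1}}{2C_{LR,1}}\le\kappa^\top\mathcal T_{-1/2}(x)\kappa\le\frac{3}{2a_{\ell,1}}C_{LR,1}.$$ Moreover $a_{-1/2,1}>0$. -/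

import Mathlib

open MeasureTheory Set

noncomputable section

namespace ESBGK

/-- The velocity space `ℝ³`. The component `v₁` of the text is `v 0`, and so on. -/
abbrev V : Type := EuclideanSpace ℝ (Fin 3)

/-! ### Macroscopic fields and the ellipsoidal Gaussian of a velocity distribution `g`

`g` stands for `f(x, ·)` at a fixed position `x`. -/

/-- Local density `ρ`. -/
def density (g : V → ℝ) : ℝ := ∫ v, g v

/-- Bulk velocity `U`, from `ρ U = ∫ g v dv`. -/
def bulkVelocity (g : V → ℝ) : V := (density g)⁻¹ • ∫ v, g v • v

/-- Local temperature `T`, from `3 ρ T = ∫ g |v - U|² dv`. -/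
def temperature (g : V → ℝ) : ℝ :=
  (3 * density g)⁻¹ * ∫ v, g v * ‖v - bulkVelocity g‖ ^ 2

/-- Stress tensor `Θ`, from `ρ Θ = ∫ g (v - U) ⊗ (v - U) dv`. -/
def stressTensor (g : V → ℝ) : Matrix (Fin 3) (Fin 3) ℝ :=
  Matrix.of fun i j =>
    (density g)⁻¹ * ∫ v, g v * ((v i - bulkVelocity g i) * (v j - bulkVelocity g j))

/-- Temperature tensor `𝒯_ν = (1 - ν) T I + ν Θ`. -/
def temperatureTensor (ν : ℝ) (g : V → ℝ) : Matrix (Fin 3) (Fin 3) ℝ :=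
  ((1 - ν) * temperature g) • (1 : Matrix (Fin 3) (Fin 3) ℝ) + ν • stressTensor g

/-- The quadratic form `κᵀ A κ`. -/
def quadForm (A : Matrix (Fin 3) (Fin 3) ℝ) (κ : V) : ℝ :=
  dotProduct κ.ofLp (A.mulVec κ.ofLp)

/-- The ellipsoidal Gaussian
`ℳ_ν(g)(v) = ρ / √det(2π 𝒯_ν) · exp(-½ (v - U)ᵀ 𝒯_ν⁻¹ (v - U))`. -/
def ellipsoidalGaussian (ν : ℝ) (g : V → ℝ) (v : V) : ℝ :=
  density g / Real.sqrt ((2 * Real.pi) • temperatureTensor ν g).det *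
    Real.exp (-(1 / 2) * quadForm (temperatureTensor ν g)⁻¹ (v - bulkVelocity g))

/-! ### Boundary data -/

/-- Specular reflection `R(v₁, v₂, v₃) = (-v₁, v₂, v₃)`. -/
def reflect (v : V) : V := !₂[-(v 0), v 1, v 2]

/-- Wall Maxwellian of wall temperature `θ`, normalized to have unit flux:
`∫_{v₁ > 0} M |v₁| dv = ∫_{v₁ < 0} M |v₁| dv = 1`. -/
def wallMaxwellian (θ : ℝ) (v : V) : ℝ :=
  1 / (2 * Real.pi * θ ^ 2) * Real.exp (-(‖v‖ ^ 2) / (2 * θ))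

/-- `h_L 1_{v₁ > 0} + h_R 1_{v₁ < 0}`. It is used for `f_{LR}`, from `f_L` and `f_R`, and for
`M_w`, from `M_w(0, ·)` and `M_w(1, ·)`. -/
def glue (hL hR : V → ℝ) (v : V) : ℝ :=
  if 0 < v 0 then hL v else if v 0 < 0 then hR v else 0

/-- Outward trace norm `‖·‖_{L¹_{γ,⟨v⟩,+}}` of boundary values `h₀` at `x = 0`, `h₁` at `x = 1`. -/
def traceNormOut (h₀ h₁ : V → ℝ) : ℝ :=
  (∫ v in {v : V | v 0 < 0}, |h₀ v| * (1 + ‖v‖ ^ 2)) +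
    ∫ v in {v : V | 0 < v 0}, |h₁ v| * (1 + ‖v‖ ^ 2)

/-- Inward trace norm `‖·‖_{L¹_{γ,⟨v⟩,-}}` of boundary values `h₀` at `x = 0`, `h₁` at `x = 1`. -/
def traceNormIn (h₀ h₁ : V → ℝ) : ℝ :=
  (∫ v in {v : V | 0 < v 0}, |h₀ v| * (1 + ‖v‖ ^ 2)) +
    ∫ v in {v : V | v 0 < 0}, |h₁ v| * (1 + ‖v‖ ^ 2)

/-- Trace norm `‖·‖_{L¹_{γ,⟨v⟩}}` of a function `h` of the velocity alone, regarded as a function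
of `(x, v)` that does not depend on `x`. -/
def traceNorm (h : V → ℝ) : ℝ := traceNormOut h h + traceNormIn h h

/-- Property (P₁): `f_{LR} ≥ 0` is not identically `0` (as a class modulo null sets) and has finite
trace norm `‖f_{LR}‖_{L¹_{γ,⟨v⟩}}`. -/
structure P1 (fL fR : V → ℝ) : Prop where
  nonneg : ∀ᵐ v : V, 0 ≤ glue fL fR v
  nontrivial : ¬ ∀ᵐ v : V, glue fL fR v = 0
  finite : Integrable fun v : V => glue fL fR v * (1 + ‖v‖ ^ 2)

/-- Property (P₂): no vertical flow is induced, i.e. `∫_{ℝ²} f_L v_i dv₂ dv₃ = 0` for almost every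
`v₁ > 0` and `∫_{ℝ²} f_R v_i dv₂ dv₃ = 0` for almost every `v₁ < 0`, where `i = 2, 3`. -/
structure P2 (fL fR : V → ℝ) : Prop where
  left₂ : ∀ᵐ s : ℝ, 0 < s → ∫ w : ℝ × ℝ, fL !₂[s, w.1, w.2] * w.1 = 0
  left₃ : ∀ᵐ s : ℝ, 0 < s → ∫ w : ℝ × ℝ, fL !₂[s, w.1, w.2] * w.2 = 0
  right₂ : ∀ᵐ s : ℝ, s < 0 → ∫ w : ℝ × ℝ, fR !₂[s, w.1, w.2] * w.1 = 0
  right₃ : ∀ᵐ s : ℝ, s < 0 → ∫ w : ℝ × ℝ, fR !₂[s, w.1, w.2] * w.2 = 0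

/-- `C_{LR,1} = ‖f_{LR}‖_{L¹_{γ,⟨v⟩}} ‖M_w‖_{L¹_{γ,⟨v⟩}}`, with wall temperatures `θ₀` at `x = 0` and
`θ₁` at `x = 1`. -/
def CLR (θ₀ θ₁ : ℝ) (fL fR : V → ℝ) : ℝ :=
  traceNorm (glue fL fR) * traceNorm (glue (wallMaxwellian θ₀) (wallMaxwellian θ₁))

/-- `a_{ℓ,1} = ∫ e^{-1/|v₁|} f_{LR} dv`. -/
def aEll (fL fR : V → ℝ) : ℝ := ∫ v : V, Real.exp (-(1 / |v 0|)) * glue fL fR v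

/-- `γ_{ℓ,1} = (∫_{v₁>0} e^{-1/|v₁|} f_L |v₁| dv) (∫_{v₁<0} e^{-1/|v₁|} f_R |v₁| dv)`. -/
def gammaEll (fL fR : V → ℝ) : ℝ :=
  (∫ v in {v : V | 0 < v 0}, Real.exp (-(1 / |v 0|)) * fL v * |v 0|) *
    ∫ v in {v : V | v 0 < 0}, Real.exp (-(1 / |v 0|)) * fR v * |v 0|

/-- `a_{-1/2,1} = inf_{|κ|=1} ∫ e^{-1/|v₁|} f_{LR} {|v|² - (v·κ)²} dv`. -/
def aCrit (fL fR : V → ℝ) : ℝ :=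
  ⨅ κ : Metric.sphere (0 : V) 1,
    ∫ v : V, Real.exp (-(1 / |v 0|)) * glue fL fR v * (‖v‖ ^ 2 - (inner ℝ v (κ : V)) ^ 2)

/-- The discrepancy `|∫_{v₁>0} f_L |v₁| dv - ∫_{v₁<0} f_R |v₁| dv|` of the boundary fluxes. -/
def fluxDiscrepancy (fL fR : V → ℝ) : ℝ :=
  abs ((∫ v in {v : V | 0 < v 0}, fL v * |v 0|) - (∫ v in {v : V | v 0 < 0}, fR v * |v 0|))

/-! ### Mild solutions -/

/-- `f` is a mild solution of `v₁ ∂ₓ f = (ℳ_ν(f) - f) / τ` on `[0, 1] × ℝ³` with the mixed boundary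
conditions of weights `δ₁` (inflow), `δ₂` (diffuse), `δ₃` (specular). The representative is the one
for which the integral equation holds at every `x ∈ [0, 1]`, for almost every `v`; its traces are then
its values at `x = 0` and `x = 1`. The second and third fields say that
`f ∈ L^∞([0,1]; L¹₂(ℝ³))` and, at `x = 0` and `x = 1`, that the trace lies in `L¹_{γ,⟨v⟩}`. -/
structure IsMildSolution (ν τ δ₁ δ₂ δ₃ θ₀ θ₁ : ℝ) (fL fR : V → ℝ) (f : ℝ → V → ℝ) : Prop where
  measurable : AEStronglyMeasurable (Function.uncurry f)
    ((volume.restrict (Icc (0 : ℝ) 1)).prod (volume : Measure V))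
  integrable : ∀ x ∈ Icc (0 : ℝ) 1, Integrable fun v : V => f x v * (1 + ‖v‖ ^ 2)
  bounded : ∃ B : ℝ, ∀ x ∈ Icc (0 : ℝ) 1, ∫ v : V, |f x v| * (1 + ‖v‖ ^ 2) ≤ B
  gaussian_integrable : ∀ᵐ v : V,
    IntervalIntegrable (fun y => ellipsoidalGaussian ν (f y) v) volume 0 1
  mild_pos : ∀ᵐ v : V, 0 < v 0 → ∀ x ∈ Icc (0 : ℝ) 1,
    f x v = Real.exp (-(x / (τ * |v 0|))) * f 0 v +
      1 / (τ * |v 0|) *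
        ∫ y in (0 : ℝ)..x, Real.exp (-((x - y) / (τ * |v 0|))) * ellipsoidalGaussian ν (f y) v
  mild_neg : ∀ᵐ v : V, v 0 < 0 → ∀ x ∈ Icc (0 : ℝ) 1,
    f x v = Real.exp (-((1 - x) / (τ * |v 0|))) * f 1 v +
      1 / (τ * |v 0|) *
        ∫ y in x..(1 : ℝ), Real.exp (-((y - x) / (τ * |v 0|))) * ellipsoidalGaussian ν (f y) v
  boundary_left : ∀ᵐ v : V, 0 < v 0 →
    f 0 v = δ₁ * fL v
      + δ₂ * (∫ w in {w : V | w 0 < 0}, f 0 w * |w 0|) * wallMaxwellian θ₀ v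
      + δ₃ * f 0 (reflect v)
  boundary_right : ∀ᵐ v : V, v 0 < 0 →
    f 1 v = δ₁ * fR v
      + δ₂ * (∫ w in {w : V | 0 < w 0}, f 1 w * |w 0|) * wallMaxwellian θ₁ v
      + δ₃ * f 1 (reflect v)

/-- `f ≥ 0`. -/
def Nonneg (f : ℝ → V → ℝ) : Prop := ∀ᵐ v : V, ∀ x ∈ Icc (0 : ℝ) 1, 0 ≤ f x v

/-- Two solutions are identified when they agree for almost every velocity, at all positions. -/
def SameSolution (f g : ℝ → V → ℝ) : Prop := ∀ᵐ v : V, ∀ x ∈ Icc (0 : ℝ) 1, f x v = g x v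

/-- The bounds on density, energy and temperature tensor in the non-critical case, with
`C¹_ν = min {1 - ν, 1 + 2ν}` and `C²_ν = max {1 - ν, 1 + 2ν}`. -/
def NoncriticalBounds (ν δ₁ θ₀ θ₁ : ℝ) (fL fR : V → ℝ) (f : ℝ → V → ℝ) : Prop :=
  ∀ x ∈ Icc (0 : ℝ) 1,
    aEll fL fR ≤ ∫ v : V, f x v ∧
    ∫ v : V, f x v * (1 + ‖v‖ ^ 2) ≤ 2 * CLR θ₀ θ₁ fL fR ∧
    ∀ κ : V, ‖κ‖ = 1 →
      min (1 - ν) (1 + 2 * ν) * δ₁ ^ 2 * (gammaEll fL fR / (3 * CLR θ₀ θ₁ fL fR ^ 2))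
          ≤ quadForm (temperatureTensor ν (f x)) κ ∧
      quadForm (temperatureTensor ν (f x)) κ
          ≤ 2 / (3 * aEll fL fR * δ₁) * max (1 - ν) (1 + 2 * ν) * CLR θ₀ θ₁ fL fR

/-- The bounds on density, energy and temperature tensor in the critical case `ν = -1/2`. -/
def CriticalBounds (δ₁ θ₀ θ₁ : ℝ) (fL fR : V → ℝ) (f : ℝ → V → ℝ) : Prop :=
  ∀ x ∈ Icc (0 : ℝ) 1,
    δ₁ * aEll fL fR ≤ ∫ v : V, f x v ∧
    ∫ v : V, f x v * ‖v‖ ^ 2 ≤ 2 * CLR θ₀ θ₁ fL fR ∧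
    ∀ κ : V, ‖κ‖ = 1 →
      δ₁ * (aCrit fL fR / (2 * CLR θ₀ θ₁ fL fR))
          ≤ quadForm (temperatureTensor (-1 / 2) (f x)) κ ∧
      quadForm (temperatureTensor (-1 / 2) (f x)) κ
          ≤ 3 / (2 * aEll fL fR) * CLR θ₀ θ₁ fL fR

end ESBGK

end

open ESBGK

/-
A mild solution is a fixed point of a transport operator: data, diffuse and specular re-emission
and collisions, all damped along the characteristics. A collision contributes the fraction
`1 - exp (-1 / (τ |v₁|))` of a Gaussian, and by dominated convergence its energy norm tends to `0`
as `τ → ∞`, uniformly over the Gaussians whose moments lie in a compact set of nondegenerate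
moments. On such a set the Gaussian is Lipschitz in the moments. So for large `τ` and small
`δ₂ + δ₃` the operator is a contraction, and its fixed point stays close to the freely transported
data.

The fixed point also lies above `δ₁ exp (-1 / |v₁|) f_LR`, and this keeps its moments
nondegenerate. In the noncritical case every direction of the temperature tensor is bounded below by
a multiple of the temperature. For `ν = -1/2` the density times the tensor in the direction `κ` is
half the energy transverse to `κ`, up to the square of the momentum divided by the density; the
momentum is small because it is nearly that of the data, whose normal and transverse parts are
controlled by the flux discrepancy and by `(P₂)`.
-/

noncomputable section

namespace ESBGK

/-- Values of the mass, the momentum and the second moments of a velocity distribution. The same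
type holds the coefficients of a quadratic polynomial in the velocity, see `Moments.poly`. -/
abbrev Moments : Type := ℝ × (Fin 3 → ℝ) × (Fin 3 → Fin 3 → ℝ)

/-- The moments `∫ g`, `∫ g v`, `∫ g v ⊗ v` of `g`. The second moments are not centred, so that the
moments are linear in `g`. -/
def moments (g : V → ℝ) : Moments :=
  (∫ v, g v, fun i => ∫ v, g v * v i, fun i j => ∫ v, g v * (v i * v j))

theorem quadForm_eq_sum (A : Matrix (Fin 3) (Fin 3) ℝ) (κ : V) :
    quadForm A κ = ∑ i, ∑ j, A i j * (κ i * κ j) := by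
  simp only [quadForm, dotProduct, Matrix.mulVec, Finset.mul_sum]
  refine Finset.sum_congr rfl fun i _ => Finset.sum_congr rfl fun j _ => ?_
  ring

theorem quadForm_smul (A : Matrix (Fin 3) (Fin 3) ℝ) (a : ℝ) (κ : V) :
    quadForm A (a • κ) = a ^ 2 * quadForm A κ := by
  simp only [quadForm_eq_sum, PiLp.smul_apply, smul_eq_mul, Finset.mul_sum]
  refine Finset.sum_congr rfl fun i _ => Finset.sum_congr rfl fun j _ => ?_
  ring

section Calculus

variable {E F : Type*} [NormedAddCommGroup E] [NormedSpace ℝ E] [NormedAddCommGroup F]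
  [NormedSpace ℝ F] {n : Type*} [Fintype n] [DecidableEq n] {k : WithTop ℕ∞}

theorem contDiffAt_det {M : E → Matrix n n ℝ} {x : E}
    (hM : ∀ i j, ContDiffAt ℝ k (fun y => M y i j) x) :
    ContDiffAt ℝ k (fun y => (M y).det) x := by
  simp only [Matrix.det_apply]
  exact ContDiffAt.sum fun σ _ => (contDiffAt_prod fun i _ => hM _ _).const_smul _

theorem contDiffAt_matrix_inv {M : E → Matrix n n ℝ} {x : E}
    (hM : ∀ i j, ContDiffAt ℝ k (fun y => M y i j) x) (hdet : (M x).det ≠ 0) (i j : n) :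
    ContDiffAt ℝ k (fun y => (M y)⁻¹ i j) x := by
  simp only [Matrix.inv_def, Ring.inverse_eq_inv', Matrix.smul_apply, smul_eq_mul,
    Matrix.adjugate_apply]
  refine ((contDiffAt_det hM).inv hdet).mul (contDiffAt_det fun a b => ?_)
  rcases eq_or_ne a j with rfl | ha
  · simpa only [Matrix.updateRow_self] using contDiffAt_const
  · simpa only [Matrix.updateRow_ne ha] using hM a b

theorem exists_norm_le_and_lipschitz_of_contDiffAt {s : Set E} (hs : IsCompact s) {f : E → F}
    (hf : ∀ x ∈ s, ContDiffAt ℝ 1 f x) :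
    ∃ K : ℝ, 0 ≤ K ∧ (∀ x ∈ s, ‖f x‖ ≤ K) ∧ ∀ x ∈ s, ∀ y ∈ s, ‖f x - f y‖ ≤ K * ‖x - y‖ := by
  have hloc : LocallyLipschitzOn s f := fun x hx => by
    obtain ⟨K, t, ht, hK⟩ := (hf x hx).exists_lipschitzOnWith
    exact ⟨K, t, mem_nhdsWithin_of_mem_nhds ht, hK⟩
  obtain ⟨K, hK⟩ := hloc.exists_lipschitzOnWith_of_compact hs
  obtain ⟨M, hM⟩ := hs.exists_bound_of_continuousOn hloc.continuousOn
  refine ⟨max K M, K.2.trans (le_max_left _ _), fun x hx => (hM x hx).trans (le_max_right _ _),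
    fun x hx y hy => (hK.norm_sub_le hx hy).trans ?_⟩
  gcongr
  exact le_max_left _ _

end Calculus

theorem abs_mul_exp_sub_mul_exp_le (a b x y : ℝ) :
    |a * Real.exp x - b * Real.exp y| ≤ (|a - b| + |b| * |x - y|) * Real.exp (max x y) := by
  have hexp : |Real.exp x - Real.exp y| ≤ |x - y| * Real.exp (max x y) := by
    wlog h : y ≤ x generalizing x y
    · rw [abs_sub_comm, abs_sub_comm x, max_comm]
      exact this y x (le_of_not_ge h)
    rw [max_eq_left h, abs_of_nonneg (sub_nonneg.2 (Real.exp_le_exp.2 h)),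
      abs_of_nonneg (sub_nonneg.2 h)]
    have hy : Real.exp y = Real.exp x * Real.exp (y - x) := by rw [← Real.exp_add]; ring_nf
    rw [hy]
    nlinarith [Real.exp_pos x, Real.add_one_le_exp (y - x)]
  calc |a * Real.exp x - b * Real.exp y|
      = |(a - b) * Real.exp x + b * (Real.exp x - Real.exp y)| := by ring_nf
    _ ≤ |a - b| * Real.exp x + |b| * |Real.exp x - Real.exp y| := by
        refine (abs_add_le _ _).trans_eq ?_
        rw [abs_mul, abs_mul, Real.abs_exp]
    _ ≤ |a - b| * Real.exp (max x y) + |b| * (|x - y| * Real.exp (max x y)) := by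
        gcongr
        exact le_max_left _ _
    _ = _ := by ring

theorem integrable_one_add_norm_sq_pow_mul_exp {E : Type*} [NormedAddCommGroup E]
    [InnerProductSpace ℝ E] [FiniteDimensional ℝ E] [MeasurableSpace E] [BorelSpace E]
    {l : ℝ} (hl : 0 < l) (k : ℕ) :
    Integrable fun v : E => (1 + ‖v‖ ^ 2) ^ k * Real.exp (-l * ‖v‖ ^ 2) := by
  have hgauss : Integrable fun v : E => Real.exp (-(l / 2) * ‖v‖ ^ 2) := by
    have h := (GaussianFourier.integrable_cexp_neg_mul_sq_norm_add
      (V := E) (b := ((l / 2 : ℝ) : ℂ)) (by simpa using hl) 0 0).re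
    refine h.congr (ae_of_all _ fun v => ?_)
    simp only [zero_mul, add_zero]
    norm_cast
  set A : ℝ := Nat.factorial k * (2 / l) ^ k
  have hpow : ∀ v : E, (1 + ‖v‖ ^ 2) ^ k ≤ A * Real.exp (l / 2 * (1 + ‖v‖ ^ 2)) := fun v =>
    calc (1 + ‖v‖ ^ 2) ^ k = A * ((l / 2 * (1 + ‖v‖ ^ 2)) ^ k / Nat.factorial k) := by
          simp only [A, mul_pow, div_pow]
          field_simp
      _ ≤ _ := by
          gcongr
          exact Real.pow_div_factorial_le_exp _ (by positivity) k
  refine (hgauss.const_mul (A * Real.exp (l / 2))).mono' (by fun_prop) (ae_of_all _ fun v => ?_)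
  rw [Real.norm_of_nonneg (by positivity)]
  calc _ ≤ A * Real.exp (l / 2 * (1 + ‖v‖ ^ 2)) * Real.exp (-l * ‖v‖ ^ 2) := by
        gcongr
        exact hpow v
    _ = _ := by
        rw [mul_assoc A, mul_assoc A, ← Real.exp_add, ← Real.exp_add]
        ring_nf

namespace Moments

variable {ν r B c : ℝ} {m : Moments}

/-- Bulk velocity of a distribution with moments `m`. -/
def velocity (m : Moments) : V := WithLp.toLp 2 fun i => m.1⁻¹ * m.2.1 i

/-- Stress tensor of a distribution with moments `m`. -/
def stress (m : Moments) : Matrix (Fin 3) (Fin 3) ℝ :=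
  Matrix.of fun i j => m.1⁻¹ * m.2.2 i j - m.1⁻¹ * m.2.1 i * (m.1⁻¹ * m.2.1 j)

/-- Temperature tensor `𝒯_ν` of a distribution with moments `m`. -/
def tensor (ν : ℝ) (m : Moments) : Matrix (Fin 3) (Fin 3) ℝ :=
  ((1 - ν) * (m.stress.trace / 3)) • (1 : Matrix (Fin 3) (Fin 3) ℝ) + ν • m.stress

/-- The factor `ρ / √det(2π 𝒯_ν)` in front of the ellipsoidal Gaussian with moments `m`. -/
def normalization (ν : ℝ) (m : Moments) : ℝ :=
  m.1 / Real.sqrt ((2 * Real.pi) • m.tensor ν).det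

/-- The ellipsoidal Gaussian with moments `m`. -/
def gaussian (ν : ℝ) (m : Moments) (v : V) : ℝ :=
  m.normalization ν * Real.exp (-(1 / 2) * quadForm (m.tensor ν)⁻¹ (v - m.velocity))

/-- The quadratic polynomial in the velocity with coefficients `m`. -/
def poly (m : Moments) (v : V) : ℝ := m.1 + ∑ i, m.2.1 i * v i + ∑ i, ∑ j, m.2.2 i j * (v i * v j)

/-- The coefficients of the exponent `-½ (v - U)ᵀ 𝒯_ν⁻¹ (v - U)` of the Gaussian, as a polynomial in
the velocity. -/
def exponent (ν : ℝ) (m : Moments) : Moments :=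
  (-(1 / 2) * ∑ i, ∑ j, (m.tensor ν)⁻¹ i j * (m.velocity i * m.velocity j),
    fun i => (1 / 2) * ∑ j, ((m.tensor ν)⁻¹ i j + (m.tensor ν)⁻¹ j i) * m.velocity j,
    fun i j => -(1 / 2) * (m.tensor ν)⁻¹ i j)

/-- Moments that stay away from vacuum, from infinity and from degenerate temperature tensors: the
set on which the Gaussian is controlled uniformly. -/
structure IsAdmissible (ν r B c : ℝ) (m : Moments) : Prop where
  density_ge : r ≤ m.1
  norm_le : ‖m‖ ≤ B
  tensor_ge : ∀ κ : V, c * ‖κ‖ ^ 2 ≤ quadForm (m.tensor ν) κ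
  symm : ∀ i j, m.2.2 i j = m.2.2 j i

theorem contDiffAt_velocity (hm : m.1 ≠ 0) (i : Fin 3) :
    ContDiffAt ℝ 1 (fun m : Moments => m.velocity i) m := by
  change ContDiffAt ℝ 1 (fun m : Moments => m.1⁻¹ * m.2.1 i) m
  fun_prop (disch := assumption)

theorem contDiffAt_stress (hm : m.1 ≠ 0) (i j : Fin 3) :
    ContDiffAt ℝ 1 (fun m : Moments => m.stress i j) m := by
  change ContDiffAt ℝ 1
    (fun m : Moments => m.1⁻¹ * m.2.2 i j - m.1⁻¹ * m.2.1 i * (m.1⁻¹ * m.2.1 j)) m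
  fun_prop (disch := assumption)

theorem contDiffAt_tensor (hm : m.1 ≠ 0) (i j : Fin 3) :
    ContDiffAt ℝ 1 (fun m : Moments => m.tensor ν i j) m := by
  simp only [tensor, Matrix.add_apply, Matrix.smul_apply, smul_eq_mul, Matrix.trace,
    Matrix.diag_apply]
  have hstress := contDiffAt_stress hm i j
  have htrace : ContDiffAt ℝ 1 (fun m : Moments => ∑ i, m.stress i i) m :=
    ContDiffAt.sum fun i _ => contDiffAt_stress hm i i
  fun_prop

theorem contDiffAt_exponent (hm : m.1 ≠ 0) (hdet : (m.tensor ν).det ≠ 0) :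
    ContDiffAt ℝ 1 (exponent ν) m := by
  have hU := fun i => contDiffAt_velocity hm i
  have hA := fun i j => contDiffAt_matrix_inv (M := tensor ν) (contDiffAt_tensor hm) hdet i j
  refine ContDiffAt.prodMk ?_ (ContDiffAt.prodMk ?_ ?_)
  · exact contDiffAt_const.mul (ContDiffAt.sum fun i _ => ContDiffAt.sum fun j _ =>
      (hA i j).mul ((hU i).mul (hU j)))
  · exact contDiffAt_pi.2 fun i => contDiffAt_const.mul (ContDiffAt.sum fun j _ =>
      ((hA i j).add (hA j i)).mul (hU j))
  · exact contDiffAt_pi.2 fun i => contDiffAt_pi.2 fun j => contDiffAt_const.mul (hA i j)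

theorem contDiffAt_normalization (hm : m.1 ≠ 0) (hdet : 0 < (m.tensor ν).det) :
    ContDiffAt ℝ 1 (normalization ν) m := by
  have hdet' : 0 < ((2 * Real.pi) • m.tensor ν).det := by
    rw [Matrix.det_smul]
    positivity
  have h := contDiffAt_det (M := fun m : Moments => (2 * Real.pi) • m.tensor ν) (x := m)
    fun i j => contDiffAt_const.mul (contDiffAt_tensor hm i j)
  exact contDiffAt_fst.div (h.sqrt hdet'.ne') (Real.sqrt_pos.2 hdet').ne'

theorem poly_exponent (m : Moments) (v : V) :
    (m.exponent ν).poly v = -(1 / 2) * quadForm (m.tensor ν)⁻¹ (v - m.velocity) := by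
  rw [quadForm_eq_sum]
  simp only [poly, exponent, Fin.sum_univ_three, PiLp.sub_apply]
  ring

theorem gaussian_eq (m : Moments) (v : V) :
    m.gaussian ν v = m.normalization ν * Real.exp ((m.exponent ν).poly v) := by
  rw [poly_exponent, gaussian]

theorem poly_sub (m m' : Moments) (v : V) : (m - m').poly v = m.poly v - m'.poly v := by
  simp only [poly, Prod.fst_sub, Prod.snd_sub, Pi.sub_apply, Fin.sum_univ_three]
  ring

theorem abs_poly_le (m : Moments) (v : V) : |m.poly v| ≤ 13 * ‖m‖ * (1 + ‖v‖ ^ 2) := by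
  have hm₁ : ∀ i, ‖m.2.1 i‖ ≤ ‖m‖ := fun i =>
    (norm_le_pi_norm m.2.1 i).trans ((norm_fst_le m.2).trans (norm_snd_le m))
  have hm₂ : ∀ i j, ‖m.2.2 i j‖ ≤ ‖m‖ := fun i j =>
    (norm_le_pi_norm (m.2.2 i) j).trans ((norm_le_pi_norm m.2.2 i).trans
      ((norm_snd_le m.2).trans (norm_snd_le m)))
  have hlin : ‖∑ i, m.2.1 i * v i‖ ≤ ∑ _i : Fin 3, ‖m‖ * ‖v‖ :=
    norm_sum_le_of_le _ fun i _ =>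
      norm_mul_le_of_le (hm₁ i) (PiLp.norm_apply_le v i)
  have hquad : ‖∑ i, ∑ j, m.2.2 i j * (v i * v j)‖ ≤
      ∑ _i : Fin 3, ∑ _j : Fin 3, ‖m‖ * (‖v‖ * ‖v‖) :=
    norm_sum_le_of_le _ fun i _ => norm_sum_le_of_le _ fun j _ =>
      norm_mul_le_of_le (hm₂ i j)
        (norm_mul_le_of_le (PiLp.norm_apply_le v i) (PiLp.norm_apply_le v j))
  simp only [Finset.sum_const, Finset.card_univ, Fintype.card_fin, nsmul_eq_mul] at hlin hquad
  push_cast at hlin hquad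
  have hsum : |m.poly v| ≤ ‖m‖ + 3 * (‖m‖ * ‖v‖) + 3 * (3 * (‖m‖ * (‖v‖ * ‖v‖))) :=
    norm_add_le_of_le (norm_add_le_of_le (norm_fst_le m) hlin) hquad
  nlinarith [mul_nonneg (norm_nonneg m) (sq_nonneg (‖v‖ - 1)),
    mul_nonneg (norm_nonneg m) (sq_nonneg ‖v‖)]

namespace IsAdmissible

theorem density_pos (hr : 0 < r) (hm : m.IsAdmissible ν r B c) : 0 < m.1 :=
  hr.trans_le hm.density_ge

theorem posDef_tensor (hc : 0 < c) (hm : m.IsAdmissible ν r B c) : (m.tensor ν).PosDef := by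
  refine Matrix.PosDef.of_dotProduct_mulVec_pos ?_ fun x hx => ?_
  · ext i j
    simp only [Matrix.conjTranspose_apply, star_trivial, tensor, stress, Matrix.add_apply,
      Matrix.smul_apply, Matrix.of_apply, Matrix.one_apply, hm.symm j i, eq_comm (a := j)]
    ring
  · have hnorm : 0 < ‖(WithLp.toLp 2 x : V)‖ := norm_pos_iff.2 (by simpa using hx)
    exact lt_of_lt_of_le (by positivity) (hm.tensor_ge (WithLp.toLp 2 x))

theorem quadForm_inv_pos (hc : 0 < c) (hm : m.IsAdmissible ν r B c) {w : V} (hw : w ≠ 0) :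
    0 < quadForm (m.tensor ν)⁻¹ w := by
  simpa [quadForm] using (hm.posDef_tensor hc).inv.dotProduct_mulVec_pos
    (x := w.ofLp) (by simpa using hw)

theorem normalization_nonneg (hr : 0 < r) (hm : m.IsAdmissible ν r B c) :
    0 ≤ m.normalization ν :=
  div_nonneg (hm.density_pos hr).le (Real.sqrt_nonneg _)

end IsAdmissible

theorem isCompact_isAdmissible (hr : 0 < r) : IsCompact {m | IsAdmissible ν r B c m} := by
  refine Metric.isCompact_of_isClosed_isBounded ?_
    (Metric.isBounded_closedBall (x := (0 : Moments)) (r := B) |>.subset fun m hm => by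
      simpa using hm.norm_le)
  have hdensity : IsClosed {m : Moments | r ≤ m.1} := isClosed_le continuous_const continuous_fst
  have htensor : ∀ κ : V, IsClosed
      ({m : Moments | r ≤ m.1} ∩ (fun m => quadForm (m.tensor ν) κ) ⁻¹' Ici (c * ‖κ‖ ^ 2)) := by
    refine fun κ =>
      ContinuousOn.preimage_isClosed_of_isClosed (fun m hm => ?_) hdensity isClosed_Ici
    simp only [quadForm_eq_sum]
    exact tendsto_finsetSum _ fun i _ => tendsto_finsetSum _ fun j _ =>
      (contDiffAt_tensor (hr.trans_le hm).ne' i j).continuousAt.continuousWithinAt.mul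
        continuousWithinAt_const
  have hnorm : IsClosed {m : Moments | ‖m‖ ≤ B} := isClosed_le continuous_norm continuous_const
  have hsymm : IsClosed {m : Moments | ∀ i j, m.2.2 i j = m.2.2 j i} := by
    simp only [ofPred_forall]
    exact isClosed_iInter fun i => isClosed_iInter fun j =>
      isClosed_eq (by fun_prop) (by fun_prop)
  convert! ((hdensity.inter hnorm).inter (isClosed_iInter htensor)).inter hsymm using 1
  ext m
  simp only [mem_ofPred_eq, mem_inter_iff, mem_iInter, mem_preimage, mem_Ici]
  exact ⟨fun h => ⟨⟨⟨h.density_ge, h.norm_le⟩, fun κ => ⟨h.density_ge, h.tensor_ge κ⟩⟩, h.symm⟩,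
    fun h => ⟨h.1.1.1, h.1.1.2, fun κ => (h.1.2 κ).2, h.2⟩⟩

theorem exists_quadForm_inv_ge (hr : 0 < r) (hc : 0 < c) :
    ∃ l > 0, ∀ m, IsAdmissible ν r B c m → ∀ w : V, l * ‖w‖ ^ 2 ≤ quadForm (m.tensor ν)⁻¹ w := by
  rcases {m | IsAdmissible ν r B c m}.eq_empty_or_nonempty with hempty | hne
  · exact ⟨1, one_pos, fun m hm => (hempty.subset hm).elim⟩
  have hcont : ContinuousOn (fun q : Moments × V => quadForm (q.1.tensor ν)⁻¹ q.2)
      ({m | IsAdmissible ν r B c m} ×ˢ Metric.sphere (0 : V) 1) := by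
    simp only [quadForm_eq_sum]
    refine continuousOn_finsetSum _ fun i _ => continuousOn_finsetSum _ fun j _ =>
      ContinuousOn.mul (fun q hq => ?_) (by fun_prop)
    have hinv := (contDiffAt_matrix_inv (M := tensor ν)
      (contDiffAt_tensor (hq.1.density_pos hr).ne') (hq.1.posDef_tensor hc).det_pos.ne'
      i j).continuousAt
    exact (ContinuousAt.comp (f := Prod.fst) hinv continuousAt_fst).continuousWithinAt
  obtain ⟨q, hq, hmin⟩ := ((isCompact_isAdmissible hr).prod
    (isCompact_sphere (0 : V) 1)).exists_isMinOn
    (hne.prod ⟨EuclideanSpace.single 0 1, by simp⟩) hcont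
  refine ⟨_, hq.1.quadForm_inv_pos hc (ne_zero_of_mem_unit_sphere ⟨q.2, hq.2⟩), fun m hm w => ?_⟩
  rcases eq_or_ne w 0 with rfl | hw
  · simp [quadForm]
  have hw' : 0 < ‖w‖ := norm_pos_iff.2 hw
  have hunit : ‖w‖⁻¹ • w ∈ Metric.sphere (0 : V) 1 := by simp [norm_smul, hw'.ne']
  calc quadForm (q.1.tensor ν)⁻¹ q.2 * ‖w‖ ^ 2
      ≤ quadForm (m.tensor ν)⁻¹ (‖w‖⁻¹ • w) * ‖w‖ ^ 2 := by
        gcongr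
        exact isMinOn_iff.1 hmin (m, ‖w‖⁻¹ • w) ⟨hm, hunit⟩
    _ = quadForm (m.tensor ν)⁻¹ w := by
        rw [quadForm_smul]
        field_simp

theorem exists_exp_exponent_le (hr : 0 < r) (hc : 0 < c) :
    ∃ X l : ℝ, 0 < X ∧ 0 < l ∧ ∀ m, IsAdmissible ν r B c m → ∀ v,
      Real.exp ((m.exponent ν).poly v) ≤ X * Real.exp (-l * ‖v‖ ^ 2) := by
  obtain ⟨l, hl, hquad⟩ := exists_quadForm_inv_ge (ν := ν) (B := B) hr hc
  obtain ⟨K, -, hK, -⟩ := exists_norm_le_and_lipschitz_of_contDiffAt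
    (isCompact_isAdmissible (ν := ν) (B := B) (c := c) hr) (f := velocity)
    fun m hm => (contDiffAt_piLp 2).2 fun i => contDiffAt_velocity (hm.density_pos hr).ne' i
  refine ⟨Real.exp (l / 2 * K ^ 2), l / 4, Real.exp_pos _, by positivity, fun m hm v => ?_⟩
  rw [← Real.exp_add, poly_exponent, Real.exp_le_exp]
  have hnorm : ‖v‖ ≤ ‖v - m.velocity‖ + K := by
    linarith [norm_le_norm_sub_add v m.velocity, hK m hm]
  have hsq : ‖v‖ ^ 2 ≤ 2 * ‖v - m.velocity‖ ^ 2 + 2 * K ^ 2 := by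
    nlinarith [norm_nonneg v, sq_nonneg (‖v - m.velocity‖ - K), norm_nonneg (v - m.velocity)]
  nlinarith [hquad m hm (v - m.velocity)]

theorem exists_abs_poly_exponent_sub_le (hr : 0 < r) (hc : 0 < c) :
    ∃ K : ℝ, 0 ≤ K ∧ ∀ m, IsAdmissible ν r B c m → ∀ m', IsAdmissible ν r B c m' → ∀ v,
      |(m.exponent ν).poly v - (m'.exponent ν).poly v| ≤ K * ‖m - m'‖ * (1 + ‖v‖ ^ 2) := by
  obtain ⟨K, hK₀, -, hK⟩ := exists_norm_le_and_lipschitz_of_contDiffAt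
    (isCompact_isAdmissible (ν := ν) (B := B) (c := c) hr)
    fun m hm => contDiffAt_exponent (hm.density_pos hr).ne' (hm.posDef_tensor hc).det_pos.ne'
  refine ⟨13 * K, by positivity, fun m hm m' hm' v => ?_⟩
  rw [← poly_sub, mul_assoc 13]
  refine (abs_poly_le _ _).trans ?_
  gcongr
  exact hK m hm m' hm'

theorem exists_gaussian_lipschitz (hr : 0 < r) (hc : 0 < c) :
    ∃ Ψ : V → ℝ, (∀ v, 0 ≤ Ψ v) ∧ Integrable (fun v => Ψ v * (1 + ‖v‖ ^ 2)) ∧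
      (∀ m, IsAdmissible ν r B c m → ∀ v, 0 ≤ m.gaussian ν v ∧ m.gaussian ν v ≤ Ψ v) ∧
      ∀ m, IsAdmissible ν r B c m → ∀ m', IsAdmissible ν r B c m' → ∀ v,
        |m.gaussian ν v - m'.gaussian ν v| ≤ ‖m - m'‖ * Ψ v := by
  obtain ⟨X, l, hX, hl, hexp⟩ := exists_exp_exponent_le (ν := ν) (B := B) hr hc
  obtain ⟨N, hN₀, hN, hN'⟩ := exists_norm_le_and_lipschitz_of_contDiffAt
    (isCompact_isAdmissible (ν := ν) (B := B) (c := c) hr)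
    fun m hm => contDiffAt_normalization (hm.density_pos hr).ne' (hm.posDef_tensor hc).det_pos
  obtain ⟨K, hK₀, hK⟩ := exists_abs_poly_exponent_sub_le (ν := ν) (B := B) hr hc
  have hweight : ∀ v : V, 1 ≤ 1 + ‖v‖ ^ 2 := fun v => le_add_of_nonneg_right (sq_nonneg _)
  refine ⟨fun v => (N + N * K) * X * (1 + ‖v‖ ^ 2) * Real.exp (-l * ‖v‖ ^ 2),
    fun v => by positivity, ?_, fun m hm v => ?_, fun m hm m' hm' v => ?_⟩
  · refine ((integrable_one_add_norm_sq_pow_mul_exp hl 2).const_mul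
      ((N + N * K) * X)).congr (ae_of_all _ fun v => ?_)
    ring
  · rw [gaussian_eq]
    refine ⟨mul_nonneg (hm.normalization_nonneg hr) (Real.exp_pos _).le, ?_⟩
    calc _ ≤ N * (X * Real.exp (-l * ‖v‖ ^ 2)) :=
          mul_le_mul ((le_abs_self _).trans (hN m hm)) (hexp m hm v) (Real.exp_pos _).le hN₀
      _ = N * X * 1 * Real.exp (-l * ‖v‖ ^ 2) := by ring
      _ ≤ _ := by
          beta_reduce
          gcongr
          exacts [le_add_of_nonneg_right (by positivity), hweight v]
  · have hpoly := hK m hm m' hm' v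
    have hmax : Real.exp (max ((m.exponent ν).poly v) ((m'.exponent ν).poly v)) ≤
        X * Real.exp (-l * ‖v‖ ^ 2) := by
      rcases max_choice ((m.exponent ν).poly v) ((m'.exponent ν).poly v) with h | h <;> rw [h]
      exacts [hexp m hm v, hexp m' hm' v]
    rw [gaussian_eq, gaussian_eq]
    calc _ ≤ (N * ‖m - m'‖ * (1 + ‖v‖ ^ 2) + N * (K * ‖m - m'‖ * (1 + ‖v‖ ^ 2))) *
          (X * Real.exp (-l * ‖v‖ ^ 2)) := by
          refine (abs_mul_exp_sub_mul_exp_le _ _ _ _).trans ?_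
          gcongr
          · exact (hN' m hm m' hm').trans (le_mul_of_one_le_right (by positivity) (hweight v))
          · exact hN m' hm'
      _ = _ := by ring

theorem continuousOn_gaussian (hr : 0 < r) (hc : 0 < c) :
    ContinuousOn (fun q : Moments × V => q.1.gaussian ν q.2)
      ({m | IsAdmissible ν r B c m} ×ˢ univ) := by
  simp only [gaussian_eq]
  intro q hq
  have hN := (contDiffAt_normalization (ν := ν) (hq.1.density_pos hr).ne'
    (hq.1.posDef_tensor hc).det_pos).continuousAt.comp (f := Prod.fst) (x := q) continuousAt_fst
  have hE := (contDiffAt_exponent (ν := ν) (hq.1.density_pos hr).ne'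
    (hq.1.posDef_tensor hc).det_pos.ne').continuousAt.comp (f := Prod.fst) (x := q) continuousAt_fst
  have hpoly : Continuous fun q : Moments × V => q.1.poly q.2 := by
    unfold poly
    fun_prop
  exact (hN.mul (Real.continuous_exp.continuousAt.comp
    (hpoly.continuousAt.comp (hE.prodMk continuousAt_snd)))).continuousWithinAt

end Moments

/-- `g` belongs to the weighted space `L¹₂(ℝ³)`. -/
def HasFiniteEnergy (g : V → ℝ) : Prop := Integrable fun v : V => g v * (1 + ‖v‖ ^ 2)

/-- The norm `∫ |g| (1 + |v|²) dv` of `L¹₂(ℝ³)`. -/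
def energyNorm (g : V → ℝ) : ℝ := ∫ v, |g v| * (1 + ‖v‖ ^ 2)

/-- The thermal energy `∫ g |v - U|² dv = 3ρT`. -/
def thermalEnergy (g : V → ℝ) : ℝ := ∫ v, g v * ‖v - bulkVelocity g‖ ^ 2

/-- The thermal energy `∫ g ((v - U)·κ)² dv = ρ κᵀΘκ` in the direction `κ`. -/
def thermalEnergyAlong (g : V → ℝ) (κ : V) : ℝ := ∫ v, g v * inner ℝ (v - bulkVelocity g) κ ^ 2

theorem energyNorm_nonneg (g : V → ℝ) : 0 ≤ energyNorm g := integral_nonneg fun v => by positivity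

theorem energyNorm_of_nonneg {g : V → ℝ} (hg : ∀ᵐ v, 0 ≤ g v) :
    energyNorm g = ∫ v, g v * (1 + ‖v‖ ^ 2) :=
  integral_congr_ae (hg.mono fun v hv => by simp only [abs_of_nonneg hv])

theorem energyNorm_const_mul (c : ℝ) (g : V → ℝ) :
    (energyNorm fun v => c * g v) = |c| * energyNorm g := by
  simp only [energyNorm, abs_mul, mul_assoc, integral_const_mul]

theorem energyNorm_congr {g h : V → ℝ} (hgh : ∀ᵐ v, g v = h v) : energyNorm g = energyNorm h :=
  integral_congr_ae (hgh.mono fun v hv => by simp only [hv])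

theorem energyNorm_abs (g : V → ℝ) : (energyNorm fun v => |g v|) = energyNorm g := by
  simp only [energyNorm, abs_abs]

theorem norm_le_one_add_norm_sq (v : V) : ‖v‖ ≤ 1 + ‖v‖ ^ 2 := by
  nlinarith [sq_nonneg (‖v‖ - 1), sq_nonneg ‖v‖]

theorem abs_apply_le (v : V) (i : Fin 3) : |v i| ≤ 1 + ‖v‖ ^ 2 :=
  (PiLp.norm_apply_le v i).trans (norm_le_one_add_norm_sq v)

theorem abs_apply_mul_apply_le (v : V) (i j : Fin 3) : |v i * v j| ≤ ‖v‖ ^ 2 := by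
  rw [abs_mul, sq]
  exact mul_le_mul (PiLp.norm_apply_le v i) (PiLp.norm_apply_le v j) (abs_nonneg _) (norm_nonneg _)

theorem norm_sub_sq_le (v w : V) : ‖v - w‖ ^ 2 ≤ (2 + 2 * ‖w‖ ^ 2) * (1 + ‖v‖ ^ 2) := by
  nlinarith [norm_sub_le v w, sq_nonneg (‖v‖ - ‖w‖), norm_nonneg (v - w), sq_nonneg ‖v‖,
    mul_nonneg (sq_nonneg ‖v‖) (sq_nonneg ‖w‖)]

namespace HasFiniteEnergy

variable {g h q : V → ℝ}

theorem aestronglyMeasurable (hg : HasFiniteEnergy g) : AEStronglyMeasurable g := by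
  have hweight : AEStronglyMeasurable (fun v : V => (1 + ‖v‖ ^ 2)⁻¹) :=
    (Continuous.inv₀ (by fun_prop) fun v => by positivity).aestronglyMeasurable
  refine (Integrable.aestronglyMeasurable hg |>.mul hweight).congr (ae_of_all _ fun v => ?_)
  have : (1 + ‖v‖ ^ 2) ≠ 0 := by positivity
  simp [this]

theorem mono (hg : HasFiniteEnergy g) (hh : AEStronglyMeasurable h)
    (hle : ∀ᵐ v, |h v| ≤ |g v|) : HasFiniteEnergy h := by
  refine Integrable.mono hg (hh.mul (by fun_prop)) ?_
  filter_upwards [hle] with v hv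
  rw [norm_mul, norm_mul]
  exact mul_le_mul_of_nonneg_right hv (norm_nonneg _)

theorem sub (hg : HasFiniteEnergy g) (hh : HasFiniteEnergy h) :
    HasFiniteEnergy fun v => g v - h v :=
  (Integrable.sub hg hh).congr (ae_of_all _ fun v => by simp only [Pi.sub_apply, sub_mul])

theorem add (hg : HasFiniteEnergy g) (hh : HasFiniteEnergy h) :
    HasFiniteEnergy fun v => g v + h v :=
  (Integrable.add hg hh).congr (ae_of_all _ fun v => by simp only [Pi.add_apply, add_mul])

theorem const_mul (hg : HasFiniteEnergy g) (c : ℝ) : HasFiniteEnergy fun v => c * g v :=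
  (Integrable.const_mul hg c).congr (ae_of_all _ fun v => by simp only [mul_assoc])

theorem integrable_abs_mul (hg : HasFiniteEnergy g) :
    Integrable fun v : V => |g v| * (1 + ‖v‖ ^ 2) := by
  refine (Integrable.norm hg).congr (ae_of_all _ fun v => ?_)
  simp only [norm_mul, Real.norm_eq_abs, abs_of_nonneg (by positivity : (0 : ℝ) ≤ 1 + ‖v‖ ^ 2)]

theorem energyNorm_mono (hg : HasFiniteEnergy g) (hle : ∀ᵐ v, |h v| ≤ |g v|) :
    energyNorm h ≤ energyNorm g := by
  refine integral_mono_of_nonneg (ae_of_all _ fun v => by positivity) hg.integrable_abs_mul ?_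
  filter_upwards [hle] with v hv
  exact mul_le_mul_of_nonneg_right hv (by positivity)

theorem energyNorm_add_le (hg : HasFiniteEnergy g) (hh : HasFiniteEnergy h) :
    (energyNorm fun v => g v + h v) ≤ energyNorm g + energyNorm h := by
  rw [energyNorm, energyNorm, energyNorm,
    ← integral_add hg.integrable_abs_mul hh.integrable_abs_mul]
  refine integral_mono (hg.add hh).integrable_abs_mul
    (hg.integrable_abs_mul.add hh.integrable_abs_mul) fun v => ?_
  simp only [← add_mul]
  exact mul_le_mul_of_nonneg_right (abs_add_le _ _) (by positivity)

theorem ae_eq_zero_of_energyNorm_le (hg : HasFiniteEnergy g) (h0 : energyNorm g ≤ 0) :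
    ∀ᵐ v, g v = 0 := by
  have hzero := (integral_eq_zero_iff_of_nonneg (fun v => by positivity) hg.integrable_abs_mul).1
    (h0.antisymm (energyNorm_nonneg g))
  filter_upwards [hzero] with v hv
  exact abs_eq_zero.1 ((mul_eq_zero.1 hv).resolve_right (by positivity))

theorem integrable_mul {C : ℝ} (hg : HasFiniteEnergy g) (hq : AEStronglyMeasurable q)
    (hle : ∀ v, |q v| ≤ C * (1 + ‖v‖ ^ 2)) : Integrable fun v => g v * q v := by
  refine (hg.integrable_abs_mul.const_mul C).mono' (hg.aestronglyMeasurable.mul hq)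
    (ae_of_all _ fun v => ?_)
  rw [norm_mul, Real.norm_eq_abs, Real.norm_eq_abs, mul_left_comm]
  exact mul_le_mul_of_nonneg_left (hle v) (abs_nonneg _)

theorem integrable_mul_sub_apply_mul_sub_apply (hg : HasFiniteEnergy g) (w : V) (i j : Fin 3) :
    Integrable fun v => g v * ((v i - w i) * (v j - w j)) :=
  hg.integrable_mul (by fun_prop) fun v =>
    (abs_apply_mul_apply_le (v - w) i j).trans (norm_sub_sq_le v w)

theorem integrable_mul_norm_sub_sq (hg : HasFiniteEnergy g) (w : V) :
    Integrable fun v => g v * ‖v - w‖ ^ 2 :=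
  hg.integrable_mul (by fun_prop) fun v => by
    simpa only [abs_pow, abs_norm] using norm_sub_sq_le v w

theorem integrable_mul_inner_sub_sq (hg : HasFiniteEnergy g) (w κ : V) :
    Integrable fun v => g v * inner ℝ (v - w) κ ^ 2 :=
  hg.integrable_mul (C := ‖κ‖ ^ 2 * (2 + 2 * ‖w‖ ^ 2)) (by fun_prop) fun v =>
    calc |inner ℝ (v - w) κ ^ 2| = |inner ℝ (v - w) κ| ^ 2 := abs_pow _ _
      _ ≤ (‖v - w‖ * ‖κ‖) ^ 2 := by
          gcongr
          exact abs_real_inner_le_norm _ _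
      _ = ‖κ‖ ^ 2 * ‖v - w‖ ^ 2 := by ring
      _ ≤ ‖κ‖ ^ 2 * ((2 + 2 * ‖w‖ ^ 2) * (1 + ‖v‖ ^ 2)) := by
          gcongr
          exact norm_sub_sq_le v w
      _ = _ := by ring

theorem integrable (hg : HasFiniteEnergy g) : Integrable g := by
  simpa using hg.integrable_mul (q := fun _ => 1) (C := 1) (by fun_prop) fun v => by simp

theorem integrable_mul_apply (hg : HasFiniteEnergy g) (i : Fin 3) :
    Integrable fun v => g v * v i :=
  hg.integrable_mul (C := 1) (by fun_prop) fun v => by simpa using abs_apply_le v i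

theorem integrable_mul_apply_mul (hg : HasFiniteEnergy g) (i j : Fin 3) :
    Integrable fun v => g v * (v i * v j) := by
  simpa using hg.integrable_mul_sub_apply_mul_sub_apply 0 i j

theorem integrable_mul_norm_sq (hg : HasFiniteEnergy g) : Integrable fun v => g v * ‖v‖ ^ 2 := by
  simpa using hg.integrable_mul_norm_sub_sq 0

theorem integrable_mul_inner_sq (hg : HasFiniteEnergy g) (κ : V) :
    Integrable fun v => g v * inner ℝ v κ ^ 2 := by
  simpa using hg.integrable_mul_inner_sub_sq 0 κ

theorem abs_integral_mul_le (hg : HasFiniteEnergy g) (hle : ∀ v, |q v| ≤ 1 + ‖v‖ ^ 2) :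
    |∫ v, g v * q v| ≤ energyNorm g := by
  rw [← Real.norm_eq_abs]
  refine norm_integral_le_of_norm_le hg.integrable_abs_mul (ae_of_all _ fun v => ?_)
  rw [norm_mul, Real.norm_eq_abs, Real.norm_eq_abs]
  exact mul_le_mul_of_nonneg_left (hle v) (abs_nonneg _)

theorem norm_moments_le (hg : HasFiniteEnergy g) : ‖moments g‖ ≤ energyNorm g := by
  have h₀ := energyNorm_nonneg g
  refine norm_prod_le_iff.2 ⟨?_, norm_prod_le_iff.2
    ⟨(pi_norm_le_iff_of_nonneg h₀).2 fun i => hg.abs_integral_mul_le fun v => abs_apply_le v i,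
      (pi_norm_le_iff_of_nonneg h₀).2 fun i => (pi_norm_le_iff_of_nonneg h₀).2 fun j =>
        hg.abs_integral_mul_le fun v =>
          (abs_apply_mul_apply_le v i j).trans (le_add_of_nonneg_left zero_le_one)⟩⟩
  simpa [moments] using hg.abs_integral_mul_le (q := fun _ => 1) fun v => by simp

theorem moments_sub (hg : HasFiniteEnergy g) (hh : HasFiniteEnergy h) :
    (moments fun v => g v - h v) = moments g - moments h := by
  simp only [moments, sub_mul, integral_sub hg.integrable hh.integrable,
    integral_sub (hg.integrable_mul_apply _) (hh.integrable_mul_apply _),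
    integral_sub (hg.integrable_mul_apply_mul _ _) (hh.integrable_mul_apply_mul _ _)]
  rfl

theorem norm_moments_sub_le (hg : HasFiniteEnergy g) (hh : HasFiniteEnergy h) :
    ‖moments g - moments h‖ ≤ energyNorm fun v => g v - h v := by
  rw [← hg.moments_sub hh]
  exact (hg.sub hh).norm_moments_le

theorem integral_mul_inner (hg : HasFiniteEnergy g) (κ : V) :
    ∫ v, g v * inner ℝ v κ = inner ℝ (∫ v, g v • v) κ := by
  have hsmul : Integrable fun v : V => g v • v := by
    refine hg.integrable_abs_mul.mono' (hg.aestronglyMeasurable.smul (by fun_prop))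
      (ae_of_all _ fun v => ?_)
    rw [norm_smul, Real.norm_eq_abs]
    exact mul_le_mul_of_nonneg_left (norm_le_one_add_norm_sq v) (abs_nonneg _)
  rw [real_inner_comm, ← integral_inner (𝕜 := ℝ) hsmul κ]
  simp only [inner_smul_right, real_inner_comm]

theorem bulkVelocity_apply (hg : HasFiniteEnergy g) (i : Fin 3) :
    bulkVelocity g i = (density g)⁻¹ * ∫ v, g v * v i := by
  have h := hg.integral_mul_inner (EuclideanSpace.single i 1)
  simp only [EuclideanSpace.inner_single_right, one_mul, conj_trivial] at h
  rw [bulkVelocity, PiLp.smul_apply, smul_eq_mul, h]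

theorem bulkVelocity_eq (hg : HasFiniteEnergy g) : bulkVelocity g = (moments g).velocity := by
  ext i
  exact hg.bulkVelocity_apply i

theorem integral_mul_apply (hg : HasFiniteEnergy g) (hρ : density g ≠ 0) (i : Fin 3) :
    ∫ v, g v * v i = density g * bulkVelocity g i := by
  rw [hg.bulkVelocity_apply, mul_inv_cancel_left₀ hρ]

theorem integral_mul_inner_sub_sq_eq_sum (hg : HasFiniteEnergy g) (w κ : V) :
    ∫ v, g v * inner ℝ (v - w) κ ^ 2 =
      ∑ i, ∑ j, (∫ v, g v * ((v i - w i) * (v j - w j))) * (κ i * κ j) := by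
  have hexpand : ∀ v : V, g v * inner ℝ (v - w) κ ^ 2 =
      ∑ i, ∑ j, g v * ((v i - w i) * (v j - w j)) * (κ i * κ j) := fun v => by
    simp only [PiLp.inner_apply, PiLp.sub_apply, RCLike.inner_apply, conj_trivial,
      Fin.sum_univ_three]
    ring
  have hintegrable := fun i j =>
    (hg.integrable_mul_sub_apply_mul_sub_apply w i j).mul_const (κ i * κ j)
  simp only [hexpand]
  rw [integral_finsetSum _ fun i _ => integrable_finsetSum _ fun j _ => hintegrable i j]
  refine Finset.sum_congr rfl fun i _ => ?_
  rw [integral_finsetSum _ fun j _ => hintegrable i j]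
  exact Finset.sum_congr rfl fun j _ => integral_mul_const _ _

theorem integral_mul_norm_sub_sq_eq_sum (hg : HasFiniteEnergy g) (w : V) :
    ∫ v, g v * ‖v - w‖ ^ 2 = ∑ i, ∫ v, g v * ((v i - w i) * (v i - w i)) := by
  rw [← integral_finsetSum _ fun i _ => hg.integrable_mul_sub_apply_mul_sub_apply w i i]
  simp only [EuclideanSpace.norm_sq_eq, PiLp.sub_apply, Real.norm_eq_abs, sq_abs, Finset.mul_sum,
    ← sq]

theorem integral_mul_sub_bulkVelocity_apply_mul (hg : HasFiniteEnergy g) (hρ : density g ≠ 0)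
    (i j : Fin 3) :
    ∫ v, g v * ((v i - bulkVelocity g i) * (v j - bulkVelocity g j)) =
      (∫ v, g v * (v i * v j)) - density g * (bulkVelocity g i * bulkVelocity g j) := by
  have hj : Integrable fun v => bulkVelocity g i * (g v * v j) :=
    (hg.integrable_mul_apply j).const_mul _
  have hi : Integrable fun v => bulkVelocity g j * (g v * v i) :=
    (hg.integrable_mul_apply i).const_mul _
  have h₀ : Integrable fun v => bulkVelocity g i * bulkVelocity g j * g v :=
    hg.integrable.const_mul _
  have hij : Integrable fun v => g v * (v i * v j) - bulkVelocity g i * (g v * v j) :=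
    (hg.integrable_mul_apply_mul i j).sub hj
  have hi₀ : Integrable fun v =>
      bulkVelocity g j * (g v * v i) - bulkVelocity g i * bulkVelocity g j * g v := hi.sub h₀
  have hexpand : ∀ v : V, g v * ((v i - bulkVelocity g i) * (v j - bulkVelocity g j)) =
      g v * (v i * v j) - bulkVelocity g i * (g v * v j) -
        (bulkVelocity g j * (g v * v i) - bulkVelocity g i * bulkVelocity g j * g v) :=
    fun v => by ring
  simp only [hexpand]
  rw [integral_sub hij hi₀, integral_sub (hg.integrable_mul_apply_mul i j) hj, integral_sub hi h₀]
  simp only [integral_const_mul, hg.integral_mul_apply hρ, ← density.eq_1]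
  ring

theorem thermalEnergyAlong_eq (hg : HasFiniteEnergy g) (hρ : density g ≠ 0) (κ : V) :
    thermalEnergyAlong g κ =
      (∫ v, g v * inner ℝ v κ ^ 2) - density g * inner ℝ (bulkVelocity g) κ ^ 2 := by
  have h₀ := hg.integral_mul_inner_sub_sq_eq_sum 0 κ
  simp only [sub_zero, PiLp.zero_apply] at h₀
  rw [thermalEnergyAlong, h₀, hg.integral_mul_inner_sub_sq_eq_sum]
  simp only [hg.integral_mul_sub_bulkVelocity_apply_mul hρ, PiLp.inner_apply, RCLike.inner_apply,
    conj_trivial, Fin.sum_univ_three]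
  ring

theorem thermalEnergy_eq (hg : HasFiniteEnergy g) (hρ : density g ≠ 0) :
    thermalEnergy g = (∫ v, g v * ‖v‖ ^ 2) - density g * ‖bulkVelocity g‖ ^ 2 := by
  have h₀ := hg.integral_mul_norm_sub_sq_eq_sum 0
  simp only [sub_zero, PiLp.zero_apply] at h₀
  rw [thermalEnergy, h₀, hg.integral_mul_norm_sub_sq_eq_sum]
  simp only [hg.integral_mul_sub_bulkVelocity_apply_mul hρ, EuclideanSpace.norm_sq_eq,
    Real.norm_eq_abs, sq_abs, Fin.sum_univ_three]
  ring

theorem stressTensor_eq (hg : HasFiniteEnergy g) (hρ : density g ≠ 0) :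
    stressTensor g = (moments g).stress := by
  ext i j
  simp only [stressTensor, Moments.stress, Matrix.of_apply, moments,
    hg.integral_mul_sub_bulkVelocity_apply_mul hρ, hg.integral_mul_apply hρ, ← density.eq_1]
  field_simp

theorem temperature_eq (hg : HasFiniteEnergy g) (hρ : density g ≠ 0) :
    temperature g = (moments g).stress.trace / 3 := by
  rw [← hg.stressTensor_eq hρ, temperature, hg.integral_mul_norm_sub_sq_eq_sum]
  simp only [Matrix.trace, Matrix.diag_apply, stressTensor, Matrix.of_apply, ← Finset.mul_sum]
  field_simp

theorem temperatureTensor_eq (hg : HasFiniteEnergy g) (hρ : density g ≠ 0) (ν : ℝ) :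
    temperatureTensor ν g = (moments g).tensor ν := by
  rw [temperatureTensor, Moments.tensor, hg.stressTensor_eq hρ, hg.temperature_eq hρ]

theorem ellipsoidalGaussian_eq (hg : HasFiniteEnergy g) (hρ : density g ≠ 0) (ν : ℝ) (v : V) :
    ellipsoidalGaussian ν g v = (moments g).gaussian ν v := by
  rw [ellipsoidalGaussian, Moments.gaussian, Moments.normalization, hg.temperatureTensor_eq hρ,
    hg.bulkVelocity_eq]
  rfl

theorem density_mul_quadForm (hg : HasFiniteEnergy g) (hρ : density g ≠ 0) (ν : ℝ) (κ : V) :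
    density g * quadForm (temperatureTensor ν g) κ =
      (1 - ν) / 3 * ‖κ‖ ^ 2 * thermalEnergy g + ν * thermalEnergyAlong g κ := by
  have htensor : quadForm (temperatureTensor ν g) κ =
      (1 - ν) * temperature g * ‖κ‖ ^ 2 + ν * quadForm (stressTensor g) κ := by
    rw [← real_inner_self_eq_norm_sq, EuclideanSpace.inner_eq_star_dotProduct]
    simp only [quadForm, temperatureTensor, Matrix.add_mulVec, Matrix.smul_mulVec,
      Matrix.one_mulVec, dotProduct_add, dotProduct_smul, smul_eq_mul, star_trivial]
  have htemperature : density g * temperature g = 1 / 3 * thermalEnergy g := by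
    rw [temperature, thermalEnergy]
    field_simp
  have hstress : density g * quadForm (stressTensor g) κ = thermalEnergyAlong g κ := by
    rw [thermalEnergyAlong, hg.integral_mul_inner_sub_sq_eq_sum, quadForm_eq_sum]
    simp only [stressTensor, Matrix.of_apply, Finset.mul_sum]
    field_simp
  rw [htensor, ← hstress]
  linear_combination ((1 - ν) * ‖κ‖ ^ 2) * htemperature

end HasFiniteEnergy

/-- Mild solution `r` of the relaxation equation `s r' = φ - r` with zero initial value. -/
def relax (s : ℝ) (φ : ℝ → ℝ) (x : ℝ) : ℝ :=
  1 / s * ∫ y in (0 : ℝ)..x, Real.exp (-((x - y) / s)) * φ y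

section Relax

variable {s x M : ℝ} {φ ψ : ℝ → ℝ}

theorem relax_const (hs : s ≠ 0) (x M : ℝ) :
    relax s (fun _ => M) x = (1 - Real.exp (-(x / s))) * M := by
  have hderiv : ∀ y ∈ uIcc 0 x, HasDerivAt (fun y => s * Real.exp (-((x - y) / s)) * M)
      (Real.exp (-((x - y) / s)) * M) y := by
    intro y _
    have hexponent : HasDerivAt (fun y => -((x - y) / s)) (1 / s) y := by
      convert! (((hasDerivAt_id y).const_sub x).div_const s).neg using 1
      ring
    convert! ((hexponent.exp.const_mul s).mul_const M) using 1
    field_simp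
  rw [relax, intervalIntegral.integral_eq_sub_of_hasDerivAt hderiv
    (Continuous.intervalIntegrable (by fun_prop) _ _)]
  simp only [sub_self, zero_div, neg_zero, Real.exp_zero, sub_zero]
  field_simp

theorem abs_relax_le (hs : 0 ≤ s) (hx : x ∈ Icc (0 : ℝ) 1) (hφ : ∀ y ∈ Icc (0 : ℝ) 1, |φ y| ≤ M) :
    |relax s φ x| ≤ (1 - Real.exp (-(1 / s))) * M := by
  rcases hs.eq_or_lt with rfl | hs
  · simp [relax]
  have hM : 0 ≤ M := (abs_nonneg _).trans (hφ 0 (by simp))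
  have hintegral : |∫ y in (0 : ℝ)..x, Real.exp (-((x - y) / s)) * φ y| ≤
      ∫ y in (0 : ℝ)..x, Real.exp (-((x - y) / s)) * M := by
    rw [← Real.norm_eq_abs]
    refine intervalIntegral.norm_integral_le_of_norm_le hx.1 (ae_of_all _ fun y hy => ?_)
      (Continuous.intervalIntegrable (by fun_prop) _ _)
    rw [norm_mul, Real.norm_of_nonneg (Real.exp_pos _).le]
    exact mul_le_mul_of_nonneg_left (hφ y ⟨hy.1.le, hy.2.trans hx.2⟩) (Real.exp_pos _).le
  calc |relax s φ x| ≤ relax s (fun _ => M) x := by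
        rw [relax, relax, abs_mul, abs_of_pos (by positivity : 0 < 1 / s)]
        exact mul_le_mul_of_nonneg_left hintegral (by positivity)
    _ = (1 - Real.exp (-(x / s))) * M := relax_const hs.ne' x M
    _ ≤ (1 - Real.exp (-(1 / s))) * M := by
        gcongr
        exact hx.2

theorem relax_nonneg (hs : 0 ≤ s) (hx : x ∈ Icc (0 : ℝ) 1) (hφ : ∀ y ∈ Icc (0 : ℝ) 1, 0 ≤ φ y) :
    0 ≤ relax s φ x :=
  mul_nonneg (by positivity) (intervalIntegral.integral_nonneg hx.1 fun y hy =>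
    mul_nonneg (Real.exp_pos _).le (hφ y ⟨hy.1, hy.2.trans hx.2⟩))

theorem relax_sub (hx : x ∈ Icc (0 : ℝ) 1) (hφ : IntervalIntegrable φ volume 0 1)
    (hψ : IntervalIntegrable ψ volume 0 1) :
    relax s φ x - relax s ψ x = relax s (fun y => φ y - ψ y) x := by
  have hweighted : ∀ φ : ℝ → ℝ, IntervalIntegrable φ volume 0 1 →
      IntervalIntegrable (fun y => Real.exp (-((x - y) / s)) * φ y) volume 0 x := by
    intro φ hφ
    refine (hφ.mono_set ?_).continuousOn_mul (by fun_prop)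
    rw [uIcc_of_le hx.1, uIcc_of_le zero_le_one]
    exact Icc_subset_Icc le_rfl hx.2
  rw [relax, relax, relax, ← mul_sub,
    ← intervalIntegral.integral_sub (hweighted φ hφ) (hweighted ψ hψ)]
  simp only [mul_sub]

theorem relax_congr (hx : x ∈ Icc (0 : ℝ) 1) (h : ∀ y ∈ Icc (0 : ℝ) 1, φ y = ψ y) :
    relax s φ x = relax s ψ x := by
  rw [relax, relax]
  congr 1
  refine intervalIntegral.integral_congr fun y hy => ?_
  rw [uIcc_of_le hx.1] at hy
  simp only [h y ⟨hy.1, hy.2.trans hx.2⟩]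

theorem continuous_relax (s : ℝ) (hφ : Continuous φ) : Continuous (relax s φ) :=
  continuous_const.mul (intervalIntegral.continuous_parametric_intervalIntegral_of_continuous
    (by fun_prop) continuous_id)

end Relax

/-- Distance of `x` from the wall at which the velocity points inwards. Measuring positions by it
treats the directions `v₁ > 0` and `v₁ < 0` alike. -/
def depth (x : ℝ) (v : V) : ℝ := if 0 < v 0 then x else 1 - x

/-- Fraction of the inflow which reaches position `x`. -/
def attenuation (τ x : ℝ) (v : V) : ℝ := Real.exp (-(depth x v / (τ * |v 0|)))

/-- Fraction of the inflow which collides within one crossing of `[0, 1]`. -/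
def absorbed (τ : ℝ) (v : V) : ℝ := 1 - Real.exp (-(1 / (τ * |v 0|)))

/-- Contribution of the source `Q` to the mild solution of `v₁ ∂ₓ f = (Q - f) / τ`. -/
def collision (τ : ℝ) (Q : ℝ → V → ℝ) (x : ℝ) (v : V) : ℝ :=
  relax (τ * |v 0|) (fun y => Q (depth y v) v) (depth x v)

/-- Mild solution of `v₁ ∂ₓ f = (Q - f) / τ` with inflow `k`, which is prescribed at `x = 0` where
`v₁ > 0` and at `x = 1` elsewhere. -/
def transport (τ : ℝ) (k : V → ℝ) (Q : ℝ → V → ℝ) (x : ℝ) (v : V) : ℝ :=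
  attenuation τ x v * k v + collision τ Q x v

section Transport

variable {τ x : ℝ} {v : V}

theorem depth_mem (hx : x ∈ Icc (0 : ℝ) 1) (v : V) : depth x v ∈ Icc (0 : ℝ) 1 := by
  unfold depth
  split_ifs
  · exact hx
  · exact ⟨by linarith [hx.2], by linarith [hx.1]⟩

theorem continuous_depth (v : V) : Continuous fun x => depth x v := by
  unfold depth
  split_ifs <;> fun_prop

theorem measurable_depth (x : ℝ) : Measurable (depth x) :=
  Measurable.ite (measurableSet_lt (by fun_prop) (by fun_prop)) measurable_const measurable_const

theorem measurable_attenuation (τ x : ℝ) : Measurable (attenuation τ x) :=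
  Real.measurable_exp.comp ((measurable_depth x).div (by fun_prop)).neg

theorem measurable_absorbed (τ : ℝ) : Measurable (absorbed τ) := by
  unfold absorbed
  fun_prop

theorem attenuation_pos (τ x : ℝ) (v : V) : 0 < attenuation τ x v := Real.exp_pos _

theorem attenuation_le_one (hτ : 0 ≤ τ) (hx : x ∈ Icc (0 : ℝ) 1) (v : V) :
    attenuation τ x v ≤ 1 := by
  rw [attenuation, Real.exp_le_one_iff]
  exact neg_nonpos.2 (div_nonneg (depth_mem hx v).1 (by positivity))

theorem exp_le_attenuation (hτ : 0 ≤ τ) (hx : x ∈ Icc (0 : ℝ) 1) (v : V) :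
    Real.exp (-(1 / (τ * |v 0|))) ≤ attenuation τ x v :=
  Real.exp_le_exp.2 (neg_le_neg (div_le_div_of_nonneg_right (depth_mem hx v).2 (by positivity)))

theorem absorbed_nonneg (hτ : 0 ≤ τ) (v : V) : 0 ≤ absorbed τ v := by
  rw [absorbed, sub_nonneg, Real.exp_le_one_iff]
  exact neg_nonpos.2 (by positivity)

theorem absorbed_le_one (τ : ℝ) (v : V) : absorbed τ v ≤ 1 := sub_le_self _ (Real.exp_pos _).le

theorem abs_collision_le (hτ : 0 ≤ τ) (hx : x ∈ Icc (0 : ℝ) 1) {Q : ℝ → V → ℝ} {M : ℝ}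
    (hQ : ∀ y ∈ Icc (0 : ℝ) 1, |Q y v| ≤ M) : |collision τ Q x v| ≤ absorbed τ v * M :=
  abs_relax_le (by positivity) (depth_mem hx v) fun y hy => hQ _ (depth_mem hy v)

theorem collision_nonneg (hτ : 0 ≤ τ) (hx : x ∈ Icc (0 : ℝ) 1) {Q : ℝ → V → ℝ}
    (hQ : ∀ y ∈ Icc (0 : ℝ) 1, 0 ≤ Q y v) : 0 ≤ collision τ Q x v :=
  relax_nonneg (by positivity) (depth_mem hx v) fun y hy => hQ _ (depth_mem hy v)

theorem intervalIntegrable_depth {Q : ℝ → V → ℝ}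
    (hQ : IntervalIntegrable (fun y => Q y v) volume 0 1) :
    IntervalIntegrable (fun y => Q (depth y v) v) volume 0 1 := by
  unfold depth
  split_ifs
  · exact hQ
  · simpa using (hQ.comp_sub_left 1).symm

theorem collision_sub (hx : x ∈ Icc (0 : ℝ) 1) {Q Q' : ℝ → V → ℝ}
    (hQ : IntervalIntegrable (fun y => Q y v) volume 0 1)
    (hQ' : IntervalIntegrable (fun y => Q' y v) volume 0 1) :
    collision τ Q x v - collision τ Q' x v = collision τ (fun y v => Q y v - Q' y v) x v :=
  relax_sub (depth_mem hx v) (intervalIntegrable_depth hQ) (intervalIntegrable_depth hQ')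

theorem collision_congr (hx : x ∈ Icc (0 : ℝ) 1) {Q Q' : ℝ → V → ℝ}
    (h : ∀ y ∈ Icc (0 : ℝ) 1, Q y v = Q' y v) : collision τ Q x v = collision τ Q' x v :=
  relax_congr (depth_mem hx v) fun _ hy => h _ (depth_mem hy v)

theorem abs_transport_sub_le (hτ : 0 ≤ τ) (hx : x ∈ Icc (0 : ℝ) 1) {k k' : V → ℝ}
    {Q Q' : ℝ → V → ℝ} {M : ℝ} (hQ : IntervalIntegrable (fun y => Q y v) volume 0 1)
    (hQ' : IntervalIntegrable (fun y => Q' y v) volume 0 1)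
    (hM : ∀ y ∈ Icc (0 : ℝ) 1, |Q y v - Q' y v| ≤ M) :
    |transport τ k Q x v - transport τ k' Q' x v| ≤ |k v - k' v| + absorbed τ v * M := by
  have hsplit : transport τ k Q x v - transport τ k' Q' x v =
      attenuation τ x v * (k v - k' v) + collision τ (fun y v => Q y v - Q' y v) x v := by
    rw [← collision_sub hx hQ hQ', transport, transport]
    ring
  rw [hsplit]
  refine (abs_add_le _ _).trans (add_le_add ?_ (abs_collision_le hτ hx hM))
  rw [abs_mul, abs_of_pos (attenuation_pos _ _ _)]
  exact mul_le_of_le_one_left (abs_nonneg _) (attenuation_le_one hτ hx v)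

theorem transport_zero (τ x : ℝ) (k : V → ℝ) (v : V) :
    transport τ k (fun _ _ => 0) x v = attenuation τ x v * k v := by
  simp [transport, collision, relax]

theorem continuous_attenuation (τ : ℝ) (v : V) : Continuous fun x => attenuation τ x v :=
  Real.continuous_exp.comp ((continuous_depth v).div_const _).neg

theorem continuous_collision {Q : ℝ → V → ℝ} (τ : ℝ) (v : V) (hQ : Continuous (Q · v)) :
    Continuous fun x => collision τ Q x v :=
  (continuous_relax _ (hQ.comp (continuous_depth v))).comp (continuous_depth v)

theorem stronglyMeasurable_collision {Q : ℝ → V → ℝ} (τ x : ℝ)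
    (hQ : Measurable (Function.uncurry Q)) : StronglyMeasurable (collision τ Q x) := by
  have hrelax : ∀ (a : ℝ) (φ : V → ℝ → ℝ), Measurable (Function.uncurry φ) →
      StronglyMeasurable fun v : V => 1 / (τ * |v 0|) *
        ∫ y in (0 : ℝ)..a, Real.exp (-((a - y) / (τ * |v 0|))) * φ v y := by
    intro a φ hφ
    have hintegrand : StronglyMeasurable (Function.uncurry fun (v : V) (y : ℝ) =>
        Real.exp (-((a - y) / (τ * |v 0|))) * φ v y) := by
      refine Measurable.stronglyMeasurable (Measurable.mul ?_ hφ)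
      fun_prop
    refine StronglyMeasurable.mul (Measurable.stronglyMeasurable (by fun_prop)) ?_
    unfold intervalIntegral
    exact hintegrand.integral_prod_right.sub hintegrand.integral_prod_right
  have hcases : collision τ Q x = fun v : V => if 0 < v 0 then
      1 / (τ * |v 0|) * (∫ y in (0 : ℝ)..x, Real.exp (-((x - y) / (τ * |v 0|))) * Q y v) else
      1 / (τ * |v 0|) * ∫ y in (0 : ℝ)..(1 - x),
        Real.exp (-((1 - x - y) / (τ * |v 0|))) * Q (1 - y) v := by
    ext v
    unfold collision relax depth
    split_ifs <;> rfl
  rw [hcases]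
  refine StronglyMeasurable.ite (measurableSet_lt (by fun_prop) (by fun_prop))
    (hrelax x (fun v y => Q y v) (hQ.comp measurable_swap))
    (hrelax (1 - x) (fun v y => Q (1 - y) v)
      (hQ.comp (g := Function.uncurry Q) (f := fun q : V × ℝ => (1 - q.2, q.1)) (by fun_prop)))

theorem tendsto_integral_absorbed {Φ : V → ℝ} (hΦ : Integrable Φ) :
    Filter.Tendsto (fun τ => ∫ v, absorbed τ v * Φ v) Filter.atTop (nhds 0) := by
  rw [← integral_zero V ℝ]
  refine tendsto_integral_filter_of_dominated_convergence (fun v => ‖Φ v‖)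
    (Filter.Eventually.of_forall fun τ =>
      (measurable_absorbed τ).aestronglyMeasurable.mul hΦ.aestronglyMeasurable)
    ?_ hΦ.norm (ae_of_all _ fun v => ?_)
  · filter_upwards [Filter.eventually_ge_atTop 0] with τ hτ
    refine ae_of_all _ fun v => ?_
    rw [norm_mul, Real.norm_of_nonneg (absorbed_nonneg hτ v)]
    exact mul_le_of_le_one_left (norm_nonneg _) (absorbed_le_one τ v)
  · rcases eq_or_ne (v 0) 0 with h | h
    · simp [absorbed, h]
    have hdepth : Filter.Tendsto (fun τ : ℝ => 1 / (τ * |v 0|)) Filter.atTop (nhds 0) :=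
      (Filter.tendsto_id.atTop_mul_const (abs_pos.2 h)).const_div_atTop 1
    have hexp := (Real.continuous_exp.tendsto 0).comp (by simpa using hdepth.neg)
    simpa [absorbed] using ((tendsto_const_nhds (x := (1 : ℝ))).sub hexp).mul_const (Φ v)

end Transport

theorem reflect_reflect (v : V) : reflect (reflect v) = v := by
  ext i
  fin_cases i <;> simp [reflect]

/-- Specular reflection as a linear isometry. -/
def reflectIsometry : V ≃ₗᵢ[ℝ] V where
  toLinearEquiv := LinearEquiv.ofInvolutive
    { toFun := reflect
      map_add' := fun v w => by
        ext i
        fin_cases i <;> simp [reflect, add_comm]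
      map_smul' := fun c v => by
        ext i
        fin_cases i <;> simp [reflect] } reflect_reflect
  norm_map' := fun v => show ‖reflect v‖ = ‖v‖ by
    simp [reflect, EuclideanSpace.norm_eq, Fin.sum_univ_three]

theorem norm_reflect (v : V) : ‖reflect v‖ = ‖v‖ := reflectIsometry.norm_map v

theorem reflect_zero_apply (v : V) : reflect v 0 = -v 0 := by simp [reflect]

theorem measurePreserving_reflect : MeasurePreserving reflect (volume : Measure V) volume :=
  reflectIsometry.measurePreserving

theorem measurableEmbedding_reflect : MeasurableEmbedding reflect :=
  reflectIsometry.toHomeomorph.measurableEmbedding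

theorem integral_comp_reflect (g : V → ℝ) : ∫ v, g (reflect v) = ∫ v, g v :=
  measurePreserving_reflect.integral_comp measurableEmbedding_reflect g

theorem HasFiniteEnergy.comp_reflect {h : V → ℝ} (hh : HasFiniteEnergy h) :
    HasFiniteEnergy fun v => h (reflect v) :=
  ((measurePreserving_reflect.integrable_comp_emb measurableEmbedding_reflect).2 hh).congr
    (ae_of_all _ fun v => by simp only [Function.comp_apply, norm_reflect])

theorem energyNorm_comp_reflect (h : V → ℝ) :
    (energyNorm fun v => h (reflect v)) = energyNorm h := by
  have := integral_comp_reflect fun v => |h v| * (1 + ‖v‖ ^ 2)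
  simpa only [energyNorm, norm_reflect] using this

theorem ae_comp_reflect {P : V → Prop} (h : ∀ᵐ v : V, P v) : ∀ᵐ v : V, P (reflect v) :=
  measurePreserving_reflect.quasiMeasurePreserving.ae h

theorem ae_apply_ne_zero (i : Fin 3) : ∀ᵐ v : V, v i ≠ 0 := by
  have hker : LinearMap.ker (EuclideanSpace.proj (𝕜 := ℝ) i).toLinearMap ≠
      (⊤ : Submodule ℝ V) := by
    intro htop
    have : (EuclideanSpace.single i 1 : V) ∈
      LinearMap.ker (EuclideanSpace.proj (𝕜 := ℝ) i).toLinearMap := htop ▸ trivial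
    simp at this
  rw [ae_iff]
  convert! Measure.addHaar_submodule (volume : Measure V) _ hker using 2
  ext v
  simp

theorem measurableSet_pos : MeasurableSet {v : V | 0 < v 0} :=
  measurableSet_lt (by fun_prop) (by fun_prop)

theorem measurableSet_neg : MeasurableSet {v : V | v 0 < 0} :=
  measurableSet_lt (by fun_prop) (by fun_prop)

/-- The outgoing mass flux at the wall where `v` points inwards. -/
def wallFlux (h : V → ℝ) (v : V) : ℝ :=
  if 0 < v 0 then ∫ w in {w : V | w 0 < 0}, h w * |w 0| else ∫ w in {w : V | 0 < w 0}, h w * |w 0|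

/-- The part of the inflow that is re-emitted by the walls, diffusely with distribution `W` and
specularly, when the outgoing trace is `h`. -/
def reemission (δ₂ δ₃ : ℝ) (W h : V → ℝ) (v : V) : ℝ :=
  δ₂ * (wallFlux h v * W v) + δ₃ * h (reflect v)

/-- The inflow for inflow data `p` and outgoing trace `h`. -/
def inflow (δ₁ δ₂ δ₃ : ℝ) (p W h : V → ℝ) (v : V) : ℝ := δ₁ * p v + reemission δ₂ δ₃ W h v

/-- The end point at which a particle of velocity `v` leaves the slab. -/
def exitPosition (v : V) : ℝ := if 0 < v 0 then 1 else 0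

/-- The part of the trace of `f` with velocities pointing out of the domain. -/
def outgoing (f : ℝ → V → ℝ) (v : V) : ℝ := f (exitPosition v) v

theorem exitPosition_mem (v : V) : exitPosition v ∈ Icc (0 : ℝ) 1 := by
  unfold exitPosition
  split_ifs <;> simp

theorem HasFiniteEnergy.outgoing {f : ℝ → V → ℝ}
    (hf : ∀ x ∈ Icc (0 : ℝ) 1, HasFiniteEnergy (f x)) : HasFiniteEnergy (outgoing f) := by
  refine ((Integrable.indicator (hf 1 (by simp)) measurableSet_pos).add
    (Integrable.indicator (hf 0 (by simp)) measurableSet_pos.compl)).congr (ae_of_all _ fun v => ?_)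
  by_cases hv : 0 < v 0 <;> simp [ESBGK.outgoing, exitPosition, indicator, hv]

section Boundary

variable {δ₁ δ₂ δ₃ : ℝ} {p W h h' : V → ℝ}

theorem HasFiniteEnergy.integrable_mul_abs_apply (hh : HasFiniteEnergy h) (i : Fin 3) :
    Integrable fun v => h v * |v i| :=
  hh.integrable_mul (C := 1) (by fun_prop) fun v => by simpa using abs_apply_le v i

theorem wallFlux_sub (hh : HasFiniteEnergy h) (hh' : HasFiniteEnergy h') (v : V) :
    wallFlux h v - wallFlux h' v = wallFlux (fun v => h v - h' v) v := by
  unfold wallFlux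
  simp only [sub_mul]
  split_ifs <;>
  exact (integral_sub (hh.integrable_mul_abs_apply 0).integrableOn
    (hh'.integrable_mul_abs_apply 0).integrableOn).symm

theorem abs_wallFlux_le (hh : HasFiniteEnergy h) (v : V) : |wallFlux h v| ≤ energyNorm h := by
  have habs := hh.integrable_abs_mul
  have hflux : ∀ S : Set V, abs (∫ w in S, h w * |w 0|) ≤ energyNorm h := by
    intro S
    rw [← Real.norm_eq_abs]
    refine (norm_integral_le_of_norm_le habs.integrableOn (ae_of_all _ fun v => ?_)).trans
      (setIntegral_le_integral habs (ae_of_all _ fun v => by positivity))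
    rw [norm_mul, Real.norm_eq_abs, Real.norm_eq_abs, abs_abs]
    exact mul_le_mul_of_nonneg_left (abs_apply_le v 0) (abs_nonneg _)
  unfold wallFlux
  split_ifs
  exacts [hflux _, hflux _]

theorem wallFlux_nonneg (hh : ∀ᵐ v, 0 ≤ h v) (v : V) : 0 ≤ wallFlux h v := by
  unfold wallFlux
  split_ifs <;>
  exact integral_nonneg_of_ae (ae_restrict_of_ae (hh.mono fun v hv => mul_nonneg hv (abs_nonneg _)))

theorem measurable_wallFlux (h : V → ℝ) : Measurable (wallFlux h) :=
  Measurable.ite measurableSet_pos measurable_const measurable_const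

theorem wallFlux_congr (hh : ∀ᵐ v, h v = h' v) (v : V) : wallFlux h v = wallFlux h' v := by
  unfold wallFlux
  split_ifs <;>
  exact integral_congr_ae (ae_restrict_of_ae (hh.mono fun w hw => by simp only [hw]))

theorem reemission_sub (hh : HasFiniteEnergy h) (hh' : HasFiniteEnergy h') (v : V) :
    reemission δ₂ δ₃ W h v - reemission δ₂ δ₃ W h' v =
      reemission δ₂ δ₃ W (fun v => h v - h' v) v := by
  rw [reemission, reemission, reemission, ← wallFlux_sub hh hh']
  ring

theorem reemission_nonneg (hδ₂ : 0 ≤ δ₂) (hδ₃ : 0 ≤ δ₃) (hW : ∀ v, 0 ≤ W v)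
    (hh : ∀ᵐ v, 0 ≤ h v) : ∀ᵐ v, 0 ≤ reemission δ₂ δ₃ W h v := by
  filter_upwards [ae_comp_reflect hh] with v hv
  have := wallFlux_nonneg hh v
  have := hW v
  unfold reemission
  positivity

theorem inflow_congr (hh : ∀ᵐ v, h v = h' v) :
    ∀ᵐ v, inflow δ₁ δ₂ δ₃ p W h v = inflow δ₁ δ₂ δ₃ p W h' v := by
  filter_upwards [ae_comp_reflect hh] with v hv
  rw [inflow, inflow, reemission, reemission, wallFlux_congr hh, hv]

theorem HasFiniteEnergy.wallFlux_mul (hW : HasFiniteEnergy W) (hh : HasFiniteEnergy h) :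
    HasFiniteEnergy fun v => wallFlux h v * W v :=
  (Integrable.bdd_mul hW (measurable_wallFlux h).aestronglyMeasurable
    (ae_of_all _ (abs_wallFlux_le hh))).congr
    (ae_of_all _ fun _ => (mul_assoc _ _ _).symm)

theorem HasFiniteEnergy.reemission (hW : HasFiniteEnergy W) (hh : HasFiniteEnergy h) :
    HasFiniteEnergy (reemission δ₂ δ₃ W h) :=
  ((hW.wallFlux_mul hh).const_mul δ₂).add (hh.comp_reflect.const_mul δ₃)

theorem HasFiniteEnergy.inflow (hp : HasFiniteEnergy p) (hW : HasFiniteEnergy W)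
    (hh : HasFiniteEnergy h) : HasFiniteEnergy (inflow δ₁ δ₂ δ₃ p W h) :=
  (hp.const_mul δ₁).add (hW.reemission hh)

theorem energyNorm_reemission_le (hδ₂ : 0 ≤ δ₂) (hδ₃ : 0 ≤ δ₃) (hW : HasFiniteEnergy W)
    (hh : HasFiniteEnergy h) :
    energyNorm (reemission δ₂ δ₃ W h) ≤ (δ₂ * energyNorm W + δ₃) * energyNorm h := by
  have hdiffuse : (energyNorm fun v => wallFlux h v * W v) ≤ energyNorm h * energyNorm W :=
    calc (energyNorm fun v => wallFlux h v * W v)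
      _ ≤ energyNorm fun v => energyNorm h * W v :=
          (hW.const_mul _).energyNorm_mono (ae_of_all _ fun v => by
            rw [abs_mul, abs_mul, abs_of_nonneg (energyNorm_nonneg h)]
            exact mul_le_mul_of_nonneg_right (abs_wallFlux_le hh v) (abs_nonneg _))
      _ = energyNorm h * energyNorm W := by
          rw [energyNorm_const_mul, abs_of_nonneg (energyNorm_nonneg h)]
  calc energyNorm (reemission δ₂ δ₃ W h)
    _ ≤ (energyNorm fun v => δ₂ * (wallFlux h v * W v)) +
          energyNorm fun v => δ₃ * h (reflect v) :=
        ((hW.wallFlux_mul hh).const_mul δ₂).energyNorm_add_le (hh.comp_reflect.const_mul δ₃)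
    _ = δ₂ * (energyNorm fun v => wallFlux h v * W v) + δ₃ * energyNorm h := by
        rw [energyNorm_const_mul, energyNorm_const_mul, energyNorm_comp_reflect,
          abs_of_nonneg hδ₂, abs_of_nonneg hδ₃]
    _ ≤ δ₂ * (energyNorm h * energyNorm W) + δ₃ * energyNorm h := by gcongr
    _ = (δ₂ * energyNorm W + δ₃) * energyNorm h := by ring

end Boundary

/-- The density at position `x` of the inflow data `δ₁ p` transported without collisions. -/
def freeTransport (δ₁ τ : ℝ) (p : V → ℝ) (x : ℝ) (v : V) : ℝ := δ₁ * (attenuation τ x v * p v)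

section FreeTransport

variable {δ₁ τ x : ℝ} {p : V → ℝ} {v : V}

theorem freeTransport_nonneg (hδ₁ : 0 ≤ δ₁) (hp : 0 ≤ p v) : 0 ≤ freeTransport δ₁ τ p x v :=
  mul_nonneg hδ₁ (mul_nonneg (attenuation_pos τ x v).le hp)

theorem freeTransport_le (hτ : 0 ≤ τ) (hx : x ∈ Icc (0 : ℝ) 1) (hδ₁ : δ₁ ≤ 1) (hp : 0 ≤ p v) :
    freeTransport δ₁ τ p x v ≤ p v := by
  have hatt := attenuation_pos τ x v
  calc freeTransport δ₁ τ p x v ≤ 1 * (attenuation τ x v * p v) := by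
        unfold freeTransport
        gcongr
    _ ≤ 1 * (1 * p v) := by
        gcongr
        exact attenuation_le_one hτ hx v
    _ = p v := by ring

theorem HasFiniteEnergy.freeTransport (hp : HasFiniteEnergy p) (hτ : 0 ≤ τ)
    (hx : x ∈ Icc (0 : ℝ) 1) : HasFiniteEnergy (freeTransport δ₁ τ p x) := by
  refine HasFiniteEnergy.const_mul (hp.mono ((measurable_attenuation τ
    x).aestronglyMeasurable.mul hp.aestronglyMeasurable) (ae_of_all _ fun v => ?_)) δ₁
  rw [Pi.mul_apply, abs_mul, abs_of_pos (attenuation_pos _ _ _)]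
  exact mul_le_of_le_one_left (abs_nonneg _) (attenuation_le_one hτ hx v)

end FreeTransport

/-- `f` exceeds `k` by a nonnegative part of energy at most `η`. -/
structure NearAbove (η : ℝ) (k f : V → ℝ) : Prop where
  finite : HasFiniteEnergy f
  ge : ∀ᵐ v, k v ≤ f v
  excess_le : (energyNorm fun v => f v - k v) ≤ η

theorem NearAbove.refl {η : ℝ} {k : V → ℝ} (hη : 0 ≤ η) (hk : HasFiniteEnergy k) :
    NearAbove η k k :=
  ⟨hk, ae_of_all _ fun _ => le_rfl, by simpa [energyNorm] using hη⟩

theorem NearAbove.energyNorm_le {η : ℝ} {k f : V → ℝ} (hf : NearAbove η k f)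
    (hk : HasFiniteEnergy k) : energyNorm f ≤ energyNorm k + η := by
  have := (hf.finite.sub hk).energyNorm_add_le hk
  simp only [sub_add_cancel] at this
  linarith [hf.excess_le]

theorem NearAbove.energyNorm_le_of_freeTransport {η δ₁ τ x : ℝ} {p f : V → ℝ}
    (h : NearAbove η (freeTransport δ₁ τ p x) f) (hp : HasFiniteEnergy p) (hp0 : ∀ᵐ v, 0 ≤ p v)
    (hδ₀ : 0 ≤ δ₁) (hδ₁ : δ₁ ≤ 1) (hτ : 0 ≤ τ) (hx : x ∈ Icc (0 : ℝ) 1) :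
    energyNorm f ≤ energyNorm p + η := by
  refine (h.energyNorm_le (hp.freeTransport hτ hx)).trans
    (add_le_add (hp.energyNorm_mono (hp0.mono fun v hv => ?_)) le_rfl)
  rw [abs_of_nonneg (freeTransport_nonneg hδ₀ hv), abs_of_nonneg hv]
  exact freeTransport_le hτ hx hδ₁ hv

/-- Conditions under which the solution map contracts states with moments in `Ω` and outgoing trace
of energy at most `B`: on `Ω` the Gaussian is bounded by `Ψ` and Lipschitz with modulus `Ψ`, and
re-emission and collisions are weak. The fields they produce exceed the free transport of the inflow
data `p` by an energy of at most `η`. -/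
structure WeakInteraction (ν τ δ₁ δ₂ δ₃ : ℝ) (p W : V → ℝ) (Ω : Set Moments) (Ψ : V → ℝ)
    (B η : ℝ) : Prop where
  time_pos : 0 < τ
  inflow_nonneg : 0 ≤ δ₁
  inflow_le_one : δ₁ ≤ 1
  diffuse_nonneg : 0 ≤ δ₂
  specular_nonneg : 0 ≤ δ₃
  data_nonneg : ∀ᵐ v, 0 ≤ p v
  data_finite : HasFiniteEnergy p
  wall_nonneg : ∀ v, 0 ≤ W v
  wall_finite : HasFiniteEnergy W
  bound_nonneg : ∀ v, 0 ≤ Ψ v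
  bound_finite : HasFiniteEnergy Ψ
  closed : IsClosed Ω
  density_ne_zero : ∀ m ∈ Ω, m.1 ≠ 0
  gaussian_continuousOn : ContinuousOn (fun q : Moments × V => q.1.gaussian ν q.2) (Ω ×ˢ univ)
  gaussian_mem : ∀ m ∈ Ω, ∀ v, 0 ≤ m.gaussian ν v ∧ m.gaussian ν v ≤ Ψ v
  gaussian_lipschitz : ∀ m ∈ Ω, ∀ m' ∈ Ω, ∀ v,
    |m.gaussian ν v - m'.gaussian ν v| ≤ ‖m - m'‖ * Ψ v
  reemission_le : δ₂ * energyNorm W + δ₃ ≤ 1 / 4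
  collision_le : (energyNorm fun v => absorbed τ v * Ψ v) ≤ 1 / 4
  excess_nonneg : 0 ≤ η
  excess_le : (δ₂ * energyNorm W + δ₃) * B + (energyNorm fun v => absorbed τ v * Ψ v) ≤ η
  trace_le : energyNorm p + η ≤ B

/-- A moment path in `Ω` and a nonnegative outgoing trace of energy at most `B`: the data from which
the next iterate of the solution map is computed. -/
structure IsTrialState (Ω : Set Moments) (B : ℝ) (m : ℝ → Moments) (h : V → ℝ) : Prop where
  continuous : Continuous m
  mem : ∀ y, m y ∈ Ω
  finite : HasFiniteEnergy h
  nonneg : ∀ᵐ v, 0 ≤ h v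
  energyNorm_le : energyNorm h ≤ B

/-- The mild solution whose sources are the Gaussians of the moments `m` and whose boundary
condition is evaluated at the outgoing trace `h`. -/
def field (ν τ δ₁ δ₂ δ₃ : ℝ) (p W : V → ℝ) (m : ℝ → Moments) (h : V → ℝ) : ℝ → V → ℝ :=
  transport τ (inflow δ₁ δ₂ δ₃ p W h) fun y v => (m y).gaussian ν v

section Contraction

variable {ν τ δ₁ δ₂ δ₃ B η : ℝ} {p W : V → ℝ} {Ω : Set Moments} {Ψ : V → ℝ}

theorem HasFiniteEnergy.absorbed_mul {Φ : V → ℝ} (hΦ : HasFiniteEnergy Φ) (hτ : 0 ≤ τ) :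
    HasFiniteEnergy fun v => absorbed τ v * Φ v := by
  refine hΦ.mono ((measurable_absorbed τ).aestronglyMeasurable.mul hΦ.aestronglyMeasurable)
    (ae_of_all _ fun v => ?_)
  rw [abs_mul, abs_of_nonneg (absorbed_nonneg hτ v)]
  exact mul_le_of_le_one_left (abs_nonneg _) (absorbed_le_one τ v)

namespace WeakInteraction

section Estimates

variable {h h' F : V → ℝ} {D : ℝ} {Q Q' : ℝ → V → ℝ} {X : V → ℝ}

theorem energyNorm_le (H : WeakInteraction ν τ δ₁ δ₂ δ₃ p W Ω Ψ B η) (hh : HasFiniteEnergy h)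
    (hD : 0 ≤ D)
    (hF : ∀ᵐ v, |F v| ≤ |reemission δ₂ δ₃ W h v| + absorbed τ v * (D * Ψ v)) :
    energyNorm F ≤ (δ₂ * energyNorm W + δ₃) * energyNorm h +
      D * energyNorm fun v => absorbed τ v * Ψ v := by
  have hre : HasFiniteEnergy fun v => |reemission δ₂ δ₃ W h v| :=
    (H.wall_finite.reemission hh).integrable_abs_mul
  have habs := (H.bound_finite.const_mul D).absorbed_mul H.time_pos.le
  calc energyNorm F
    _ ≤ energyNorm fun v => |reemission δ₂ δ₃ W h v| + absorbed τ v * (D * Ψ v) :=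
        (hre.add habs).energyNorm_mono (hF.mono fun v hv => hv.trans (le_abs_self _))
    _ ≤ energyNorm (reemission δ₂ δ₃ W h) + energyNorm fun v => absorbed τ v * (D * Ψ v) := by
        rw [← energyNorm_abs (reemission δ₂ δ₃ W h)]
        exact hre.energyNorm_add_le habs
    _ = energyNorm (reemission δ₂ δ₃ W h) + D * energyNorm fun v => absorbed τ v * Ψ v := by
        simp only [mul_left_comm _ D, energyNorm_const_mul, abs_of_nonneg hD]
    _ ≤ (δ₂ * energyNorm W + δ₃) * energyNorm h + D * energyNorm fun v => absorbed τ v * Ψ v := by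
        gcongr
        exact energyNorm_reemission_le H.diffuse_nonneg H.specular_nonneg H.wall_finite hh

theorem energyNorm_transport_sub_le (H : WeakInteraction ν τ δ₁ δ₂ δ₃ p W Ω Ψ B η)
    (hX : ∀ v, X v ∈ Icc (0 : ℝ) 1) (hh : HasFiniteEnergy h) (hh' : HasFiniteEnergy h')
    (hD : (energyNorm fun v => h v - h' v) ≤ D)
    (hQ : ∀ᵐ v, IntervalIntegrable (fun y => Q y v) volume 0 1)
    (hQ' : ∀ᵐ v, IntervalIntegrable (fun y => Q' y v) volume 0 1)
    (hQQ' : ∀ y ∈ Icc (0 : ℝ) 1, ∀ v, |Q y v - Q' y v| ≤ D * Ψ v) :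
    (energyNorm fun v => transport τ (inflow δ₁ δ₂ δ₃ p W h) Q (X v) v -
      transport τ (inflow δ₁ δ₂ δ₃ p W h') Q' (X v) v) ≤ D / 2 := by
  have hD0 : 0 ≤ D := (energyNorm_nonneg _).trans hD
  have hle := H.energyNorm_le (D := D) (F := fun v =>
    transport τ (inflow δ₁ δ₂ δ₃ p W h) Q (X v) v - transport τ (inflow δ₁ δ₂ δ₃ p W h') Q' (X v) v)
    (hh.sub hh') hD0 (by
      filter_upwards [hQ, hQ'] with v hv hv'
      rw [← reemission_sub hh hh',
        ← add_sub_add_left_eq_sub (reemission δ₂ δ₃ W h v) _ (δ₁ * p v)]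
      exact abs_transport_sub_le H.time_pos.le (hX v) hv hv' fun y hy => hQQ' y hy v)
  have hre : (δ₂ * energyNorm W + δ₃) * (energyNorm fun v => h v - h' v) ≤ 1 / 4 * D :=
    mul_le_mul H.reemission_le hD (energyNorm_nonneg _) (by norm_num)
  have hcol := mul_le_mul_of_nonneg_left H.collision_le hD0
  linarith

theorem energyNorm_sub_freeTransport_le (H : WeakInteraction ν τ δ₁ δ₂ δ₃ p W Ω Ψ B η)
    (hX : ∀ v, X v ∈ Icc (0 : ℝ) 1) (hh : HasFiniteEnergy h) (hB : energyNorm h ≤ B)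
    (hQ : ∀ᵐ v, IntervalIntegrable (fun y => Q y v) volume 0 1)
    (hQΨ : ∀ y ∈ Icc (0 : ℝ) 1, ∀ v, |Q y v| ≤ Ψ v) :
    (energyNorm fun v => transport τ (inflow δ₁ δ₂ δ₃ p W h) Q (X v) v -
      freeTransport δ₁ τ p (X v) v) ≤ η := by
  have hfree : ∀ v, freeTransport δ₁ τ p (X v) v =
      transport τ (fun v => δ₁ * p v) (fun _ _ => 0) (X v) v := fun v => by
    rw [transport_zero, freeTransport, mul_left_comm]
  have hle := H.energyNorm_le (D := 1) (F := fun v =>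
    transport τ (inflow δ₁ δ₂ δ₃ p W h) Q (X v) v - freeTransport δ₁ τ p (X v) v) hh zero_le_one (by
      filter_upwards [hQ] with v hv
      rw [hfree, ← add_sub_cancel_left (δ₁ * p v) (reemission δ₂ δ₃ W h v), one_mul]
      exact abs_transport_sub_le H.time_pos.le (hX v) hv intervalIntegrable_const
        fun y hy => by simpa using hQΨ y hy v)
  have hnonneg : 0 ≤ δ₂ * energyNorm W + δ₃ :=
    add_nonneg (mul_nonneg H.diffuse_nonneg (energyNorm_nonneg _)) H.specular_nonneg
  linarith [H.excess_le, mul_le_mul_of_nonneg_left hB hnonneg]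

end Estimates

section Field

variable {m : ℝ → Moments} {h : V → ℝ}

theorem continuous_gaussian (H : WeakInteraction ν τ δ₁ δ₂ δ₃ p W Ω Ψ B η)
    (T : IsTrialState Ω B m h) : Continuous (Function.uncurry fun y v => (m y).gaussian ν v) :=
  have := T.continuous
  H.gaussian_continuousOn.comp_continuous (f := fun q : ℝ × V => (m q.1, q.2)) (by fun_prop)
    fun q => ⟨T.mem q.1, trivial⟩

theorem continuous_gaussian_apply (H : WeakInteraction ν τ δ₁ δ₂ δ₃ p W Ω Ψ B η)
    (T : IsTrialState Ω B m h) (v : V) : Continuous fun y => (m y).gaussian ν v :=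
  (H.continuous_gaussian T).comp (by fun_prop : Continuous fun y : ℝ => (y, v))

theorem abs_gaussian_le (H : WeakInteraction ν τ δ₁ δ₂ δ₃ p W Ω Ψ B η)
    (T : IsTrialState Ω B m h) (y : ℝ) (v : V) : |(m y).gaussian ν v| ≤ Ψ v := by
  obtain ⟨hnonneg, hle⟩ := H.gaussian_mem _ (T.mem y) v
  rwa [abs_of_nonneg hnonneg]

theorem hasFiniteEnergy_inflow (H : WeakInteraction ν τ δ₁ δ₂ δ₃ p W Ω Ψ B η)
    (T : IsTrialState Ω B m h) : HasFiniteEnergy (inflow δ₁ δ₂ δ₃ p W h) :=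
  H.data_finite.inflow H.wall_finite T.finite

theorem hasFiniteEnergy_envelope (H : WeakInteraction ν τ δ₁ δ₂ δ₃ p W Ω Ψ B η)
    (T : IsTrialState Ω B m h) : HasFiniteEnergy fun v => |inflow δ₁ δ₂ δ₃ p W h v| + Ψ v :=
  HasFiniteEnergy.add (H.hasFiniteEnergy_inflow T).integrable_abs_mul H.bound_finite

theorem abs_field_le (H : WeakInteraction ν τ δ₁ δ₂ δ₃ p W Ω Ψ B η) (T : IsTrialState Ω B m h)
    {x : ℝ} (hx : x ∈ Icc (0 : ℝ) 1) (v : V) :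
    |field ν τ δ₁ δ₂ δ₃ p W m h x v| ≤ |inflow δ₁ δ₂ δ₃ p W h v| + Ψ v := by
  refine (abs_add_le _ _).trans (add_le_add ?_ ?_)
  · rw [abs_mul, abs_of_pos (attenuation_pos _ _ _)]
    exact mul_le_of_le_one_left (abs_nonneg _) (attenuation_le_one H.time_pos.le hx v)
  · exact (abs_collision_le H.time_pos.le hx fun y _ => H.abs_gaussian_le T y v).trans
      (mul_le_of_le_one_left (H.bound_nonneg v) (absorbed_le_one τ v))

theorem continuous_field (H : WeakInteraction ν τ δ₁ δ₂ δ₃ p W Ω Ψ B η)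
    (T : IsTrialState Ω B m h) (v : V) : Continuous fun x => field ν τ δ₁ δ₂ δ₃ p W m h x v :=
  ((continuous_attenuation τ v).mul continuous_const).add
    (continuous_collision τ v (H.continuous_gaussian_apply T v))

theorem aestronglyMeasurable_field (H : WeakInteraction ν τ δ₁ δ₂ δ₃ p W Ω Ψ B η)
    (T : IsTrialState Ω B m h) (x : ℝ) :
    AEStronglyMeasurable (field ν τ δ₁ δ₂ δ₃ p W m h x) :=
  ((measurable_attenuation τ x).aestronglyMeasurable.mul
    (H.hasFiniteEnergy_inflow T).aestronglyMeasurable).add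
    (stronglyMeasurable_collision τ x (H.continuous_gaussian T).measurable).aestronglyMeasurable

theorem aestronglyMeasurable_uncurry_field (H : WeakInteraction ν τ δ₁ δ₂ δ₃ p W Ω Ψ B η)
    (T : IsTrialState Ω B m h) (μ : Measure ℝ) :
    AEStronglyMeasurable (Function.uncurry (field ν τ δ₁ δ₂ δ₃ p W m h)) (μ.prod volume) := by
  have hattenuation : StronglyMeasurable (Function.uncurry (attenuation τ)) :=
    stronglyMeasurable_uncurry_of_continuous_of_stronglyMeasurable (continuous_attenuation τ)
      fun x => (measurable_attenuation τ x).stronglyMeasurable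
  have hcollision : StronglyMeasurable
      (Function.uncurry (collision τ fun y v => (m y).gaussian ν v)) :=
    stronglyMeasurable_uncurry_of_continuous_of_stronglyMeasurable
      (fun v => continuous_collision τ v (H.continuous_gaussian_apply T v))
      fun x => stronglyMeasurable_collision τ x (H.continuous_gaussian T).measurable
  exact (hattenuation.aestronglyMeasurable.mul
    (H.hasFiniteEnergy_inflow T).aestronglyMeasurable.comp_snd).add hcollision.aestronglyMeasurable

theorem hasFiniteEnergy_field (H : WeakInteraction ν τ δ₁ δ₂ δ₃ p W Ω Ψ B η)
    (T : IsTrialState Ω B m h) {x : ℝ} (hx : x ∈ Icc (0 : ℝ) 1) :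
    HasFiniteEnergy (field ν τ δ₁ δ₂ δ₃ p W m h x) :=
  (H.hasFiniteEnergy_envelope T).mono (H.aestronglyMeasurable_field T x)
    (ae_of_all _ fun v => (H.abs_field_le T hx v).trans (le_abs_self _))

theorem continuous_integral_field_mul (H : WeakInteraction ν τ δ₁ δ₂ δ₃ p W Ω Ψ B η)
    (T : IsTrialState Ω B m h) {q : V → ℝ} (hq : Continuous q) (hle : ∀ v, |q v| ≤ 1 + ‖v‖ ^ 2) :
    Continuous fun x : Icc (0 : ℝ) 1 => ∫ v, field ν τ δ₁ δ₂ δ₃ p W m h x v * q v := by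
  refine continuous_of_dominated (fun x => (H.aestronglyMeasurable_field T x).mul (by fun_prop))
    (fun x => ae_of_all _ fun v => ?_) (H.hasFiniteEnergy_envelope T)
    (ae_of_all _ fun v => ((H.continuous_field T v).comp continuous_subtype_val).mul
      continuous_const)
  rw [norm_mul]
  have habs := H.abs_field_le T x.2 v
  exact mul_le_mul habs (hle v) (norm_nonneg _) ((abs_nonneg _).trans habs)

theorem continuous_moments_field (H : WeakInteraction ν τ δ₁ δ₂ δ₃ p W Ω Ψ B η)
    (T : IsTrialState Ω B m h) :
    Continuous fun x : Icc (0 : ℝ) 1 => moments (field ν τ δ₁ δ₂ δ₃ p W m h x) := by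
  refine Continuous.prodMk ?_ (Continuous.prodMk (continuous_pi fun i => ?_)
    (continuous_pi fun i => continuous_pi fun j => ?_))
  · simpa using H.continuous_integral_field_mul T (q := fun _ => 1) (by fun_prop) fun v => by simp
  · exact H.continuous_integral_field_mul T (by fun_prop) fun v => abs_apply_le v i
  · exact H.continuous_integral_field_mul T (by fun_prop) fun v =>
      (abs_apply_mul_apply_le v i j).trans (by linarith)

theorem freeTransport_le_field (H : WeakInteraction ν τ δ₁ δ₂ δ₃ p W Ω Ψ B η)
    (T : IsTrialState Ω B m h) :
    ∀ᵐ v, ∀ x ∈ Icc (0 : ℝ) 1, freeTransport δ₁ τ p x v ≤ field ν τ δ₁ δ₂ δ₃ p W m h x v := by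
  filter_upwards [reemission_nonneg H.diffuse_nonneg H.specular_nonneg H.wall_nonneg T.nonneg]
    with v hv x hx
  have hcollision := collision_nonneg (Q := fun y v => (m y).gaussian ν v) (v := v)
    H.time_pos.le hx fun y _ => (H.gaussian_mem _ (T.mem y) v).1
  have hsplit : field ν τ δ₁ δ₂ δ₃ p W m h x v = freeTransport δ₁ τ p x v +
      attenuation τ x v * reemission δ₂ δ₃ W h v +
      collision τ (fun y v => (m y).gaussian ν v) x v := by
    rw [field, transport, freeTransport, inflow]
    ring
  linarith [mul_nonneg (attenuation_pos τ x v).le hv]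

theorem nearAbove_field_comp (H : WeakInteraction ν τ δ₁ δ₂ δ₃ p W Ω Ψ B η)
    (T : IsTrialState Ω B m h) {X : V → ℝ} (hX : ∀ v, X v ∈ Icc (0 : ℝ) 1)
    (hfinite : HasFiniteEnergy fun v => field ν τ δ₁ δ₂ δ₃ p W m h (X v) v) :
    NearAbove η (fun v => freeTransport δ₁ τ p (X v) v)
      fun v => field ν τ δ₁ δ₂ δ₃ p W m h (X v) v where
  finite := hfinite
  ge := (H.freeTransport_le_field T).mono fun v hv => hv _ (hX v)
  excess_le := H.energyNorm_sub_freeTransport_le hX T.finite T.energyNorm_le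
    (ae_of_all _ fun v => (H.continuous_gaussian_apply T v).intervalIntegrable _ _)
    fun y _ v => H.abs_gaussian_le T y v

theorem nearAbove_field (H : WeakInteraction ν τ δ₁ δ₂ δ₃ p W Ω Ψ B η)
    (T : IsTrialState Ω B m h) {x : ℝ} (hx : x ∈ Icc (0 : ℝ) 1) :
    NearAbove η (freeTransport δ₁ τ p x) (field ν τ δ₁ δ₂ δ₃ p W m h x) :=
  H.nearAbove_field_comp T (X := fun _ => x) (fun _ => hx) (H.hasFiniteEnergy_field T hx)

theorem nearAbove_outgoing_field (H : WeakInteraction ν τ δ₁ δ₂ δ₃ p W Ω Ψ B η)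
    (T : IsTrialState Ω B m h) :
    NearAbove η (outgoing (freeTransport δ₁ τ p)) (outgoing (field ν τ δ₁ δ₂ δ₃ p W m h)) :=
  H.nearAbove_field_comp T exitPosition_mem
    (HasFiniteEnergy.outgoing fun _ hx => H.hasFiniteEnergy_field T hx)

theorem field_nonneg (H : WeakInteraction ν τ δ₁ δ₂ δ₃ p W Ω Ψ B η) (T : IsTrialState Ω B m h) :
    ∀ᵐ v, ∀ x ∈ Icc (0 : ℝ) 1, 0 ≤ field ν τ δ₁ δ₂ δ₃ p W m h x v := by
  filter_upwards [H.freeTransport_le_field T, H.data_nonneg] with v hv hp x hx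
  exact (freeTransport_nonneg H.inflow_nonneg hp).trans (hv x hx)

theorem energyNorm_outgoing_field_le (H : WeakInteraction ν τ δ₁ δ₂ δ₃ p W Ω Ψ B η)
    (T : IsTrialState Ω B m h) : energyNorm (outgoing (field ν τ δ₁ δ₂ δ₃ p W m h)) ≤ B := by
  have hfree : energyNorm (outgoing (freeTransport δ₁ τ p)) ≤ energyNorm p := by
    refine H.data_finite.energyNorm_mono (H.data_nonneg.mono fun v hv => ?_)
    rw [outgoing, abs_of_nonneg (freeTransport_nonneg H.inflow_nonneg hv), abs_of_nonneg hv]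
    exact freeTransport_le H.time_pos.le (exitPosition_mem v) H.inflow_le_one hv
  have hnear := (H.nearAbove_outgoing_field T).energyNorm_le
    (HasFiniteEnergy.outgoing fun _ hx => H.data_finite.freeTransport H.time_pos.le hx)
  linarith [H.trace_le]

end Field

end WeakInteraction

end Contraction

/-- Moment paths together with outgoing traces, the latter multiplied by `1 + |v|²`. -/
abbrev State : Type := C(Icc (0 : ℝ) 1, Moments) × Lp ℝ 1 (volume : Measure V)

/-- The moment path of a state, extended constantly to all positions. -/
def State.path (q : State) (y : ℝ) : Moments := q.1 (projIcc 0 1 zero_le_one y)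

/-- The outgoing trace of a state. -/
def State.trace (q : State) (v : V) : ℝ := q.2 v / (1 + ‖v‖ ^ 2)

/-- The states whose path and trace form a trial state. -/
def stateSet (Ω : Set Moments) (B : ℝ) : Set State :=
  {q | (∀ x, q.1 x ∈ Ω) ∧ 0 ≤ q.2 ∧ ‖q.2‖ ≤ B}

section State

variable {Ω : Set Moments} {B : ℝ} {q q' : State} {f g : V → ℝ}

theorem isClosed_stateSet (hΩ : IsClosed Ω) : IsClosed (stateSet Ω B) := by
  have hmem : IsClosed {q : State | ∀ x, q.1 x ∈ Ω} := by
    simp only [ofPred_forall]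
    exact isClosed_iInter fun x =>
      hΩ.preimage ((ContinuousEvalConst.continuous_eval_const x).comp continuous_fst)
  have hnonneg : IsClosed {q : State | 0 ≤ q.2} := isClosed_le continuous_const continuous_snd
  have hnorm : IsClosed {q : State | ‖q.2‖ ≤ B} :=
    isClosed_le continuous_snd.norm continuous_const
  exact hmem.inter (hnonneg.inter hnorm)

theorem State.trace_mul (q : State) (v : V) : q.trace v * (1 + ‖v‖ ^ 2) = q.2 v :=
  div_mul_cancel₀ _ (by positivity)

theorem abs_mul_one_add_norm_sq (a : ℝ) (v : V) : |a| * (1 + ‖v‖ ^ 2) = ‖a * (1 + ‖v‖ ^ 2)‖ := by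
  rw [norm_mul, Real.norm_eq_abs, Real.norm_of_nonneg (by positivity)]

theorem State.energyNorm_trace (q : State) : energyNorm q.trace = ‖q.2‖ := by
  simp only [energyNorm, abs_mul_one_add_norm_sq, trace_mul, L1.norm_eq_integral_norm]

theorem State.energyNorm_trace_sub (q q' : State) :
    (energyNorm fun v => q.trace v - q'.trace v) = dist q.2 q'.2 := by
  rw [dist_eq_norm, L1.norm_eq_integral_norm]
  refine integral_congr_ae ?_
  filter_upwards [Lp.coeFn_sub q.2 q'.2] with v hv
  rw [hv, Pi.sub_apply, ← trace_mul, ← trace_mul, ← sub_mul, abs_mul_one_add_norm_sq]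

theorem State.norm_path_sub_le (q q' : State) (y : ℝ) : ‖q.path y - q'.path y‖ ≤ dist q.1 q'.1 := by
  rw [← dist_eq_norm]
  exact ContinuousMap.dist_apply_le_dist _

theorem isTrialState_of_mem (hq : q ∈ stateSet Ω B) : IsTrialState Ω B q.path q.trace where
  continuous := q.1.continuous.comp continuous_projIcc
  mem y := hq.1 _
  finite := by
    simp only [HasFiniteEnergy, State.trace_mul]
    exact L1.integrable_coeFn q.2
  nonneg := ((Lp.coeFn_nonneg q.2).2 hq.2.1).mono fun v hv => div_nonneg hv (by positivity)
  energyNorm_le := q.energyNorm_trace.trans_le hq.2.2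

/-- A distribution of finite energy, multiplied by `1 + |v|²`, as an element of `L¹`. -/
def HasFiniteEnergy.weighted (hf : HasFiniteEnergy f) : Lp ℝ 1 (volume : Measure V) :=
  Integrable.toL1 (fun v => f v * (1 + ‖v‖ ^ 2)) hf

theorem HasFiniteEnergy.coeFn_weighted (hf : HasFiniteEnergy f) :
    ∀ᵐ v, hf.weighted v = f v * (1 + ‖v‖ ^ 2) :=
  Integrable.coeFn_toL1 hf

theorem HasFiniteEnergy.norm_weighted (hf : HasFiniteEnergy f) :
    ‖hf.weighted‖ = energyNorm f := by
  rw [L1.norm_eq_integral_norm]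
  refine integral_congr_ae (hf.coeFn_weighted.mono fun v hv => ?_)
  simp only [hv, abs_mul_one_add_norm_sq]

theorem HasFiniteEnergy.dist_weighted (hf : HasFiniteEnergy f) (hg : HasFiniteEnergy g) :
    dist hf.weighted hg.weighted = energyNorm fun v => f v - g v := by
  rw [dist_eq_norm, L1.norm_eq_integral_norm]
  refine integral_congr_ae ?_
  filter_upwards [Lp.coeFn_sub hf.weighted hg.weighted, hf.coeFn_weighted, hg.coeFn_weighted]
    with v hsub hf hg
  rw [hsub, Pi.sub_apply, hf, hg, ← sub_mul, abs_mul_one_add_norm_sq]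

theorem HasFiniteEnergy.weighted_nonneg (hf : HasFiniteEnergy f) (h0 : ∀ᵐ v, 0 ≤ f v) :
    0 ≤ hf.weighted := by
  refine (Lp.coeFn_nonneg _).1 ?_
  filter_upwards [hf.coeFn_weighted, h0] with v hv hv0
  rw [hv]
  exact mul_nonneg hv0 (by positivity)

end State

section Existence

variable {ν τ δ₁ δ₂ δ₃ B η : ℝ} {p W : V → ℝ} {Ω : Set Moments} {Ψ : V → ℝ}

namespace WeakInteraction

/-- One iteration: the moments and the outgoing trace of the field that a trial state produces. -/
def nextState (H : WeakInteraction ν τ δ₁ δ₂ δ₃ p W Ω Ψ B η) {m : ℝ → Moments} {h : V → ℝ}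
    (T : IsTrialState Ω B m h) : State :=
  (⟨fun x => moments (field ν τ δ₁ δ₂ δ₃ p W m h x), H.continuous_moments_field T⟩,
    (H.nearAbove_outgoing_field T).finite.weighted)

theorem nextState_mem (H : WeakInteraction ν τ δ₁ δ₂ δ₃ p W Ω Ψ B η)
    (hinv : ∀ x ∈ Icc (0 : ℝ) 1, ∀ f, NearAbove η (freeTransport δ₁ τ p x) f → moments f ∈ Ω)
    {m : ℝ → Moments} {h : V → ℝ} (T : IsTrialState Ω B m h) : H.nextState T ∈ stateSet Ω B := by
  refine ⟨fun x => hinv x x.2 _ (H.nearAbove_field T x.2),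
    (H.nearAbove_outgoing_field T).finite.weighted_nonneg ?_,
    ((H.nearAbove_outgoing_field T).finite.norm_weighted).trans_le
      (H.energyNorm_outgoing_field_le T)⟩
  exact (H.field_nonneg T).mono fun v hv => hv _ (exitPosition_mem v)

theorem dist_nextState_le (H : WeakInteraction ν τ δ₁ δ₂ δ₃ p W Ω Ψ B η) {q q' : State}
    (hq : q ∈ stateSet Ω B) (hq' : q' ∈ stateSet Ω B) :
    dist (H.nextState (isTrialState_of_mem hq)) (H.nextState (isTrialState_of_mem hq')) ≤
      dist q q' / 2 := by
  have T := isTrialState_of_mem hq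
  have T' := isTrialState_of_mem hq'
  have hfield : ∀ X : V → ℝ, (∀ v, X v ∈ Icc (0 : ℝ) 1) →
      (energyNorm fun v => field ν τ δ₁ δ₂ δ₃ p W q.path q.trace (X v) v -
        field ν τ δ₁ δ₂ δ₃ p W q'.path q'.trace (X v) v) ≤ dist q q' / 2 := fun X hX =>
    H.energyNorm_transport_sub_le hX T.finite T'.finite
      ((q.energyNorm_trace_sub q').trans_le (le_max_right _ _))
      (ae_of_all _ fun v => (H.continuous_gaussian_apply T v).intervalIntegrable _ _)
      (ae_of_all _ fun v => (H.continuous_gaussian_apply T' v).intervalIntegrable _ _)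
      fun y _ v => (H.gaussian_lipschitz _ (T.mem y) _ (T'.mem y) v).trans
        (mul_le_mul_of_nonneg_right ((q.norm_path_sub_le q' y).trans (le_max_left _ _))
          (H.bound_nonneg v))
  rw [Prod.dist_eq]
  refine max_le ((ContinuousMap.dist_le (by positivity)).2 fun x => ?_) ?_
  · rw [dist_eq_norm]
    exact ((H.hasFiniteEnergy_field T x.2).norm_moments_sub_le
      (H.hasFiniteEnergy_field T' x.2)).trans (hfield (fun _ => x) fun _ => x.2)
  · exact ((H.nearAbove_outgoing_field T).finite.dist_weighted
      (H.nearAbove_outgoing_field T').finite).trans_le (hfield exitPosition exitPosition_mem)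

theorem exists_fixed_field (H : WeakInteraction ν τ δ₁ δ₂ δ₃ p W Ω Ψ B η)
    (hinv : ∀ x ∈ Icc (0 : ℝ) 1, ∀ f, NearAbove η (freeTransport δ₁ τ p x) f → moments f ∈ Ω) :
    ∃ m h, IsTrialState Ω B m h ∧
      (∀ y ∈ Icc (0 : ℝ) 1, moments (field ν τ δ₁ δ₂ δ₃ p W m h y) = m y) ∧
      ∀ᵐ v, outgoing (field ν τ δ₁ δ₂ δ₃ p W m h) v = h v := by
  have hcomplete : CompleteSpace (stateSet Ω B) := (isClosed_stateSet H.closed).completeSpace_coe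
  have hB : 0 ≤ B := by linarith [energyNorm_nonneg p, H.excess_nonneg, H.trace_le]
  have hnonempty : Nonempty (stateSet Ω B) :=
    ⟨⟨(ContinuousMap.const _ (moments (freeTransport δ₁ τ p 0)), 0),
      fun _ => hinv 0 (by simp) _ (NearAbove.refl H.excess_nonneg
        (H.data_finite.freeTransport H.time_pos.le (by simp))), le_rfl, by simpa using hB⟩⟩
  let Φ : stateSet Ω B → stateSet Ω B := fun q =>
    ⟨H.nextState (isTrialState_of_mem q.2), H.nextState_mem hinv _⟩
  have hΦ : ContractingWith (1 / 2) Φ := by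
    refine ⟨by norm_num, LipschitzWith.of_dist_le_mul fun q q' => ?_⟩
    refine (H.dist_nextState_le q.2 q'.2).trans_eq ?_
    rw [Subtype.dist_eq]
    push_cast
    ring
  obtain ⟨⟨q, hq⟩, hfix⟩ : ∃ q, Φ q = q := ⟨_, hΦ.fixedPoint_isFixedPt⟩
  have hnext : H.nextState (isTrialState_of_mem hq) = q := congrArg Subtype.val hfix
  refine ⟨q.path, q.trace, isTrialState_of_mem hq, fun y hy => ?_, ?_⟩
  · have hmoments := DFunLike.congr_fun (congrArg Prod.fst hnext) ⟨y, hy⟩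
    rw [State.path, projIcc_of_mem zero_le_one hy]
    exact hmoments
  · have htrace := congrArg Prod.snd hnext
    filter_upwards [(H.nearAbove_outgoing_field
      (isTrialState_of_mem hq)).finite.coeFn_weighted] with v hv
    rw [State.trace, ← htrace, nextState, hv, mul_div_cancel_right₀ _ (by positivity)]

end WeakInteraction

end Existence

section MildSolution

variable {ν τ δ₁ δ₂ δ₃ θ₀ θ₁ B η : ℝ} {fL fR : V → ℝ} {f g : ℝ → V → ℝ} {Ω : Set Moments}
  {Ψ : V → ℝ}

theorem wallFlux_outgoing_of_pos (f : ℝ → V → ℝ) {v : V} (hv : 0 < v 0) :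
    wallFlux (outgoing f) v = ∫ w in {w : V | w 0 < 0}, f 0 w * |w 0| := by
  rw [wallFlux, if_pos hv]
  refine setIntegral_congr_fun measurableSet_neg fun w hw => ?_
  simp only [outgoing, exitPosition, if_neg (show w 0 < 0 from hw).not_gt]

theorem wallFlux_outgoing_of_neg (f : ℝ → V → ℝ) {v : V} (hv : v 0 < 0) :
    wallFlux (outgoing f) v = ∫ w in {w : V | 0 < w 0}, f 1 w * |w 0| := by
  rw [wallFlux, if_neg hv.not_gt]
  refine setIntegral_congr_fun measurableSet_pos fun w hw => ?_
  simp only [outgoing, exitPosition, if_pos (show 0 < w 0 from hw)]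

theorem inflow_outgoing_of_pos (f : ℝ → V → ℝ) {v : V} (hv : 0 < v 0) :
    inflow δ₁ δ₂ δ₃ (glue fL fR) (glue (wallMaxwellian θ₀) (wallMaxwellian θ₁)) (outgoing f) v =
      δ₁ * fL v + δ₂ * (∫ w in {w : V | w 0 < 0}, f 0 w * |w 0|) * wallMaxwellian θ₀ v +
        δ₃ * f 0 (reflect v) := by
  have hv' : ¬ 0 < reflect v 0 := by simpa [reflect_zero_apply] using hv.le
  rw [inflow, reemission, wallFlux_outgoing_of_pos f hv]
  simp only [glue, outgoing, exitPosition, if_pos hv, if_neg hv', mul_assoc, add_assoc]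

theorem inflow_outgoing_of_neg (f : ℝ → V → ℝ) {v : V} (hv : v 0 < 0) :
    inflow δ₁ δ₂ δ₃ (glue fL fR) (glue (wallMaxwellian θ₀) (wallMaxwellian θ₁)) (outgoing f) v =
      δ₁ * fR v + δ₂ * (∫ w in {w : V | 0 < w 0}, f 1 w * |w 0|) * wallMaxwellian θ₁ v +
        δ₃ * f 1 (reflect v) := by
  have hv' : 0 < reflect v 0 := by simpa [reflect_zero_apply] using hv
  rw [inflow, reemission, wallFlux_outgoing_of_neg f hv]
  simp only [glue, outgoing, exitPosition, if_neg hv.not_gt, if_pos hv, if_pos hv', mul_assoc,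
    add_assoc]

theorem transport_of_pos (k : V → ℝ) (Q : ℝ → V → ℝ) (x : ℝ) {v : V} (hv : 0 < v 0) :
    transport τ k Q x v = Real.exp (-(x / (τ * |v 0|))) * k v +
      1 / (τ * |v 0|) * ∫ y in (0 : ℝ)..x, Real.exp (-((x - y) / (τ * |v 0|))) * Q y v := by
  simp only [transport, attenuation, collision, relax, depth, if_pos hv]

theorem transport_of_neg (k : V → ℝ) (Q : ℝ → V → ℝ) (x : ℝ) {v : V} (hv : v 0 < 0) :
    transport τ k Q x v = Real.exp (-((1 - x) / (τ * |v 0|))) * k v +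
      1 / (τ * |v 0|) * ∫ y in x..(1 : ℝ), Real.exp (-((y - x) / (τ * |v 0|))) * Q y v := by
  have h := intervalIntegral.integral_comp_sub_left (a := 0) (b := 1 - x)
    (fun y => Real.exp (-((y - x) / (τ * |v 0|))) * Q y v) 1
  rw [sub_sub_cancel, sub_zero] at h
  rw [← h]
  simp only [transport, attenuation, collision, relax, depth, if_neg hv.not_gt, sub_right_comm]

theorem transport_zero_of_pos (k : V → ℝ) (Q : ℝ → V → ℝ) {v : V} (hv : 0 < v 0) :
    transport τ k Q 0 v = k v := by
  simp [transport_of_pos _ _ _ hv]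

theorem transport_one_of_neg (k : V → ℝ) (Q : ℝ → V → ℝ) {v : V} (hv : v 0 < 0) :
    transport τ k Q 1 v = k v := by
  simp [transport_of_neg _ _ _ hv]

theorem IsMildSolution.eq_transport (hf : IsMildSolution ν τ δ₁ δ₂ δ₃ θ₀ θ₁ fL fR f) :
    ∀ᵐ v, ∀ x ∈ Icc (0 : ℝ) 1, f x v = transport τ
      (inflow δ₁ δ₂ δ₃ (glue fL fR) (glue (wallMaxwellian θ₀) (wallMaxwellian θ₁)) (outgoing f))
      (fun y v => ellipsoidalGaussian ν (f y) v) x v := by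
  filter_upwards [hf.mild_pos, hf.mild_neg, hf.boundary_left, hf.boundary_right,
    ae_apply_ne_zero 0] with v hpos hneg hleft hright hv x hx
  rcases hv.lt_or_gt with hv | hv
  · rw [transport_of_neg _ _ _ hv, inflow_outgoing_of_neg f hv, ← hright hv, ← hneg hv x hx]
  · rw [transport_of_pos _ _ _ hv, inflow_outgoing_of_pos f hv, ← hleft hv, ← hpos hv x hx]

theorem isMildSolution_of_eq_transport
    (hmeas : AEStronglyMeasurable (Function.uncurry f)
      ((volume.restrict (Icc (0 : ℝ) 1)).prod (volume : Measure V)))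
    (hfin : ∀ x ∈ Icc (0 : ℝ) 1, HasFiniteEnergy (f x))
    (hbdd : ∃ B : ℝ, ∀ x ∈ Icc (0 : ℝ) 1, energyNorm (f x) ≤ B)
    (hgauss : ∀ᵐ v : V, IntervalIntegrable (fun y => ellipsoidalGaussian ν (f y) v) volume 0 1)
    (hf : ∀ᵐ v, ∀ x ∈ Icc (0 : ℝ) 1, f x v = transport τ
      (inflow δ₁ δ₂ δ₃ (glue fL fR) (glue (wallMaxwellian θ₀) (wallMaxwellian θ₁)) (outgoing f))
      (fun y v => ellipsoidalGaussian ν (f y) v) x v) :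
    IsMildSolution ν τ δ₁ δ₂ δ₃ θ₀ θ₁ fL fR f where
  measurable := hmeas
  integrable := hfin
  bounded := hbdd
  gaussian_integrable := hgauss
  mild_pos := by
    filter_upwards [hf] with v hv hpos x hx
    rw [hv x hx, hv 0 (by simp), transport_zero_of_pos _ _ hpos, transport_of_pos _ _ _ hpos]
  mild_neg := by
    filter_upwards [hf] with v hv hneg x hx
    rw [hv x hx, hv 1 (by simp), transport_one_of_neg _ _ hneg, transport_of_neg _ _ _ hneg]
  boundary_left := by
    filter_upwards [hf] with v hv hpos
    rw [hv 0 (by simp), transport_zero_of_pos _ _ hpos, inflow_outgoing_of_pos f hpos]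
  boundary_right := by
    filter_upwards [hf] with v hv hneg
    rw [hv 1 (by simp), transport_one_of_neg _ _ hneg, inflow_outgoing_of_neg f hneg]

theorem WeakInteraction.isMildSolution_field
    (H : WeakInteraction ν τ δ₁ δ₂ δ₃ (glue fL fR) (glue (wallMaxwellian θ₀) (wallMaxwellian θ₁))
      Ω Ψ B η) {m : ℝ → Moments} {h : V → ℝ} (T : IsTrialState Ω B m h)
    (hfix : ∀ y ∈ Icc (0 : ℝ) 1, moments (field ν τ δ₁ δ₂ δ₃ (glue fL fR)
      (glue (wallMaxwellian θ₀) (wallMaxwellian θ₁)) m h y) = m y)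
    (hout : ∀ᵐ v, outgoing (field ν τ δ₁ δ₂ δ₃ (glue fL fR)
      (glue (wallMaxwellian θ₀) (wallMaxwellian θ₁)) m h) v = h v) :
    IsMildSolution ν τ δ₁ δ₂ δ₃ θ₀ θ₁ fL fR (field ν τ δ₁ δ₂ δ₃ (glue fL fR)
      (glue (wallMaxwellian θ₀) (wallMaxwellian θ₁)) m h) := by
  set f := field ν τ δ₁ δ₂ δ₃ (glue fL fR) (glue (wallMaxwellian θ₀) (wallMaxwellian θ₁)) m h
  have hfin : ∀ x ∈ Icc (0 : ℝ) 1, HasFiniteEnergy (f x) := fun x hx =>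
    H.hasFiniteEnergy_field T hx
  have hgauss : ∀ y ∈ Icc (0 : ℝ) 1, ∀ v,
      ellipsoidalGaussian ν (f y) v = (m y).gaussian ν v := fun y hy v => by
    have hρ : (moments (f y)).1 ≠ 0 := hfix y hy ▸ H.density_ne_zero _ (T.mem y)
    rw [(hfin y hy).ellipsoidalGaussian_eq hρ, hfix y hy]
  refine isMildSolution_of_eq_transport (H.aestronglyMeasurable_uncurry_field T _) hfin
    ⟨energyNorm (glue fL fR) + η, fun x hx => ?_⟩ (ae_of_all _ fun v => ?_) ?_
  · exact (H.nearAbove_field T hx).energyNorm_le_of_freeTransport H.data_finite H.data_nonneg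
      H.inflow_nonneg H.inflow_le_one H.time_pos.le hx
  · refine ((H.continuous_gaussian_apply T v).intervalIntegrable 0 1).congr fun y hy => ?_
    rw [uIoc_of_le zero_le_one] at hy
    exact (hgauss y (Ioc_subset_Icc_self hy) v).symm
  · filter_upwards [inflow_congr (δ₁ := δ₁) (δ₂ := δ₂) (δ₃ := δ₃) (p := glue fL fR)
      (W := glue (wallMaxwellian θ₀) (wallMaxwellian θ₁)) hout] with v hv x hx
    rw [transport, hv, collision_congr hx fun y hy => hgauss y hy v]
    rfl

theorem WeakInteraction.exists_mild_solution
    (H : WeakInteraction ν τ δ₁ δ₂ δ₃ (glue fL fR) (glue (wallMaxwellian θ₀) (wallMaxwellian θ₁))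
      Ω Ψ B η)
    (hinv : ∀ x ∈ Icc (0 : ℝ) 1, ∀ f, NearAbove η (freeTransport δ₁ τ (glue fL fR) x) f →
      moments f ∈ Ω) :
    ∃ f, IsMildSolution ν τ δ₁ δ₂ δ₃ θ₀ θ₁ fL fR f ∧ Nonneg f ∧
      ∀ x ∈ Icc (0 : ℝ) 1, NearAbove η (freeTransport δ₁ τ (glue fL fR) x) (f x) := by
  obtain ⟨m, h, T, hfix, hout⟩ := H.exists_fixed_field hinv
  exact ⟨_, H.isMildSolution_field T hfix hout, H.field_nonneg T,
    fun x hx => H.nearAbove_field T hx⟩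

/-- `D` bounds the distance of `f` and `g` in the quantities on which the solution map depends: the
moments and, in energy norm, the outgoing traces. -/
def AreWithin (f g : ℝ → V → ℝ) (D : ℝ) : Prop :=
  (∀ x ∈ Icc (0 : ℝ) 1, ‖moments (f x) - moments (g x)‖ ≤ D) ∧
    (energyNorm fun v => outgoing f v - outgoing g v) ≤ D

theorem IsMildSolution.exists_areWithin (hf : IsMildSolution ν τ δ₁ δ₂ δ₃ θ₀ θ₁ fL fR f)
    (hg : IsMildSolution ν τ δ₁ δ₂ δ₃ θ₀ θ₁ fL fR g) : ∃ D, AreWithin f g D := by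
  obtain ⟨B₁, hB₁⟩ := hf.bounded
  obtain ⟨B₂, hB₂⟩ := hg.bounded
  refine ⟨max (B₁ + B₂) _, fun x hx => le_trans ?_ (le_max_left _ _), le_max_right _ _⟩
  exact (norm_sub_le _ _).trans (add_le_add
    ((HasFiniteEnergy.norm_moments_le (hf.integrable x hx)).trans (hB₁ x hx))
    ((HasFiniteEnergy.norm_moments_le (hg.integrable x hx)).trans (hB₂ x hx)))

theorem IsMildSolution.ellipsoidalGaussian_eq
    (H : WeakInteraction ν τ δ₁ δ₂ δ₃ (glue fL fR) (glue (wallMaxwellian θ₀) (wallMaxwellian θ₁))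
      Ω Ψ B η) (hf : IsMildSolution ν τ δ₁ δ₂ δ₃ θ₀ θ₁ fL fR f)
    (hfΩ : ∀ x ∈ Icc (0 : ℝ) 1, moments (f x) ∈ Ω) {y : ℝ} (hy : y ∈ Icc (0 : ℝ) 1) (v : V) :
    ellipsoidalGaussian ν (f y) v = (moments (f y)).gaussian ν v :=
  HasFiniteEnergy.ellipsoidalGaussian_eq (hf.integrable y hy) (H.density_ne_zero _ (hfΩ y hy)) ν v

theorem AreWithin.half
    (H : WeakInteraction ν τ δ₁ δ₂ δ₃ (glue fL fR) (glue (wallMaxwellian θ₀) (wallMaxwellian θ₁))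
      Ω Ψ B η)
    (hf : IsMildSolution ν τ δ₁ δ₂ δ₃ θ₀ θ₁ fL fR f)
    (hg : IsMildSolution ν τ δ₁ δ₂ δ₃ θ₀ θ₁ fL fR g)
    (hfΩ : ∀ x ∈ Icc (0 : ℝ) 1, moments (f x) ∈ Ω)
    (hgΩ : ∀ x ∈ Icc (0 : ℝ) 1, moments (g x) ∈ Ω) {D : ℝ} (hD : AreWithin f g D) :
    AreWithin f g (D / 2) := by
  have hfield : ∀ X : V → ℝ, (∀ v, X v ∈ Icc (0 : ℝ) 1) →
      (energyNorm fun v => f (X v) v - g (X v) v) ≤ D / 2 := fun X hX => by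
    rw [energyNorm_congr ((hf.eq_transport.and hg.eq_transport).mono fun v hv =>
      congrArg₂ (· - ·) (hv.1 _ (hX v)) (hv.2 _ (hX v)))]
    refine H.energyNorm_transport_sub_le hX (HasFiniteEnergy.outgoing hf.integrable)
      (HasFiniteEnergy.outgoing hg.integrable) hD.2 hf.gaussian_integrable hg.gaussian_integrable
      fun y hy v => ?_
    rw [IsMildSolution.ellipsoidalGaussian_eq H hf hfΩ hy,
      IsMildSolution.ellipsoidalGaussian_eq H hg hgΩ hy]
    exact (H.gaussian_lipschitz _ (hfΩ y hy) _ (hgΩ y hy) v).trans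
      (mul_le_mul_of_nonneg_right (hD.1 y hy) (H.bound_nonneg v))
  exact ⟨fun x hx => (HasFiniteEnergy.norm_moments_sub_le (hf.integrable x hx)
      (hg.integrable x hx)).trans (hfield (fun _ => x) fun _ => hx),
    hfield exitPosition exitPosition_mem⟩

theorem areWithin_zero_of_half (hD : ∃ D, AreWithin f g D)
    (hhalf : ∀ D, AreWithin f g D → AreWithin f g (D / 2)) : AreWithin f g 0 := by
  obtain ⟨D, hD⟩ := hD
  have hpow : ∀ n : ℕ, AreWithin f g (D * (1 / 2) ^ n) := by
    intro n
    induction n with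
    | zero => simpa using hD
    | succ n ih => convert! hhalf _ ih using 1; ring
  have hlim : Filter.Tendsto (fun n : ℕ => D * (1 / 2 : ℝ) ^ n) Filter.atTop (nhds 0) := by
    simpa using (tendsto_pow_atTop_nhds_zero_of_lt_one (r := (1 / 2 : ℝ)) (by norm_num)
      (by norm_num)).const_mul D
  exact ⟨fun x hx => ge_of_tendsto' hlim fun n => (hpow n).1 x hx,
    ge_of_tendsto' hlim fun n => (hpow n).2⟩

theorem WeakInteraction.mild_solution_unique
    (H : WeakInteraction ν τ δ₁ δ₂ δ₃ (glue fL fR) (glue (wallMaxwellian θ₀) (wallMaxwellian θ₁))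
      Ω Ψ B η)
    (hf : IsMildSolution ν τ δ₁ δ₂ δ₃ θ₀ θ₁ fL fR f)
    (hg : IsMildSolution ν τ δ₁ δ₂ δ₃ θ₀ θ₁ fL fR g)
    (hfΩ : ∀ x ∈ Icc (0 : ℝ) 1, moments (f x) ∈ Ω)
    (hgΩ : ∀ x ∈ Icc (0 : ℝ) 1, moments (g x) ∈ Ω) : SameSolution f g := by
  obtain ⟨hmoments, htrace⟩ := areWithin_zero_of_half (hf.exists_areWithin hg) fun D hD =>
    hD.half H hf hg hfΩ hgΩ
  have hout : ∀ᵐ v, outgoing f v = outgoing g v :=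
    (HasFiniteEnergy.ae_eq_zero_of_energyNorm_le ((HasFiniteEnergy.outgoing hf.integrable).sub
      (HasFiniteEnergy.outgoing hg.integrable)) htrace).mono fun v hv => sub_eq_zero.1 hv
  have hgauss : ∀ y ∈ Icc (0 : ℝ) 1, ∀ v,
      ellipsoidalGaussian ν (f y) v = ellipsoidalGaussian ν (g y) v := fun y hy v => by
    rw [IsMildSolution.ellipsoidalGaussian_eq H hf hfΩ hy,
      IsMildSolution.ellipsoidalGaussian_eq H hg hgΩ hy,
      sub_eq_zero.1 (norm_le_zero_iff.1 (hmoments y hy))]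
  filter_upwards [hf.eq_transport, hg.eq_transport, inflow_congr (δ₁ := δ₁) (δ₂ := δ₂) (δ₃ := δ₃)
    (p := glue fL fR) (W := glue (wallMaxwellian θ₀) (wallMaxwellian θ₁)) hout]
    with v hfv hgv hv x hx
  rw [hfv x hx, hgv x hx, transport, transport, hv,
    collision_congr hx fun y hy => hgauss y hy v]

end MildSolution

section HalfSpaces

theorem integral_eq_add_setIntegral {F : V → ℝ} (hF : Integrable F) :
    ∫ v, F v = (∫ v in {v : V | 0 < v 0}, F v) + ∫ v in {v : V | v 0 < 0}, F v := by
  rw [← integral_add_compl measurableSet_pos hF]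
  congr 1
  refine setIntegral_congr_set ?_
  filter_upwards [ae_apply_ne_zero 0] with v hv
  exact propext ⟨fun h => lt_of_le_of_ne (not_lt.1 h) hv, fun h => not_lt.2 (le_of_lt h)⟩

theorem setIntegral_neg_eq_setIntegral_pos {F : V → ℝ} (hF : ∀ v, F (reflect v) = F v) :
    ∫ v in {v : V | v 0 < 0}, F v = ∫ v in {v : V | 0 < v 0}, F v := by
  have h := measurePreserving_reflect.setIntegral_preimage_emb measurableEmbedding_reflect F
    {v : V | 0 < v 0}
  simp only [hF] at h
  rw [← h]
  congr 2
  ext v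
  simp [reflect_zero_apply]

variable {hL hR : V → ℝ} {v : V}

theorem glue_of_pos (hv : 0 < v 0) : glue hL hR v = hL v := if_pos hv

theorem glue_of_neg (hv : v 0 < 0) : glue hL hR v = hR v := by
  rw [glue, if_neg hv.not_gt, if_pos hv]

theorem HasFiniteEnergy.glue (hhL : HasFiniteEnergy hL) (hhR : HasFiniteEnergy hR) :
    HasFiniteEnergy (glue hL hR) := by
  refine ((Integrable.indicator hhL measurableSet_pos).add
    (Integrable.indicator hhR measurableSet_neg)).congr (ae_of_all _ fun v => ?_)
  rcases lt_trichotomy (v 0) 0 with h | h | h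
  · simp [ESBGK.glue, indicator, h, h.not_gt]
  · simp [ESBGK.glue, indicator, h]
  · simp [ESBGK.glue, indicator, h, h.not_gt]

theorem HasFiniteEnergy.traceNorm_eq {h : V → ℝ} (hh : HasFiniteEnergy h) :
    traceNorm h = 2 * energyNorm h := by
  rw [traceNorm, traceNormOut, traceNormIn, energyNorm,
    integral_eq_add_setIntegral hh.integrable_abs_mul]
  ring

theorem energyNorm_glue_of_comp_reflect (hhL : HasFiniteEnergy hL) (hhR : HasFiniteEnergy hR)
    (hLr : ∀ v, hL (reflect v) = hL v) (hRr : ∀ v, hR (reflect v) = hR v) :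
    energyNorm (glue hL hR) = (energyNorm hL + energyNorm hR) / 2 := by
  have hpos : ∫ v in {v : V | 0 < v 0}, |glue hL hR v| * (1 + ‖v‖ ^ 2) =
      ∫ v in {v : V | 0 < v 0}, |hL v| * (1 + ‖v‖ ^ 2) :=
    setIntegral_congr_fun measurableSet_pos fun v hv => by simp only [glue_of_pos hv]
  have hneg : ∫ v in {v : V | v 0 < 0}, |glue hL hR v| * (1 + ‖v‖ ^ 2) =
      ∫ v in {v : V | v 0 < 0}, |hR v| * (1 + ‖v‖ ^ 2) :=
    setIntegral_congr_fun measurableSet_neg fun v hv => by simp only [glue_of_neg hv]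
  simp only [energyNorm]
  rw [integral_eq_add_setIntegral (hhL.glue hhR).integrable_abs_mul, hpos, hneg,
    integral_eq_add_setIntegral hhL.integrable_abs_mul,
    integral_eq_add_setIntegral hhR.integrable_abs_mul,
    setIntegral_neg_eq_setIntegral_pos fun v => by rw [hRr, norm_reflect],
    setIntegral_neg_eq_setIntegral_pos fun v => by rw [hLr, norm_reflect]]
  ring

end HalfSpaces

section WallMaxwellian

variable {θ θ₀ θ₁ : ℝ}

theorem wallMaxwellian_nonneg (hθ : 0 < θ) (v : V) : 0 ≤ wallMaxwellian θ v := by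
  unfold wallMaxwellian
  positivity

theorem wallMaxwellian_reflect (θ : ℝ) (v : V) :
    wallMaxwellian θ (reflect v) = wallMaxwellian θ v := by
  rw [wallMaxwellian, wallMaxwellian, norm_reflect]

theorem hasFiniteEnergy_wallMaxwellian (hθ : 0 < θ) : HasFiniteEnergy (wallMaxwellian θ) := by
  refine ((integrable_one_add_norm_sq_pow_mul_exp (l := 1 / (2 * θ)) (by positivity) 1).const_mul
    (1 / (2 * Real.pi * θ ^ 2))).congr (ae_of_all _ fun v => ?_)
  simp only [wallMaxwellian, show -(1 / (2 * θ)) * ‖v‖ ^ 2 = -(‖v‖ ^ 2) / (2 * θ) by ring]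
  ring

theorem integral_wallMaxwellian_mul_norm (hθ : 0 < θ) :
    ∫ v : V, wallMaxwellian θ v * ‖v‖ = 4 := by
  have hradial : ∫ r in Ioi (0 : ℝ), r ^ 3 * Real.exp (-(1 / (2 * θ)) * r ^ 2) = 2 * θ ^ 2 := by
    have h := integral_rpow_mul_exp_neg_mul_rpow (p := 2) (q := 3) (b := 1 / (2 * θ))
      (by norm_num) (by norm_num) (by positivity)
    norm_num [Real.Gamma_two] at h
    norm_num
    rw [h, mul_pow, inv_pow]
    field_simp
  have hvol : (volume : Measure V).real (Metric.ball 0 1) = Real.pi * 4 / 3 := by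
    rw [Measure.real, EuclideanSpace.volume_ball_fin_three, ENNReal.ofReal_one, one_pow, one_mul,
      ENNReal.toReal_ofReal (by positivity)]
  have hpolar := integral_fun_norm_addHaar (volume : Measure V)
    fun r => 1 / (2 * Real.pi * θ ^ 2) * Real.exp (-(r ^ 2) / (2 * θ)) * r
  have hintegrand : ∀ r : ℝ,
      r ^ (3 - 1) • (1 / (2 * Real.pi * θ ^ 2) * Real.exp (-(r ^ 2) / (2 * θ)) * r) =
        1 / (2 * Real.pi * θ ^ 2) * (r ^ 3 * Real.exp (-(1 / (2 * θ)) * r ^ 2)) := fun r => by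
    rw [smul_eq_mul, show -(1 / (2 * θ)) * r ^ 2 = -(r ^ 2) / (2 * θ) by ring]
    ring
  simp only [wallMaxwellian]
  rw [hpolar, hvol, finrank_euclideanSpace_fin]
  simp only [hintegrand, integral_const_mul, hradial, nsmul_eq_mul, smul_eq_mul]
  push_cast
  field_simp

theorem one_le_energyNorm_wallMaxwellian (hθ : 0 < θ) : 1 ≤ energyNorm (wallMaxwellian θ) := by
  have hM := hasFiniteEnergy_wallMaxwellian hθ
  have hnorm : Integrable fun v : V => wallMaxwellian θ v * ‖v‖ :=
    hM.integrable_mul (C := 1) (by fun_prop) fun v => by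
      simpa only [abs_norm, one_mul] using norm_le_one_add_norm_sq v
  calc (1 : ℝ) ≤ ∫ v : V, wallMaxwellian θ v * ‖v‖ := by
        rw [integral_wallMaxwellian_mul_norm hθ]
        norm_num
    _ ≤ ∫ v : V, wallMaxwellian θ v * (1 + ‖v‖ ^ 2) :=
        integral_mono hnorm hM fun v =>
          mul_le_mul_of_nonneg_left (norm_le_one_add_norm_sq v) (wallMaxwellian_nonneg hθ v)
    _ = energyNorm (wallMaxwellian θ) :=
        (energyNorm_of_nonneg (ae_of_all _ (wallMaxwellian_nonneg hθ))).symm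

theorem glue_wallMaxwellian_nonneg (hθ₀ : 0 < θ₀) (hθ₁ : 0 < θ₁) (v : V) :
    0 ≤ glue (wallMaxwellian θ₀) (wallMaxwellian θ₁) v := by
  unfold glue
  split_ifs
  exacts [wallMaxwellian_nonneg hθ₀ v, wallMaxwellian_nonneg hθ₁ v, le_rfl]

theorem hasFiniteEnergy_glue_wallMaxwellian (hθ₀ : 0 < θ₀) (hθ₁ : 0 < θ₁) :
    HasFiniteEnergy (glue (wallMaxwellian θ₀) (wallMaxwellian θ₁)) :=
  (hasFiniteEnergy_wallMaxwellian hθ₀).glue (hasFiniteEnergy_wallMaxwellian hθ₁)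

theorem one_le_energyNorm_glue_wallMaxwellian (hθ₀ : 0 < θ₀) (hθ₁ : 0 < θ₁) :
    1 ≤ energyNorm (glue (wallMaxwellian θ₀) (wallMaxwellian θ₁)) := by
  rw [energyNorm_glue_of_comp_reflect (hasFiniteEnergy_wallMaxwellian hθ₀)
    (hasFiniteEnergy_wallMaxwellian hθ₁) (wallMaxwellian_reflect θ₀) (wallMaxwellian_reflect θ₁)]
  linarith [one_le_energyNorm_wallMaxwellian hθ₀, one_le_energyNorm_wallMaxwellian hθ₁]

end WallMaxwellian

section Data

variable {θ₀ θ₁ : ℝ} {fL fR p q : V → ℝ}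

/-- The part `e^{-1/|v₁|} p` of the inflow `p` that crosses the whole slab without a collision when
`τ = 1`. -/
def damped (p : V → ℝ) (v : V) : ℝ := Real.exp (-(1 / |v 0|)) * p v

theorem damped_nonneg {v : V} (hp : 0 ≤ p v) : 0 ≤ damped p v :=
  mul_nonneg (Real.exp_pos _).le hp

theorem abs_damped_le (p : V → ℝ) (v : V) : |damped p v| ≤ |p v| := by
  rw [damped, abs_mul, abs_of_pos (Real.exp_pos _)]
  exact mul_le_of_le_one_left (abs_nonneg _)
    (Real.exp_le_one_iff.2 (neg_nonpos.2 (by positivity)))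

theorem damped_eq_zero_iff {v : V} : damped p v = 0 ↔ p v = 0 := by
  simp [damped, Real.exp_ne_zero]

theorem HasFiniteEnergy.damped (hp : HasFiniteEnergy p) : HasFiniteEnergy (damped p) :=
  hp.mono (AEStronglyMeasurable.mul (Measurable.aestronglyMeasurable (by fun_prop))
    hp.aestronglyMeasurable) (ae_of_all _ (abs_damped_le p))

theorem integral_mul_pos {μ : Measure V} (hp : ∀ᵐ v ∂μ, 0 ≤ p v) (hp0 : ¬ ∀ᵐ v ∂μ, p v = 0)
    (hq : ∀ᵐ v ∂μ, 0 < q v) (hpq : Integrable (fun v => p v * q v) μ) :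
    0 < ∫ v, p v * q v ∂μ := by
  have hnonneg : 0 ≤ᵐ[μ] fun v => p v * q v := by
    filter_upwards [hp, hq] with v hpv hqv using mul_nonneg hpv hqv.le
  refine lt_of_le_of_ne (integral_nonneg_of_ae hnonneg) fun hzero => hp0 ?_
  filter_upwards [(integral_eq_zero_iff_of_nonneg_ae hnonneg hpq).1 hzero.symm, hq] with v h hqv
  exact (mul_eq_zero.1 h).resolve_right hqv.ne'

theorem P1.damped_nonneg (hP : P1 fL fR) : ∀ᵐ v, 0 ≤ damped (glue fL fR) v :=
  hP.nonneg.mono fun _ => ESBGK.damped_nonneg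

theorem P1.hasFiniteEnergy (hP : P1 fL fR) : HasFiniteEnergy (glue fL fR) := hP.finite

theorem P1.damped_nontrivial (hP : P1 fL fR) : ¬ ∀ᵐ v, damped (glue fL fR) v = 0 := by
  simpa only [damped_eq_zero_iff] using hP.nontrivial

theorem P1.energyNorm_pos (hP : P1 fL fR) : 0 < energyNorm (glue fL fR) := by
  rw [energyNorm_of_nonneg hP.nonneg]
  exact integral_mul_pos hP.nonneg hP.nontrivial (ae_of_all _ fun v => by positivity) hP.finite

theorem four_mul_energyNorm_le_CLR (hθ₀ : 0 < θ₀) (hθ₁ : 0 < θ₁) (hP : P1 fL fR) :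
    4 * energyNorm (glue fL fR) ≤ CLR θ₀ θ₁ fL fR := by
  rw [CLR, hP.hasFiniteEnergy.traceNorm_eq,
    (hasFiniteEnergy_glue_wallMaxwellian hθ₀ hθ₁).traceNorm_eq]
  nlinarith [one_le_energyNorm_glue_wallMaxwellian hθ₀ hθ₁, hP.energyNorm_pos]

theorem CLR_pos (hθ₀ : 0 < θ₀) (hθ₁ : 0 < θ₁) (hP : P1 fL fR) : 0 < CLR θ₀ θ₁ fL fR := by
  linarith [four_mul_energyNorm_le_CLR hθ₀ hθ₁ hP, hP.energyNorm_pos]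

theorem aEll_pos (hP : P1 fL fR) : 0 < aEll fL fR := by
  have hpos := integral_mul_pos (q := fun _ => 1) hP.damped_nonneg hP.damped_nontrivial
    (ae_of_all _ fun _ => one_pos) (hP.hasFiniteEnergy.damped.integrable.mul_const 1)
  simpa only [mul_one, aEll, damped] using hpos

theorem gammaEll_eq (fL fR : V → ℝ) :
    gammaEll fL fR = (∫ v in {v : V | 0 < v 0}, damped (glue fL fR) v * |v 0|) *
      ∫ v in {v : V | v 0 < 0}, damped (glue fL fR) v * |v 0| := by
  rw [gammaEll]
  congr 1
  · exact setIntegral_congr_fun measurableSet_pos fun v hv => by simp only [damped, glue_of_pos hv]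
  · exact setIntegral_congr_fun measurableSet_neg fun v hv => by simp only [damped, glue_of_neg hv]

theorem gammaEll_nonneg (hP : P1 fL fR) : 0 ≤ gammaEll fL fR := by
  have hnonneg : ∀ S : Set V, 0 ≤ ∫ v in S, damped (glue fL fR) v * |v 0| := fun S =>
    integral_nonneg_of_ae <| ae_restrict_of_ae <| hP.damped_nonneg.mono fun v hv =>
      mul_nonneg hv (abs_nonneg _)
  rw [gammaEll_eq]
  exact mul_nonneg (hnonneg _) (hnonneg _)

theorem P1.setIntegral_damped_mul_pos (hP : P1 fL fR) {S : Set V} (hS : MeasurableSet S)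
    (hne : ¬ ∀ᵐ v, v ∈ S → glue fL fR v = 0) :
    0 < ∫ v in S, damped (glue fL fR) v * |v 0| := by
  refine integral_mul_pos (ae_restrict_of_ae hP.damped_nonneg) ?_
    (ae_restrict_of_ae ((ae_apply_ne_zero 0).mono fun v => abs_pos.2))
    (hP.hasFiniteEnergy.damped.integrable_mul_abs_apply 0).integrableOn
  simpa only [damped_eq_zero_iff, ae_restrict_iff' hS] using hne

theorem gammaEll_pos (hP : P1 fL fR) (hL : ¬ ∀ᵐ v : V, 0 < v 0 → fL v = 0)
    (hR : ¬ ∀ᵐ v : V, v 0 < 0 → fR v = 0) : 0 < gammaEll fL fR := by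
  rw [gammaEll_eq]
  refine mul_pos (hP.setIntegral_damped_mul_pos measurableSet_pos fun h => hL ?_)
    (hP.setIntegral_damped_mul_pos measurableSet_neg fun h => hR ?_)
  · filter_upwards [h] with v hv hv0
    exact (glue_of_pos hv0).symm.trans (hv hv0)
  · filter_upwards [h] with v hv hv0
    exact (glue_of_neg hv0).symm.trans (hv hv0)

end Data

section TransverseEnergy

variable {fL fR p : V → ℝ} {κ : V}

/-- The energy `∫ p (|v|² - (v·κ)²) dv` of the motion orthogonal to the unit vector `κ`. -/
def transverseEnergy (p : V → ℝ) (κ : V) : ℝ := ∫ v, p v * (‖v‖ ^ 2 - inner ℝ v κ ^ 2)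

theorem norm_sub_inner_smul_sq (hκ : ‖κ‖ = 1) (v : V) :
    ‖v - (inner ℝ v κ : ℝ) • κ‖ ^ 2 = ‖v‖ ^ 2 - inner ℝ v κ ^ 2 := by
  rw [norm_sub_sq_real, real_inner_smul_right, norm_smul, hκ, mul_one, Real.norm_eq_abs, sq_abs]
  ring

theorem inner_sq_le_norm_sq (hκ : ‖κ‖ = 1) (v : V) : inner ℝ v κ ^ 2 ≤ ‖v‖ ^ 2 := by
  linarith [norm_sub_inner_smul_sq hκ v, sq_nonneg ‖v - (inner ℝ v κ : ℝ) • κ‖]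

theorem ae_inner_sq_lt_norm_sq (hκ : ‖κ‖ = 1) : ∀ᵐ v : V, inner ℝ v κ ^ 2 < ‖v‖ ^ 2 := by
  have hnull := Measure.addHaar_submodule (volume : Measure V) (Submodule.span ℝ {κ}) (by
    intro htop
    have hcard := finrank_span_le_card (R := ℝ) ({κ} : Set V)
    rw [htop, finrank_top, finrank_euclideanSpace_fin] at hcard
    simp at hcard)
  filter_upwards [measure_eq_zero_iff_ae_notMem.1 hnull] with v hv
  refine lt_of_le_of_ne (inner_sq_le_norm_sq hκ v) fun heq => hv ?_
  have hzero : ‖v - (inner ℝ v κ : ℝ) • κ‖ ^ 2 = 0 := by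
    rw [norm_sub_inner_smul_sq hκ, heq, sub_self]
  exact Submodule.mem_span_singleton.2
    ⟨_, (sub_eq_zero.1 (norm_eq_zero.1 (pow_eq_zero_iff two_ne_zero |>.1 hzero))).symm⟩

theorem HasFiniteEnergy.integrable_mul_transverse (hp : HasFiniteEnergy p) (κ : V) :
    Integrable fun v => p v * (‖v‖ ^ 2 - inner ℝ v κ ^ 2) := by
  simp only [mul_sub]
  exact hp.integrable_mul_norm_sq.sub (hp.integrable_mul_inner_sq κ)

theorem transverseEnergy_nonneg (hp : ∀ᵐ v, 0 ≤ p v) (hκ : ‖κ‖ = 1) : 0 ≤ transverseEnergy p κ :=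
  integral_nonneg_of_ae <| hp.mono fun v hv =>
    mul_nonneg hv (sub_nonneg.2 (inner_sq_le_norm_sq hκ v))

theorem HasFiniteEnergy.continuous_transverseEnergy (hp : HasFiniteEnergy p) :
    Continuous (transverseEnergy p) := by
  have hexpand : ∀ κ, transverseEnergy p κ =
      (∫ v, p v * ‖v‖ ^ 2) - ∑ i, ∑ j, (∫ v, p v * (v i * v j)) * (κ i * κ j) := fun κ => by
    have hsum := hp.integral_mul_inner_sub_sq_eq_sum 0 κ
    simp only [sub_zero, PiLp.zero_apply] at hsum
    simp only [transverseEnergy, mul_sub]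
    rw [integral_sub hp.integrable_mul_norm_sq (hp.integrable_mul_inner_sq κ), hsum]
  simp only [funext hexpand]
  fun_prop

theorem aCrit_eq (fL fR : V → ℝ) :
    aCrit fL fR = ⨅ κ : Metric.sphere (0 : V) 1, transverseEnergy (damped (glue fL fR)) κ :=
  rfl

theorem aCrit_le (hP : P1 fL fR) (hκ : ‖κ‖ = 1) :
    aCrit fL fR ≤ transverseEnergy (damped (glue fL fR)) κ := by
  rw [aCrit_eq]
  refine ciInf_le (f := fun κ : Metric.sphere (0 : V) 1 => transverseEnergy _ κ) ⟨0, ?_⟩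
    ⟨κ, by simpa using hκ⟩
  rintro _ ⟨κ', rfl⟩
  exact transverseEnergy_nonneg hP.damped_nonneg (by simp)

theorem aCrit_pos (hP : P1 fL fR) : 0 < aCrit fL fR := by
  have hfinite := hP.hasFiniteEnergy.damped
  have hne : Nonempty (Metric.sphere (0 : V) 1) := ⟨⟨EuclideanSpace.single 0 1, by simp⟩⟩
  have hcompact : CompactSpace (Metric.sphere (0 : V) 1) :=
    isCompact_iff_compactSpace.1 (isCompact_sphere (0 : V) 1)
  obtain ⟨κ, -, hmin⟩ := isCompact_univ.exists_isMinOn (univ_nonempty (α := Metric.sphere 0 1))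
    (hfinite.continuous_transverseEnergy.comp continuous_subtype_val).continuousOn
  have hpos : 0 < transverseEnergy (damped (glue fL fR)) κ :=
    integral_mul_pos hP.damped_nonneg hP.damped_nontrivial
      ((ae_inner_sq_lt_norm_sq (by simp)).mono fun v => sub_pos.2)
      (hfinite.integrable_mul_transverse κ)
  exact hpos.trans_le (le_ciInf fun κ' => hmin (mem_univ κ'))

end TransverseEnergy

section Slices

variable {fL fR : V → ℝ}

/-- The identification of `ℝ³` with `ℝ × ℝ²` that singles out the component normal to the walls. -/
def splitEquiv : V ≃ᵐ ℝ × ℝ × ℝ :=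
  ((MeasurableEquiv.toLp 2 (Fin 3 → ℝ)).symm.trans
    (MeasurableEquiv.piFinSuccAbove (fun _ => ℝ) 0)).trans
    ((MeasurableEquiv.refl ℝ).prodCongr MeasurableEquiv.finTwoArrow)

theorem measurePreserving_splitEquiv : MeasurePreserving splitEquiv :=
  ((EuclideanSpace.volume_preserving_symm_measurableEquiv_toLp (Fin 3)).trans
    (volume_preserving_piFinSuccAbove (fun _ => ℝ) 0)).trans
    ((MeasurePreserving.id volume).prod (volume_preserving_finTwoArrow ℝ))

theorem integral_eq_iterated {G : V → ℝ} (hG : Integrable G) :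
    ∫ v, G v = ∫ s : ℝ, ∫ w : ℝ × ℝ, G !₂[s, w.1, w.2] := by
  have hsplit : ∀ v, G !₂[(splitEquiv v).1, (splitEquiv v).2.1, (splitEquiv v).2.2] = G v := by
    intro v
    congr 1
    ext i
    fin_cases i <;> rfl
  have hintegral := measurePreserving_splitEquiv.integral_comp'
    (fun z : ℝ × ℝ × ℝ => G !₂[z.1, z.2.1, z.2.2])
  have hintegrable := (measurePreserving_splitEquiv.integrable_comp_emb
    splitEquiv.measurableEmbedding (g := fun z : ℝ × ℝ × ℝ => G !₂[z.1, z.2.1, z.2.2])).1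
    (hG.congr (ae_of_all _ fun v => (hsplit v).symm))
  simp only [hsplit] at hintegral
  rw [hintegral]
  exact integral_prod _ hintegrable

theorem P2.integral_slice_eq_zero (hP2 : P2 fL fR) {i : Fin 3} (hi : i ≠ 0) :
    ∀ᵐ s : ℝ, ∫ w : ℝ × ℝ, glue fL fR !₂[s, w.1, w.2] * (!₂[s, w.1, w.2] : V) i = 0 := by
  have hslice : ∀ q : ℝ × ℝ → ℝ,
      (∀ᵐ s : ℝ, 0 < s → ∫ w : ℝ × ℝ, fL !₂[s, w.1, w.2] * q w = 0) →
      (∀ᵐ s : ℝ, s < 0 → ∫ w : ℝ × ℝ, fR !₂[s, w.1, w.2] * q w = 0) →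
      ∀ᵐ s : ℝ, ∫ w : ℝ × ℝ, glue fL fR !₂[s, w.1, w.2] * q w = 0 := by
    intro q hqL hqR
    filter_upwards [hqL, hqR, Measure.ae_ne volume 0] with s hsL hsR hs
    rcases hs.lt_or_gt with h | h
    · simpa only [fun w : ℝ × ℝ => glue_of_neg (hL := fL) (hR := fR) (v := !₂[s, w.1, w.2]) h]
        using hsR h
    · simpa only [fun w : ℝ × ℝ => glue_of_pos (hL := fL) (hR := fR) (v := !₂[s, w.1, w.2]) h]
        using hsL h
  match i, hi with
  | 1, _ => exact hslice (fun w => w.1) hP2.left₂ hP2.right₂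
  | 2, _ => exact hslice (fun w => w.2) hP2.left₃ hP2.right₃

theorem P2.integral_mul_apply_eq_zero (hP2 : P2 fL fR) (hfinite : HasFiniteEnergy (glue fL fR))
    {φ : ℝ → ℝ} (hφ : Measurable φ) (hφ1 : ∀ s, |φ s| ≤ 1) {i : Fin 3} (hi : i ≠ 0) :
    ∫ v : V, φ (v 0) * (glue fL fR v * v i) = 0 := by
  have hintegrable : Integrable fun v : V => φ (v 0) * (glue fL fR v * v i) :=
    (hfinite.integrable_mul_apply i).bdd_mul (c := 1)
      (Measurable.aestronglyMeasurable (f := fun v : V => φ (v 0)) (by fun_prop))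
      (ae_of_all _ fun v => hφ1 _)
  rw [integral_eq_iterated hintegrable]
  refine integral_eq_zero_of_ae ((hP2.integral_slice_eq_zero hi).mono fun s hs => ?_)
  change ∫ w : ℝ × ℝ, φ s * (glue fL fR !₂[s, w.1, w.2] * (!₂[s, w.1, w.2] : V) i) = 0
  rw [integral_const_mul, hs, mul_zero]

end Slices

section Quotients

theorem div_le_of_le_mul_of_le {y ρ R Z : ℝ} (hy : 0 ≤ y) (hρ : 0 < ρ) (hR : ρ ≤ R)
    (h : y ≤ ρ * Z) : y / R ≤ Z :=
  (div_le_div_of_nonneg_left hy hρ hR).trans ((div_le_iff₀' hρ).2 h)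

theorem le_div_of_mul_le_of_le {y ρ a Z : ℝ} (hy : 0 ≤ y) (ha : 0 < a) (haρ : a ≤ ρ)
    (h : ρ * Z ≤ y) : Z ≤ y / a :=
  ((le_div_iff₀' (ha.trans_le haρ)).2 h).trans (div_le_div_of_nonneg_left hy ha haρ)

end Quotients

section ThermalEnergy

variable {f : V → ℝ} {κ : V} {ν : ℝ}

theorem ellipsoidalGaussian_nonneg (hf0 : ∀ᵐ v, 0 ≤ f v) (ν : ℝ) (v : V) :
    0 ≤ ellipsoidalGaussian ν f v :=
  mul_nonneg (div_nonneg (integral_nonneg_of_ae hf0) (Real.sqrt_nonneg _)) (Real.exp_pos _).le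

theorem HasFiniteEnergy.density_le (hf : HasFiniteEnergy f) : density f ≤ energyNorm f := by
  simpa [density] using
    (le_abs_self _).trans (hf.abs_integral_mul_le (q := fun _ => 1) fun v => by simp)

theorem HasFiniteEnergy.integral_mul_norm_sq_le (hf : HasFiniteEnergy f) :
    ∫ v, f v * ‖v‖ ^ 2 ≤ energyNorm f :=
  (le_abs_self _).trans (hf.abs_integral_mul_le fun v => by simp)

theorem thermalEnergyAlong_nonneg (hf0 : ∀ᵐ v, 0 ≤ f v) (κ : V) : 0 ≤ thermalEnergyAlong f κ :=
  integral_nonneg_of_ae (hf0.mono fun _ hv => mul_nonneg hv (sq_nonneg _))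

theorem HasFiniteEnergy.thermalEnergyAlong_le (hf : HasFiniteEnergy f) (hf0 : ∀ᵐ v, 0 ≤ f v)
    (hκ : ‖κ‖ = 1) : thermalEnergyAlong f κ ≤ thermalEnergy f :=
  integral_mono_ae (hf.integrable_mul_inner_sub_sq _ κ) (hf.integrable_mul_norm_sub_sq _) <|
    hf0.mono fun _ hv => mul_le_mul_of_nonneg_left (inner_sq_le_norm_sq hκ _) hv

theorem HasFiniteEnergy.thermalEnergy_le_integral_mul_norm_sq (hf : HasFiniteEnergy f)
    (hρ : 0 < density f) : thermalEnergy f ≤ ∫ v, f v * ‖v‖ ^ 2 := by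
  rw [hf.thermalEnergy_eq hρ.ne']
  exact sub_le_self _ (mul_nonneg hρ.le (sq_nonneg _))

theorem HasFiniteEnergy.thermalEnergy_le (hf : HasFiniteEnergy f) (hρ : 0 < density f) :
    thermalEnergy f ≤ energyNorm f :=
  (hf.thermalEnergy_le_integral_mul_norm_sq hρ).trans hf.integral_mul_norm_sq_le

theorem HasFiniteEnergy.thermalEnergy_sub_thermalEnergyAlong (hf : HasFiniteEnergy f)
    (hρ : density f ≠ 0) (κ : V) :
    thermalEnergy f - thermalEnergyAlong f κ = transverseEnergy f κ -
      density f * (‖bulkVelocity f‖ ^ 2 - inner ℝ (bulkVelocity f) κ ^ 2) := by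
  simp only [hf.thermalEnergy_eq hρ, hf.thermalEnergyAlong_eq hρ, transverseEnergy, mul_sub]
  rw [integral_sub hf.integrable_mul_norm_sq (hf.integrable_mul_inner_sq κ)]
  ring

theorem exists_unit_inner_sq_eq_norm_sq (w : V) : ∃ κ : V, ‖κ‖ = 1 ∧ inner ℝ w κ ^ 2 = ‖w‖ ^ 2 := by
  rcases eq_or_ne w 0 with rfl | hw
  · exact ⟨EuclideanSpace.single 0 1, by simp, by simp⟩
  · have hnorm : ‖w‖ ≠ 0 := norm_ne_zero_iff.2 hw
    refine ⟨‖w‖⁻¹ • w, by simp [norm_smul, hnorm], ?_⟩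
    rw [real_inner_smul_right, real_inner_self_eq_norm_sq]
    field_simp

theorem HasFiniteEnergy.exists_transverseEnergy_le_thermalEnergy (hf : HasFiniteEnergy f)
    (hf0 : ∀ᵐ v, 0 ≤ f v) (hρ : density f ≠ 0) :
    ∃ κ : V, ‖κ‖ = 1 ∧ transverseEnergy f κ ≤ thermalEnergy f := by
  obtain ⟨κ, hκ, hparallel⟩ := exists_unit_inner_sq_eq_norm_sq (bulkVelocity f)
  have hdiff := hf.thermalEnergy_sub_thermalEnergyAlong hρ κ
  rw [hparallel, sub_self, mul_zero, sub_zero] at hdiff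
  exact ⟨κ, hκ, by linarith [thermalEnergyAlong_nonneg hf0 κ]⟩

theorem HasFiniteEnergy.min_mul_thermalEnergy_le (hf : HasFiniteEnergy f) (hf0 : ∀ᵐ v, 0 ≤ f v)
    (hρ : 0 < density f) (ν : ℝ) (hκ : ‖κ‖ = 1) :
    min (1 - ν) (1 + 2 * ν) / 3 * thermalEnergy f ≤
      density f * quadForm (temperatureTensor ν f) κ := by
  rw [hf.density_mul_quadForm hρ.ne', hκ]
  have hnonneg := thermalEnergyAlong_nonneg hf0 κ
  have hle := hf.thermalEnergyAlong_le hf0 hκ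
  rcases le_total (1 - ν) (1 + 2 * ν) with h | h
  · rw [min_eq_left h]
    nlinarith
  · rw [min_eq_right h]
    nlinarith

theorem HasFiniteEnergy.density_mul_quadForm_le (hf : HasFiniteEnergy f) (hf0 : ∀ᵐ v, 0 ≤ f v)
    (hρ : 0 < density f) (ν : ℝ) (hκ : ‖κ‖ = 1) :
    density f * quadForm (temperatureTensor ν f) κ ≤
      max (1 - ν) (1 + 2 * ν) / 3 * thermalEnergy f := by
  rw [hf.density_mul_quadForm hρ.ne', hκ]
  have hnonneg := thermalEnergyAlong_nonneg hf0 κ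
  have hle := hf.thermalEnergyAlong_le hf0 hκ
  rcases le_total (1 - ν) (1 + 2 * ν) with h | h
  · rw [max_eq_right h]
    nlinarith
  · rw [max_eq_left h]
    nlinarith

theorem HasFiniteEnergy.density_mul_quadForm_critical (hf : HasFiniteEnergy f)
    (hρ : density f ≠ 0) (hκ : ‖κ‖ = 1) :
    density f * quadForm (temperatureTensor (-1 / 2) f) κ =
      1 / 2 * (thermalEnergy f - thermalEnergyAlong f κ) := by
  rw [hf.density_mul_quadForm hρ, hκ]
  ring

theorem HasFiniteEnergy.isAdmissible_moments (hf : HasFiniteEnergy f) {r B c : ℝ} (hr : 0 < r)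
    (hdensity : r ≤ density f) (henergy : energyNorm f ≤ B)
    (htensor : ∀ κ : V, ‖κ‖ = 1 → c ≤ quadForm (temperatureTensor ν f) κ) :
    (moments f).IsAdmissible ν r B c := by
  refine ⟨hdensity, hf.norm_moments_le.trans henergy, fun κ => ?_, fun i j => ?_⟩
  · rw [← hf.temperatureTensor_eq (hr.trans_le hdensity).ne']
    rcases eq_or_ne κ 0 with rfl | hκ
    · simp [quadForm]
    have hnorm : ‖κ‖ ≠ 0 := norm_ne_zero_iff.2 hκ
    have hunit := htensor (‖κ‖⁻¹ • κ) (by simp [norm_smul, hnorm])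
    rw [quadForm_smul] at hunit
    calc c * ‖κ‖ ^ 2 ≤ ‖κ‖⁻¹ ^ 2 * quadForm (temperatureTensor ν f) κ * ‖κ‖ ^ 2 := by gcongr
      _ = quadForm (temperatureTensor ν f) κ := by field_simp
  · simp only [moments, mul_comm]

end ThermalEnergy

section NormalFlux

variable {f : V → ℝ}

theorem sq_integral_mul_le {q : V → ℝ} (hf0 : ∀ᵐ v, 0 ≤ f v) (hf : Integrable f)
    (hfq : Integrable fun v => f v * q v) (hfq2 : Integrable fun v => f v * q v ^ 2) :
    (∫ v, f v * q v) ^ 2 ≤ (∫ v, f v) * ∫ v, f v * q v ^ 2 := by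
  have hquadratic : ∀ t : ℝ, 0 ≤ (∫ v, f v) * (t * t) + (-2 * ∫ v, f v * q v) * t +
      ∫ v, f v * q v ^ 2 := fun t => by
    have hsquare : 0 ≤ ∫ v, f v * (q v - t) ^ 2 :=
      integral_nonneg_of_ae (hf0.mono fun v hv => mul_nonneg hv (sq_nonneg _))
    have hexpand : ∀ v, f v * (q v - t) ^ 2 =
        f v * q v ^ 2 - 2 * t * (f v * q v) + t * t * f v := fun v => by ring
    simp only [hexpand] at hsquare
    have hdiff : Integrable fun v => f v * q v ^ 2 - 2 * t * (f v * q v) :=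
      hfq2.sub (hfq.const_mul _)
    rw [integral_add hdiff (hf.const_mul _), integral_sub hfq2 (hfq.const_mul _),
      integral_const_mul, integral_const_mul] at hsquare
    linarith
  have hdiscrim := discrim_le_zero hquadratic
  rw [discrim] at hdiscrim
  linarith

theorem HasFiniteEnergy.four_mul_flux_mul_flux_le (hf : HasFiniteEnergy f)
    (hf0 : ∀ᵐ v, 0 ≤ f v) (hρ : density f ≠ 0) :
    4 * ((∫ v in {v : V | 0 < v 0}, f v * |v 0|) * ∫ v in {v : V | v 0 < 0}, f v * |v 0|) ≤
      density f * thermalEnergyAlong f (EuclideanSpace.single 0 1) := by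
  have hinner : ∀ v : V, inner ℝ v (EuclideanSpace.single 0 1 : V) = v 0 := fun v => by
    simp [EuclideanSpace.inner_single_right]
  have hflux := hf.integrable_mul_abs_apply 0
  have hsquare : Integrable fun v => f v * |v 0| ^ 2 := by
    simpa only [sq, abs_mul_abs_self] using hf.integrable_mul_apply_mul 0 0
  have hcauchy := sq_integral_mul_le hf0 hf.integrable hflux hsquare
  simp only [sq_abs] at hcauchy
  have hnet : ∫ v, f v * v 0 = (∫ v in {v : V | 0 < v 0}, f v * |v 0|) -
      ∫ v in {v : V | v 0 < 0}, f v * |v 0| := by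
    rw [integral_eq_add_setIntegral (hf.integrable_mul_apply 0), sub_eq_add_neg, ← integral_neg]
    congr 1
    · exact setIntegral_congr_fun measurableSet_pos fun v (hv : 0 < v 0) => by
        simp only [abs_of_pos hv]
    · exact setIntegral_congr_fun measurableSet_neg fun v (hv : v 0 < 0) => by
        simp only [abs_of_neg hv, mul_neg, neg_neg]
  have hbulk := hf.integral_mul_apply hρ 0
  rw [integral_eq_add_setIntegral hflux, ← density.eq_1] at hcauchy
  rw [hf.thermalEnergyAlong_eq hρ]
  simp only [hinner]
  rw [hnet] at hbulk
  linear_combination hcauchy - (bulkVelocity f 0 * density f +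
    ((∫ v in {v : V | 0 < v 0}, f v * |v 0|) - ∫ v in {v : V | v 0 < 0}, f v * |v 0|)) * hbulk

end NormalFlux

section AboveData

variable {fL fR f : V → ℝ} {δ ν C : ℝ} {κ : V}

/-- `f` has finite energy and dominates the fraction `δ` of the inflow data `f_{LR}` that crosses
the slab without a collision. -/
structure AboveData (δ : ℝ) (fL fR f : V → ℝ) : Prop where
  weight_nonneg : 0 ≤ δ
  data : P1 fL fR
  finite : HasFiniteEnergy f
  ge : ∀ᵐ v, δ * damped (glue fL fR) v ≤ f v

namespace AboveData

theorem nonneg (h : AboveData δ fL fR f) : ∀ᵐ v, 0 ≤ f v := by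
  filter_upwards [h.ge, h.data.damped_nonneg] with v hge hdata
  exact (mul_nonneg h.weight_nonneg hdata).trans hge

theorem setIntegral_ge (h : AboveData δ fL fR f) (S : Set V) {q : V → ℝ} (hq : ∀ v, 0 ≤ q v)
    (hdata : Integrable fun v => damped (glue fL fR) v * q v)
    (hf : Integrable fun v => f v * q v) :
    δ * ∫ v in S, damped (glue fL fR) v * q v ≤ ∫ v in S, f v * q v := by
  rw [← integral_const_mul]
  refine integral_mono_ae (hdata.integrableOn.const_mul δ) hf.integrableOn
    (ae_restrict_of_ae (h.ge.mono fun v hv => ?_))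
  simp only [← mul_assoc]
  exact mul_le_mul_of_nonneg_right hv (hq v)

theorem density_ge (h : AboveData δ fL fR f) : δ * aEll fL fR ≤ density f := by
  have hmono := h.setIntegral_ge univ (q := fun _ => 1) (fun _ => zero_le_one)
    (h.data.hasFiniteEnergy.damped.integrable.mul_const 1) (h.finite.integrable.mul_const 1)
  simpa only [setIntegral_univ, mul_one, aEll, damped, density] using hmono

theorem density_pos (h : AboveData δ fL fR f) (hδ : 0 < δ) : 0 < density f :=
  lt_of_lt_of_le (mul_pos hδ (aEll_pos h.data)) h.density_ge

theorem transverseEnergy_ge (h : AboveData δ fL fR f) (hκ : ‖κ‖ = 1) :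
    δ * aCrit fL fR ≤ transverseEnergy f κ := by
  have hmono := h.setIntegral_ge univ (q := fun v => ‖v‖ ^ 2 - inner ℝ v κ ^ 2)
    (fun v => sub_nonneg.2 (inner_sq_le_norm_sq hκ v))
    (h.data.hasFiniteEnergy.damped.integrable_mul_transverse κ)
    (h.finite.integrable_mul_transverse κ)
  rw [setIntegral_univ, setIntegral_univ] at hmono
  exact (mul_le_mul_of_nonneg_left (aCrit_le h.data hκ) h.weight_nonneg).trans hmono

theorem thermalEnergy_ge (h : AboveData δ fL fR f) (hδ : 0 < δ) :
    δ * aCrit fL fR ≤ thermalEnergy f := by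
  obtain ⟨κ, hκ, hle⟩ :=
    h.finite.exists_transverseEnergy_le_thermalEnergy h.nonneg (h.density_pos hδ).ne'
  exact (h.transverseEnergy_ge hκ).trans hle

theorem density_mul_thermalEnergy_ge (h : AboveData δ fL fR f) (hδ : 0 < δ) :
    4 * δ ^ 2 * gammaEll fL fR ≤ density f * thermalEnergy f := by
  have hdata := h.data.hasFiniteEnergy.damped.integrable_mul_abs_apply 0
  have hflux := h.finite.integrable_mul_abs_apply 0
  have hpos := h.setIntegral_ge {v : V | 0 < v 0} (fun _ => abs_nonneg _) hdata hflux
  have hneg := h.setIntegral_ge {v : V | v 0 < 0} (fun _ => abs_nonneg _) hdata hflux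
  have hnonneg : ∀ S : Set V, 0 ≤ δ * ∫ v in S, damped (glue fL fR) v * |v 0| := fun S =>
    mul_nonneg hδ.le <| integral_nonneg_of_ae <|
      ae_restrict_of_ae (h.data.damped_nonneg.mono fun v hv => mul_nonneg hv (abs_nonneg _))
  have hρ := h.density_pos hδ
  calc 4 * δ ^ 2 * gammaEll fL fR
      = 4 * ((δ * ∫ v in {v : V | 0 < v 0}, damped (glue fL fR) v * |v 0|) *
          (δ * ∫ v in {v : V | v 0 < 0}, damped (glue fL fR) v * |v 0|)) := by
        rw [gammaEll_eq]
        ring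
    _ ≤ 4 * ((∫ v in {v : V | 0 < v 0}, f v * |v 0|) * ∫ v in {v : V | v 0 < 0}, f v * |v 0|) := by
        gcongr
        exacts [hnonneg _, (hnonneg _).trans hpos]
    _ ≤ density f * thermalEnergyAlong f (EuclideanSpace.single 0 1) :=
        h.finite.four_mul_flux_mul_flux_le h.nonneg hρ.ne'
    _ ≤ density f * thermalEnergy f :=
        mul_le_mul_of_nonneg_left (h.finite.thermalEnergyAlong_le h.nonneg (by simp)) hρ.le

theorem le_quadForm_of_aCrit (h : AboveData δ fL fR f) (hδ : 1 / 2 ≤ δ) (hν : -1 / 2 < ν)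
    (hν1 : ν < 1) (hE : energyNorm f ≤ 2 * C) (hκ : ‖κ‖ = 1) :
    min (1 - ν) (1 + 2 * ν) * aCrit fL fR / (12 * C) ≤ quadForm (temperatureTensor ν f) κ := by
  have hmin : 0 < min (1 - ν) (1 + 2 * ν) := lt_min (by linarith) (by linarith)
  have hcrit := aCrit_pos h.data
  have hρ := h.density_pos (by linarith)
  have hthermal : aCrit fL fR / 2 ≤ thermalEnergy f := by
    linarith [h.thermalEnergy_ge (by linarith), mul_le_mul_of_nonneg_right hδ hcrit.le]
  have hlower : min (1 - ν) (1 + 2 * ν) / 3 * (aCrit fL fR / 2) ≤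
      density f * quadForm (temperatureTensor ν f) κ :=
    (by gcongr : _ ≤ min (1 - ν) (1 + 2 * ν) / 3 * thermalEnergy f).trans
      (h.finite.min_mul_thermalEnergy_le h.nonneg hρ ν hκ)
  convert div_le_of_le_mul_of_le (by positivity) hρ (h.finite.density_le.trans hE) hlower using 1
  ring

theorem le_quadForm_of_gammaEll (h : AboveData δ fL fR f) (hδ : 0 < δ) (hν : -1 / 2 < ν)
    (hν1 : ν < 1) (hE : energyNorm f ≤ 2 * C) (hκ : ‖κ‖ = 1) :
    min (1 - ν) (1 + 2 * ν) * δ ^ 2 * (gammaEll fL fR / (3 * C ^ 2)) ≤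
      quadForm (temperatureTensor ν f) κ := by
  have hmin : 0 < min (1 - ν) (1 + 2 * ν) := lt_min (by linarith) (by linarith)
  have hγ := gammaEll_nonneg h.data
  have hρ := h.density_pos hδ
  have hρC := h.finite.density_le.trans hE
  have hC : 0 < 2 * C := hρ.trans_le hρC
  have hthermal : 4 * δ ^ 2 * gammaEll fL fR / (2 * C) ≤ thermalEnergy f :=
    div_le_of_le_mul_of_le (by positivity) hρ hρC (h.density_mul_thermalEnergy_ge hδ)
  have hlower : min (1 - ν) (1 + 2 * ν) / 3 * (4 * δ ^ 2 * gammaEll fL fR / (2 * C)) ≤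
      density f * quadForm (temperatureTensor ν f) κ :=
    (by gcongr : _ ≤ min (1 - ν) (1 + 2 * ν) / 3 * thermalEnergy f).trans
      (h.finite.min_mul_thermalEnergy_le h.nonneg hρ ν hκ)
  convert div_le_of_le_mul_of_le (by positivity) hρ hρC hlower using 1
  field_simp
  ring

theorem quadForm_le (h : AboveData δ fL fR f) (hδ : 0 < δ) (hν1 : ν < 1)
    (hE : energyNorm f ≤ 2 * C) (hκ : ‖κ‖ = 1) :
    quadForm (temperatureTensor ν f) κ ≤
      2 / (3 * aEll fL fR * δ) * max (1 - ν) (1 + 2 * ν) * C := by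
  have hmax : 0 < max (1 - ν) (1 + 2 * ν) := lt_max_of_lt_left (by linarith)
  have ha := aEll_pos h.data
  have hρ := h.density_pos hδ
  have hC : 0 < 2 * C := hρ.trans_le (h.finite.density_le.trans hE)
  have hupper : density f * quadForm (temperatureTensor ν f) κ ≤
      max (1 - ν) (1 + 2 * ν) / 3 * (2 * C) :=
    (h.finite.density_mul_quadForm_le h.nonneg hρ ν hκ).trans
      (mul_le_mul_of_nonneg_left ((h.finite.thermalEnergy_le hρ).trans hE) (by positivity))
  convert le_div_of_mul_le_of_le (by positivity) (mul_pos hδ ha) h.density_ge hupper using 1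
  field_simp

end AboveData

end AboveData

section CriticalTensor

variable {fL fR f : V → ℝ} {δ C s : ℝ} {κ : V}

theorem HasFiniteEnergy.density_mul_norm_bulkVelocity_sq_le (hf : HasFiniteEnergy f)
    (hρ : 0 < density f) (hs : ∀ i, |∫ v, f v * v i| ≤ s) :
    density f * ‖bulkVelocity f‖ ^ 2 ≤ 3 * s ^ 2 / density f := by
  have hmomentum : density f * ‖bulkVelocity f‖ ^ 2 * density f = ∑ i, (∫ v, f v * v i) ^ 2 := by
    simp only [EuclideanSpace.norm_sq_eq, hf.bulkVelocity_apply, Real.norm_eq_abs, sq_abs,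
      Fin.sum_univ_three]
    field_simp
  rw [le_div_iff₀ hρ, hmomentum]
  calc ∑ i, (∫ v, f v * v i) ^ 2 ≤ ∑ _i : Fin 3, s ^ 2 :=
        Finset.sum_le_sum fun i _ => sq_le_sq' (abs_le.1 (hs i)).1 (abs_le.1 (hs i)).2
    _ = 3 * s ^ 2 := by simp

theorem AboveData.density_ge_half (h : AboveData δ fL fR f) (hδ : 1 / 2 ≤ δ) :
    aEll fL fR / 2 ≤ density f := by
  linarith [h.density_ge, mul_le_mul_of_nonneg_right hδ (aEll_pos h.data).le]

theorem AboveData.le_quadForm_critical (h : AboveData δ fL fR f) (hδ : 1 / 2 ≤ δ)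
    (hE : energyNorm f ≤ C / 2) (hs : ∀ i, |∫ v, f v * v i| ≤ s)
    (hsmall : 24 * s ^ 2 ≤ aEll fL fR * aCrit fL fR) (hκ : ‖κ‖ = 1) :
    δ * (aCrit fL fR / (2 * C)) ≤ quadForm (temperatureTensor (-1 / 2) f) κ := by
  have hρ := h.density_pos (by linarith)
  have hcrit := aCrit_pos h.data
  have hkinetic : 3 * s ^ 2 / density f ≤ aCrit fL fR / 4 := by
    rw [div_le_iff₀ hρ]
    nlinarith [h.density_ge_half hδ]
  have hlower : δ * aCrit fL fR / 4 ≤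
      density f * quadForm (temperatureTensor (-1 / 2) f) κ := by
    rw [h.finite.density_mul_quadForm_critical hρ.ne' hκ,
      h.finite.thermalEnergy_sub_thermalEnergyAlong hρ.ne']
    nlinarith [h.transverseEnergy_ge hκ, h.finite.density_mul_norm_bulkVelocity_sq_le hρ hs,
      mul_nonneg hρ.le (sq_nonneg (inner ℝ (bulkVelocity f) κ))]
  convert div_le_of_le_mul_of_le (by positivity) hρ (h.finite.density_le.trans hE) hlower using 1
  ring

theorem AboveData.quadForm_critical_le (h : AboveData δ fL fR f) (hδ : 1 / 2 ≤ δ)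
    (hE : energyNorm f ≤ C / 2) (hκ : ‖κ‖ = 1) :
    quadForm (temperatureTensor (-1 / 2) f) κ ≤ 3 / (2 * aEll fL fR) * C := by
  have ha := aEll_pos h.data
  have hρ := h.density_pos (by linarith)
  have hC : 0 < C / 2 := hρ.trans_le (h.finite.density_le.trans hE)
  have hupper : density f * quadForm (temperatureTensor (-1 / 2) f) κ ≤ 3 * C / 4 := by
    rw [h.finite.density_mul_quadForm_critical hρ.ne' hκ]
    linarith [thermalEnergyAlong_nonneg h.nonneg κ, h.finite.thermalEnergy_le hρ]
  convert le_div_of_mul_le_of_le (by linarith) (half_pos ha) (h.density_ge_half hδ) hupper using 1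
  field_simp
  ring

end CriticalTensor

section NearFreeTransport

variable {fL fR f k p : V → ℝ} {η δ τ x : ℝ} {v : V}

theorem NearAbove.abs_momentum_le (h : NearAbove η k f) (hk : HasFiniteEnergy k) (i : Fin 3) :
    |∫ v, f v * v i| ≤ |∫ v, k v * v i| + η := by
  have hexcess := h.finite.sub hk
  have hsplit : ∫ v, f v * v i = (∫ v, k v * v i) + ∫ v, (f v - k v) * v i := by
    rw [← integral_add (hk.integrable_mul_apply i) (hexcess.integrable_mul_apply i)]
    simp only [sub_mul, add_sub_cancel]
  rw [hsplit]
  exact (abs_add_le _ _).trans (add_le_add le_rfl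
    ((hexcess.abs_integral_mul_le fun v => abs_apply_le v i).trans h.excess_le))

theorem exp_inv_le_attenuation (hτ : 1 ≤ τ) (hx : x ∈ Icc (0 : ℝ) 1) (v : V) :
    Real.exp (-(1 / |v 0|)) ≤ attenuation τ x v := by
  refine le_trans (Real.exp_le_exp.2 (neg_le_neg ?_)) (exp_le_attenuation (by linarith) hx v)
  rcases eq_or_ne (v 0) 0 with h | h
  · simp [h]
  · have hpos := abs_pos.2 h
    exact one_div_le_one_div_of_le hpos (le_mul_of_one_le_left hpos.le hτ)

theorem NearAbove.aboveData (h : NearAbove η (freeTransport δ τ (glue fL fR) x) f)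
    (hP : P1 fL fR) (hδ : 0 ≤ δ) (hτ : 1 ≤ τ) (hx : x ∈ Icc (0 : ℝ) 1) :
    AboveData δ fL fR f := by
  refine ⟨hδ, hP, h.finite, ?_⟩
  filter_upwards [h.ge, hP.nonneg] with v hge hdata
  exact (mul_le_mul_of_nonneg_left (mul_le_mul_of_nonneg_right
    (exp_inv_le_attenuation hτ hx v) hdata) hδ).trans hge

theorem P2.integral_freeTransport_mul_apply_eq_zero (hP2 : P2 fL fR) (hP : P1 fL fR)
    (hτ : 0 ≤ τ) (hx : x ∈ Icc (0 : ℝ) 1) {i : Fin 3} (hi : i ≠ 0) :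
    ∫ v, freeTransport δ τ (glue fL fR) x v * v i = 0 := by
  set φ : ℝ → ℝ := fun s => Real.exp (-((if 0 < s then x else 1 - x) / (τ * |s|)))
  have hφ : Measurable φ := Real.measurable_exp.comp
    (((Measurable.ite (measurableSet_lt (by fun_prop) (by fun_prop)) measurable_const
      measurable_const).div (by fun_prop)).neg)
  have hφ1 : ∀ s, |φ s| ≤ 1 := fun s => by
    have hdepth : 0 ≤ if 0 < s then x else 1 - x := by
      split_ifs
      exacts [hx.1, by linarith [hx.2]]
    rw [abs_of_pos (Real.exp_pos _)]
    exact Real.exp_le_one_iff.2 (neg_nonpos.2 (by positivity))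
  have hfree : ∀ v : V, freeTransport δ τ (glue fL fR) x v * v i =
      δ * (φ (v 0) * (glue fL fR v * v i)) := fun v => by
    simp only [freeTransport, attenuation, depth, φ, mul_assoc]
  simp only [hfree, integral_const_mul,
    hP2.integral_mul_apply_eq_zero hP.hasFiniteEnergy hφ hφ1 hi, mul_zero]

theorem NearAbove.abs_transverse_momentum_le
    (h : NearAbove η (freeTransport δ τ (glue fL fR) x) f) (hP : P1 fL fR) (hP2 : P2 fL fR)
    (hτ : 0 ≤ τ) (hx : x ∈ Icc (0 : ℝ) 1) {i : Fin 3} (hi : i ≠ 0) :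
    |∫ v, f v * v i| ≤ η := by
  simpa [hP2.integral_freeTransport_mul_apply_eq_zero hP hτ hx hi] using
    h.abs_momentum_le (hP.hasFiniteEnergy.freeTransport hτ hx) i

theorem P1.fluxDiscrepancy_eq (hP : P1 fL fR) :
    fluxDiscrepancy fL fR = |∫ v, glue fL fR v * v 0| := by
  rw [fluxDiscrepancy, integral_eq_add_setIntegral (hP.hasFiniteEnergy.integrable_mul_apply 0),
    sub_eq_add_neg, ← integral_neg]
  congr 2
  · exact setIntegral_congr_fun measurableSet_pos fun v (hv : 0 < v 0) => by
      simp only [glue_of_pos hv, abs_of_pos hv]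
  · exact setIntegral_congr_fun measurableSet_neg fun v (hv : v 0 < 0) => by
      simp only [glue_of_neg hv, abs_of_neg hv, mul_neg, neg_neg]

theorem one_sub_attenuation_mul_le (hτ : 0 < τ) (hx : x ∈ Icc (0 : ℝ) 1) (v : V) :
    (1 - attenuation τ x v) * |v 0| ≤ 1 / τ := by
  rcases eq_or_ne (v 0) 0 with h | h
  · rw [h, abs_zero, mul_zero]
    positivity
  have hpos := abs_pos.2 h
  have hexp := Real.add_one_le_exp (-(depth x v / (τ * |v 0|)))
  have hdepth : depth x v / (τ * |v 0|) ≤ 1 / (τ * |v 0|) :=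
    div_le_div_of_nonneg_right (depth_mem hx v).2 (by positivity)
  rw [attenuation]
  calc (1 - Real.exp (-(depth x v / (τ * |v 0|)))) * |v 0|
      ≤ 1 / (τ * |v 0|) * |v 0| := mul_le_mul_of_nonneg_right (by linarith) hpos.le
    _ = 1 / τ := by field_simp

theorem abs_sub_freeTransport_mul_le (hδ : δ ≤ 1) (hτ : 0 < τ)
    (hx : x ∈ Icc (0 : ℝ) 1) (hp : 0 ≤ p v) :
    |(p v - freeTransport δ τ p x v) * v 0| ≤ (1 - δ + 1 / τ) * (p v * (1 + ‖v‖ ^ 2)) := by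
  have hatt : 0 ≤ (1 - attenuation τ x v) * |v 0| :=
    mul_nonneg (sub_nonneg.2 (attenuation_le_one hτ.le hx v)) (abs_nonneg _)
  have hdelay : δ * ((1 - attenuation τ x v) * |v 0|) ≤ 1 / τ * (1 + ‖v‖ ^ 2) :=
    ((mul_le_of_le_one_left hatt hδ).trans (one_sub_attenuation_mul_le hτ hx v)).trans
      (le_mul_of_one_le_right (by positivity) (by nlinarith [sq_nonneg ‖v‖]))
  have hloss : (1 - δ) * |v 0| ≤ (1 - δ) * (1 + ‖v‖ ^ 2) :=
    mul_le_mul_of_nonneg_left (abs_apply_le v 0) (by linarith)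
  rw [abs_mul, abs_of_nonneg (sub_nonneg.2 (freeTransport_le hτ.le hx hδ hp))]
  calc (p v - freeTransport δ τ p x v) * |v 0|
      = p v * ((1 - δ) * |v 0| + δ * ((1 - attenuation τ x v) * |v 0|)) := by
        rw [freeTransport]
        ring
    _ ≤ p v * ((1 - δ) * (1 + ‖v‖ ^ 2) + 1 / τ * (1 + ‖v‖ ^ 2)) := by gcongr
    _ = (1 - δ + 1 / τ) * (p v * (1 + ‖v‖ ^ 2)) := by ring

theorem P1.abs_integral_freeTransport_mul_le (hP : P1 fL fR) (hδ : δ ≤ 1) (hτ : 0 < τ)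
    (hx : x ∈ Icc (0 : ℝ) 1) :
    |∫ v, freeTransport δ τ (glue fL fR) x v * v 0| ≤
      fluxDiscrepancy fL fR + (1 - δ + 1 / τ) * energyNorm (glue fL fR) := by
  have hdata := hP.hasFiniteEnergy.integrable_mul_apply 0
  have hfree := (hP.hasFiniteEnergy.freeTransport (δ₁ := δ) hτ.le hx).integrable_mul_apply 0
  have hloss : |(∫ v, glue fL fR v * v 0) - ∫ v, freeTransport δ τ (glue fL fR) x v * v 0| ≤
      (1 - δ + 1 / τ) * energyNorm (glue fL fR) := by
    rw [← integral_sub hdata hfree, energyNorm_of_nonneg hP.nonneg, ← integral_const_mul,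
      ← Real.norm_eq_abs]
    refine norm_integral_le_of_norm_le (hP.finite.const_mul _) (hP.nonneg.mono fun v hv => ?_)
    rw [Real.norm_eq_abs, ← sub_mul]
    exact abs_sub_freeTransport_mul_le hδ hτ hx hv
  rw [hP.fluxDiscrepancy_eq]
  linarith [abs_sub_abs_le_abs_sub (∫ v, freeTransport δ τ (glue fL fR) x v * v 0)
    (∫ v, glue fL fR v * v 0), abs_sub_comm (∫ v, glue fL fR v * v 0)
    (∫ v, freeTransport δ τ (glue fL fR) x v * v 0)]

theorem NearAbove.abs_normal_momentum_le
    (h : NearAbove η (freeTransport δ τ (glue fL fR) x) f) (hP : P1 fL fR) (hδ : δ ≤ 1)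
    (hτ : 0 < τ) (hx : x ∈ Icc (0 : ℝ) 1) :
    |∫ v, f v * v 0| ≤
      fluxDiscrepancy fL fR + (1 - δ + 1 / τ) * energyNorm (glue fL fR) + η :=
  (h.abs_momentum_le (hP.hasFiniteEnergy.freeTransport hτ.le hx) 0).trans
    (add_le_add (hP.abs_integral_freeTransport_mul_le hδ hτ hx) le_rfl)

end NearFreeTransport

section DensityGain

variable {fL fR f : V → ℝ} {η δ τ x C : ℝ} {v : V}

theorem exp_mul_one_add_le_attenuation (hτ : 2 ≤ τ) (hx : x ∈ Icc (0 : ℝ) 1) (hv : v 0 ≠ 0) :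
    Real.exp (-(1 / |v 0|)) * (1 + 1 / |v 0| / 2) ≤ attenuation τ x v := by
  have hslow : 1 / (τ * |v 0|) ≤ 1 / |v 0| / 2 := by
    rw [div_div, mul_comm |v 0|]
    gcongr
  calc Real.exp (-(1 / |v 0|)) * (1 + 1 / |v 0| / 2)
      ≤ Real.exp (-(1 / |v 0|)) * Real.exp (1 / |v 0| / 2) := by
        gcongr
        linarith [Real.add_one_le_exp (1 / |v 0| / 2)]
    _ = Real.exp (-(1 / |v 0| / 2)) := by
        rw [← Real.exp_add]
        ring_nf
    _ ≤ Real.exp (-(1 / (τ * |v 0|))) := Real.exp_le_exp.2 (neg_le_neg hslow)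
    _ ≤ attenuation τ x v := exp_le_attenuation (by linarith) hx v

theorem one_add_mul_exp_sub_le_attenuation (hτ : 2 ≤ τ) (hx : x ∈ Icc (0 : ℝ) 1) (hv : v 0 ≠ 0)
    (l : ℝ) : (1 + l) * Real.exp (-(1 / |v 0|)) - l ^ 2 / 2 * (1 + ‖v‖ ^ 2) ≤
      attenuation τ x v := by
  have hyoung : 2 * l ≤ l ^ 2 * |v 0| + 1 / |v 0| := by
    have hsquare : l ^ 2 * |v 0| + 1 / |v 0| - 2 * l = (l * |v 0| - 1) ^ 2 / |v 0| := by
      field_simp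
      ring
    have hnonneg : 0 ≤ (l * |v 0| - 1) ^ 2 / |v 0| := by positivity
    linarith
  have hexp : Real.exp (-(1 / |v 0|)) ≤ 1 :=
    Real.exp_le_one_iff.2 (neg_nonpos.2 (by positivity))
  have hremainder : Real.exp (-(1 / |v 0|)) * (l ^ 2 / 2 * |v 0|) ≤
      1 * (l ^ 2 / 2 * (1 + ‖v‖ ^ 2)) := by
    gcongr
    exact abs_apply_le v 0
  nlinarith [exp_mul_one_add_le_attenuation hτ hx hv, Real.exp_pos (-(1 / |v 0|))]

theorem P1.one_add_mul_aEll_sub_le (hP : P1 fL fR) (hτ : 2 ≤ τ) (hx : x ∈ Icc (0 : ℝ) 1)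
    (l : ℝ) : (1 + l) * aEll fL fR - l ^ 2 / 2 * energyNorm (glue fL fR) ≤
      ∫ v, freeTransport 1 τ (glue fL fR) x v := by
  have hdamped := hP.hasFiniteEnergy.damped.integrable.const_mul (1 + l)
  have henergy := hP.finite.const_mul (l ^ 2 / 2)
  rw [energyNorm_of_nonneg hP.nonneg, ← integral_const_mul,
    show aEll fL fR = ∫ v, damped (glue fL fR) v from rfl, ← integral_const_mul,
    ← integral_sub hdamped henergy]
  refine integral_mono_ae (hdamped.sub henergy)
    (hP.hasFiniteEnergy.freeTransport (by linarith) hx).integrable ?_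
  filter_upwards [hP.nonneg, ae_apply_ne_zero 0] with v hv hv0
  calc (1 + l) * damped (glue fL fR) v - l ^ 2 / 2 * (glue fL fR v * (1 + ‖v‖ ^ 2))
      = ((1 + l) * Real.exp (-(1 / |v 0|)) - l ^ 2 / 2 * (1 + ‖v‖ ^ 2)) * glue fL fR v := by
        rw [damped]
        ring
    _ ≤ attenuation τ x v * glue fL fR v :=
        mul_le_mul_of_nonneg_right (one_add_mul_exp_sub_le_attenuation hτ hx hv0 l) hv
    _ = freeTransport 1 τ (glue fL fR) x v := (one_mul _).symm

-- The gain factor absorbs the loss `δ < 1`, so that the density bound does not deteriorate.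
theorem P1.aEll_mul_one_add_le (hP : P1 fL fR) (hC : 0 < C) (hE : energyNorm (glue fL fR) ≤ C)
    (hτ : 2 ≤ τ) (hx : x ∈ Icc (0 : ℝ) 1) :
    aEll fL fR * (1 + aEll fL fR / (2 * C)) ≤ ∫ v, freeTransport 1 τ (glue fL fR) x v := by
  have hoptimal := hP.one_add_mul_aEll_sub_le hτ hx (aEll fL fR / C)
  have henergy : (aEll fL fR / C) ^ 2 / 2 * energyNorm (glue fL fR) ≤
      (aEll fL fR / C) ^ 2 / 2 * C := by gcongr
  have hvalue : aEll fL fR * (1 + aEll fL fR / (2 * C)) =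
      (1 + aEll fL fR / C) * aEll fL fR - (aEll fL fR / C) ^ 2 / 2 * C := by
    field_simp
    ring
  linarith

theorem NearAbove.aEll_le_density (h : NearAbove η (freeTransport δ τ (glue fL fR) x) f)
    (hP : P1 fL fR) (hC : 0 < C) (hE : energyNorm (glue fL fR) ≤ C) (hτ : 2 ≤ τ)
    (hx : x ∈ Icc (0 : ℝ) 1) (hδ : 1 - aEll fL fR / (2 * C + aEll fL fR) ≤ δ) :
    aEll fL fR ≤ density f := by
  have ha := aEll_pos hP
  have hweight : 1 - aEll fL fR / (2 * C + aEll fL fR) = 2 * C / (2 * C + aEll fL fR) := by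
    field_simp
    ring
  rw [hweight] at hδ
  have hδ₀ : 0 ≤ δ := le_trans (by positivity) hδ
  calc aEll fL fR
      = 2 * C / (2 * C + aEll fL fR) * (aEll fL fR * (1 + aEll fL fR / (2 * C))) := by
        field_simp
    _ ≤ δ * ∫ v, freeTransport 1 τ (glue fL fR) x v := by
        gcongr
        exact hP.aEll_mul_one_add_le hC hE hτ hx
    _ = ∫ v, freeTransport δ τ (glue fL fR) x v := by
        simp only [freeTransport, integral_const_mul, one_mul]
    _ ≤ density f := integral_mono_ae
        (hP.hasFiniteEnergy.freeTransport (by linarith) hx).integrable h.finite.integrable h.ge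

end DensityGain

section MildSolutionBounds

variable {ν τ δ₁ δ₂ δ₃ θ₀ θ₁ B η : ℝ} {fL fR : V → ℝ} {f : ℝ → V → ℝ} {Ω : Set Moments}
  {Ψ : V → ℝ}

theorem IsMildSolution.aboveData (hf : IsMildSolution ν τ δ₁ δ₂ δ₃ θ₀ θ₁ fL fR f)
    (hf0 : Nonneg f) (hP : P1 fL fR) (hθ₀ : 0 < θ₀) (hθ₁ : 0 < θ₁) (hδ₁ : 0 ≤ δ₁) (hδ₂ : 0 ≤ δ₂)
    (hδ₃ : 0 ≤ δ₃) (hτ : 1 ≤ τ) {x : ℝ} (hx : x ∈ Icc (0 : ℝ) 1) : AboveData δ₁ fL fR (f x) := by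
  refine ⟨hδ₁, hP, hf.integrable x hx, ?_⟩
  have hout : ∀ᵐ v, 0 ≤ outgoing f v := hf0.mono fun v hv => hv _ (exitPosition_mem v)
  have hgauss : ∀ y ∈ Icc (0 : ℝ) 1, ∀ v, 0 ≤ ellipsoidalGaussian ν (f y) v := fun y hy v =>
    ellipsoidalGaussian_nonneg (hf0.mono fun _ hv => hv y hy) ν v
  filter_upwards [hf.eq_transport, hP.nonneg,
    reemission_nonneg hδ₂ hδ₃ (glue_wallMaxwellian_nonneg hθ₀ hθ₁) hout]
    with v htransport hdata hre
  have hcollision : 0 ≤ collision τ (fun y v => ellipsoidalGaussian ν (f y) v) x v :=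
    collision_nonneg (by linarith) hx fun y hy => hgauss y hy v
  have hatt := attenuation_pos τ x v
  rw [htransport x hx, transport, inflow]
  calc δ₁ * damped (glue fL fR) v
      ≤ δ₁ * (attenuation τ x v * glue fL fR v) := by
        rw [damped]
        gcongr
        exact exp_inv_le_attenuation hτ hx v
    _ = attenuation τ x v * (δ₁ * glue fL fR v) := by ring
    _ ≤ _ := le_add_of_le_of_nonneg (by gcongr; exact le_add_of_nonneg_right hre) hcollision

/-- Well-posedness of the boundary value problem in the class of nonnegative mild solutions
satisfying `Bounds`. -/
def ExistsUniqueMildSolution (ν τ δ₁ δ₂ δ₃ θ₀ θ₁ : ℝ) (fL fR : V → ℝ)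
    (Bounds : (ℝ → V → ℝ) → Prop) : Prop :=
  ∃ f, (IsMildSolution ν τ δ₁ δ₂ δ₃ θ₀ θ₁ fL fR f ∧ Nonneg f ∧ Bounds f) ∧
    ∀ g, IsMildSolution ν τ δ₁ δ₂ δ₃ θ₀ θ₁ fL fR g → Nonneg g → Bounds g → SameSolution g f

theorem WeakInteraction.existsUniqueMildSolution
    (H : WeakInteraction ν τ δ₁ δ₂ δ₃ (glue fL fR) (glue (wallMaxwellian θ₀) (wallMaxwellian θ₁))
      Ω Ψ B η)
    (hθ₀ : 0 < θ₀) (hθ₁ : 0 < θ₁) (hP : P1 fL fR) (hτ : 1 ≤ τ) {S : (V → ℝ) → Prop}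
    (hbound : ∀ x ∈ Icc (0 : ℝ) 1, ∀ f, NearAbove η (freeTransport δ₁ τ (glue fL fR) x) f → S f)
    (hmem : ∀ f, AboveData δ₁ fL fR f → S f → moments f ∈ Ω) :
    ExistsUniqueMildSolution ν τ δ₁ δ₂ δ₃ θ₀ θ₁ fL fR fun f => ∀ x ∈ Icc (0 : ℝ) 1, S (f x) := by
  have hinv : ∀ x ∈ Icc (0 : ℝ) 1, ∀ f, NearAbove η (freeTransport δ₁ τ (glue fL fR) x) f →
      moments f ∈ Ω := fun x hx f hf =>
    hmem f (hf.aboveData hP H.inflow_nonneg hτ hx) (hbound x hx f hf)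
  obtain ⟨f, hf, hf0, hnear⟩ := H.exists_mild_solution hinv
  refine ⟨f, ⟨hf, hf0, fun x hx => hbound x hx _ (hnear x hx)⟩, fun g hg hg0 hgS =>
    H.mild_solution_unique hg hf (fun x hx => ?_) fun x hx => hinv x hx _ (hnear x hx)⟩
  exact hmem _ (hg.aboveData hg0 hP hθ₀ hθ₁ H.inflow_nonneg H.diffuse_nonneg H.specular_nonneg
    hτ hx) (hgS x hx)

theorem exists_weakInteraction {r c : ℝ} (hr : 0 < r) (hc : 0 < c) {W : V → ℝ}
    (hW0 : ∀ v, 0 ≤ W v) (hW : HasFiniteEnergy W) {D : ℝ} (hD : 0 < D) (hη : 0 < η) :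
    ∃ Ψ : V → ℝ, ∃ ε > 0, ∃ K > 0, ∀ p : V → ℝ, (∀ᵐ v, 0 ≤ p v) → HasFiniteEnergy p →
      energyNorm p + η ≤ D → ∀ τ δ₁ δ₂ δ₃ : ℝ, 0 ≤ δ₁ → 0 ≤ δ₂ → 0 ≤ δ₃ → δ₁ + δ₂ + δ₃ = 1 →
        K < τ → δ₂ + δ₃ < ε →
        WeakInteraction ν τ δ₁ δ₂ δ₃ p W {m | m.IsAdmissible ν r B c} Ψ D η := by
  obtain ⟨Ψ, hΨ0, hΨ, hmem, hlip⟩ :=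
    Moments.exists_gaussian_lipschitz (ν := ν) (B := B) hr hc
  have hw := energyNorm_nonneg W
  have hsmall : 0 < min (1 / 4) (η / 2) := by positivity
  obtain ⟨K, hK⟩ := Filter.eventually_atTop.1
    ((tendsto_integral_absorbed hΨ).eventually (gt_mem_nhds hsmall))
  refine ⟨Ψ, min (1 / 4) (η / (2 * D)) / (1 + energyNorm W), by positivity, max K 1,
    by positivity, fun p hp0 hp htrace τ δ₁ δ₂ δ₃ hδ₁ hδ₂ hδ₃ hsum hτ hδ => ?_⟩
  have hτ0 : 0 < τ := one_pos.trans ((le_max_right _ _).trans_lt hτ)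
  have hcollision : (energyNorm fun v => absorbed τ v * Ψ v) ≤ min (1 / 4) (η / 2) := by
    rw [energyNorm_of_nonneg (ae_of_all _ fun v =>
      mul_nonneg (absorbed_nonneg hτ0.le v) (hΨ0 v))]
    simpa only [mul_assoc] using (hK τ ((le_max_left _ _).trans hτ.le)).le
  have hreemission : δ₂ * energyNorm W + δ₃ ≤ min (1 / 4) (η / (2 * D)) := by
    rw [lt_div_iff₀ (by positivity)] at hδ
    nlinarith
  have hexcess : (δ₂ * energyNorm W + δ₃) * D ≤ η / 2 :=
    calc (δ₂ * energyNorm W + δ₃) * D ≤ η / (2 * D) * D := by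
          gcongr
          exact hreemission.trans (min_le_right _ _)
      _ = η / 2 := by field_simp
  exact ⟨hτ0, hδ₁, by linarith, hδ₂, hδ₃, hp0, hp, hW0, hW, hΨ0, hΨ,
    (Moments.isCompact_isAdmissible hr).isClosed, fun m hm => (hm.density_pos hr).ne',
    Moments.continuousOn_gaussian hr hc, hmem, hlip, hreemission.trans (min_le_left _ _),
    hcollision.trans (min_le_left _ _), hη.le,
    by linarith [hcollision.trans (min_le_right _ _)], htrace⟩

end MildSolutionBounds

section Noncritical

variable {ν τ δ η x C : ℝ} {fL fR f : V → ℝ}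

/-- The inequalities of `NoncriticalBounds` at a fixed position, with `C` in place of `C_{LR,1}`. -/
def NoncriticalBoundsAt (ν δ C : ℝ) (fL fR f : V → ℝ) : Prop :=
  aEll fL fR ≤ density f ∧ ∫ v, f v * (1 + ‖v‖ ^ 2) ≤ 2 * C ∧ ∀ κ : V, ‖κ‖ = 1 →
    min (1 - ν) (1 + 2 * ν) * δ ^ 2 * (gammaEll fL fR / (3 * C ^ 2))
        ≤ quadForm (temperatureTensor ν f) κ ∧
      quadForm (temperatureTensor ν f) κ
        ≤ 2 / (3 * aEll fL fR * δ) * max (1 - ν) (1 + 2 * ν) * C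

theorem AboveData.isAdmissible_of_noncriticalBoundsAt (h : AboveData δ fL fR f) (hδ : 1 / 2 ≤ δ)
    (hν : -1 / 2 < ν) (hν1 : ν < 1) (hf : NoncriticalBoundsAt ν δ C fL fR f) :
    (moments f).IsAdmissible ν (aEll fL fR) (2 * C)
      (min (1 - ν) (1 + 2 * ν) * aCrit fL fR / (12 * C)) := by
  have henergy : energyNorm f ≤ 2 * C := (energyNorm_of_nonneg h.nonneg).trans_le hf.2.1
  exact h.finite.isAdmissible_moments (aEll_pos h.data) hf.1 henergy fun κ hκ =>
    h.le_quadForm_of_aCrit hδ hν hν1 henergy hκ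

theorem NearAbove.noncriticalBoundsAt (h : NearAbove η (freeTransport δ τ (glue fL fR) x) f)
    (hP : P1 fL fR) (hν : -1 / 2 < ν) (hν1 : ν < 1) (hE : energyNorm (glue fL fR) ≤ C)
    (hη : η ≤ C) (hδ : 1 - aEll fL fR / (2 * C + aEll fL fR) ≤ δ) (hδ₀ : 0 < δ) (hδ₁ : δ ≤ 1)
    (hτ : 2 ≤ τ) (hx : x ∈ Icc (0 : ℝ) 1) : NoncriticalBoundsAt ν δ C fL fR f := by
  have habove := h.aboveData hP hδ₀.le (by linarith) hx
  have henergy : energyNorm f ≤ 2 * C := by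
    linarith [h.energyNorm_le_of_freeTransport hP.hasFiniteEnergy hP.nonneg hδ₀.le hδ₁
      (by linarith) hx]
  exact ⟨h.aEll_le_density hP (hP.energyNorm_pos.trans_le hE) hE hτ hx hδ,
    (energyNorm_of_nonneg habove.nonneg).symm.trans_le henergy, fun κ hκ =>
    ⟨habove.le_quadForm_of_gammaEll hδ₀ hν hν1 henergy hκ,
      habove.quadForm_le hδ₀ hν1 henergy hκ⟩⟩

theorem exists_noncritical_solution {θ₀ θ₁ : ℝ} (hθ₀ : 0 < θ₀) (hθ₁ : 0 < θ₁) (hν : -1 / 2 < ν)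
    (hν1 : ν < 1) {a b : ℝ} (hC : 0 < C) (ha : 0 < a) (hb : 0 < b) :
    ∃ K₁ > (0 : ℝ), ∃ ε > (0 : ℝ), ∀ fL fR : V → ℝ, P1 fL fR →
      CLR θ₀ θ₁ fL fR = C → aEll fL fR = a → aCrit fL fR = b →
      ∀ τ δ₁ δ₂ δ₃ : ℝ, 0 ≤ δ₁ → 0 ≤ δ₂ → 0 ≤ δ₃ → δ₁ + δ₂ + δ₃ = 1 → K₁ < τ → δ₂ + δ₃ < ε →
        ExistsUniqueMildSolution ν τ δ₁ δ₂ δ₃ θ₀ θ₁ fL fR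
          (NoncriticalBounds ν δ₁ θ₀ θ₁ fL fR) := by
  have hmin : 0 < min (1 - ν) (1 + 2 * ν) := lt_min (by linarith) (by linarith)
  obtain ⟨Ψ, ε, hε, K, hK, hweak⟩ := exists_weakInteraction (ν := ν) (B := 2 * C) ha
    (c := min (1 - ν) (1 + 2 * ν) * b / (12 * C)) (by positivity)
    (glue_wallMaxwellian_nonneg hθ₀ hθ₁) (hasFiniteEnergy_glue_wallMaxwellian hθ₀ hθ₁) hC
    (η := C / 4) (by positivity)
  refine ⟨max K 2, by positivity, min ε (min (1 / 2) (a / (2 * C + a))), by positivity, ?_⟩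
  rintro fL fR hP rfl rfl rfl τ δ₁ δ₂ δ₃ hδ₁ hδ₂ hδ₃ hsum hτ hδ
  obtain ⟨hδε, hδhalf, hδa⟩ := (lt_min_iff.1 hδ).imp_right lt_min_iff.1
  obtain ⟨hτK, hτ2⟩ := max_lt_iff.1 hτ
  have hdata := four_mul_energyNorm_le_CLR hθ₀ hθ₁ hP
  have H := hweak _ hP.nonneg hP.hasFiniteEnergy (by linarith) τ δ₁ δ₂ δ₃ hδ₁ hδ₂ hδ₃ hsum hτK hδε
  exact H.existsUniqueMildSolution hθ₀ hθ₁ hP (by linarith)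
    (S := NoncriticalBoundsAt ν δ₁ (CLR θ₀ θ₁ fL fR) fL fR)
    (fun x hx f hf => hf.noncriticalBoundsAt hP hν hν1 (by linarith) (by linarith) (by linarith)
      (by linarith) H.inflow_le_one hτ2.le hx)
    fun f hf hS => hf.isAdmissible_of_noncriticalBoundsAt (by linarith) hν hν1 hS

end Noncritical

section Critical

variable {τ δ η x C s : ℝ} {fL fR f : V → ℝ}

/-- The inequalities of `CriticalBounds` at a fixed position, with `C` in place of `C_{LR,1}`. -/
def CriticalBoundsAt (δ C : ℝ) (fL fR f : V → ℝ) : Prop :=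
  δ * aEll fL fR ≤ density f ∧ ∫ v, f v * ‖v‖ ^ 2 ≤ 2 * C ∧ ∀ κ : V, ‖κ‖ = 1 →
    δ * (aCrit fL fR / (2 * C)) ≤ quadForm (temperatureTensor (-1 / 2) f) κ ∧
      quadForm (temperatureTensor (-1 / 2) f) κ ≤ 3 / (2 * aEll fL fR) * C

theorem AboveData.le_quadForm_of_criticalBoundsAt (h : AboveData δ fL fR f) (hδ : 1 / 2 ≤ δ)
    (hC : 0 < C) (hf : CriticalBoundsAt δ C fL fR f) {κ : V} (hκ : ‖κ‖ = 1) :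
    aCrit fL fR / (4 * C) ≤ quadForm (temperatureTensor (-1 / 2) f) κ := by
  have hcrit := aCrit_pos h.data
  calc aCrit fL fR / (4 * C) = 1 / 2 * (aCrit fL fR / (2 * C)) := by
        field_simp
        norm_num
    _ ≤ δ * (aCrit fL fR / (2 * C)) := by gcongr
    _ ≤ quadForm (temperatureTensor (-1 / 2) f) κ := (hf.2.2 κ hκ).1

-- A lower bound on the tensor limits the mass that the kinetic energy can carry.
theorem AboveData.density_le_of_criticalBoundsAt (h : AboveData δ fL fR f) (hδ : 1 / 2 ≤ δ)
    (hC : 0 < C) (hf : CriticalBoundsAt δ C fL fR f) : density f ≤ 4 * C ^ 2 / aCrit fL fR := by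
  have hcrit := aCrit_pos h.data
  have hρ := h.density_pos (by linarith)
  have hκ : ‖(EuclideanSpace.single 0 1 : V)‖ = 1 := by simp
  have htensor := mul_le_mul_of_nonneg_left (h.le_quadForm_of_criticalBoundsAt hδ hC hf hκ) hρ.le
  rw [h.finite.density_mul_quadForm_critical hρ.ne' hκ] at htensor
  have hmass : density f * (aCrit fL fR / (4 * C)) ≤ C := by
    linarith [thermalEnergyAlong_nonneg h.nonneg (EuclideanSpace.single 0 1 : V),
      h.finite.thermalEnergy_le_integral_mul_norm_sq hρ, hf.2.1]
  rw [← mul_div_assoc, div_le_iff₀ (by positivity)] at hmass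
  rw [le_div_iff₀ hcrit]
  linarith

theorem AboveData.isAdmissible_of_criticalBoundsAt (h : AboveData δ fL fR f) (hδ : 1 / 2 ≤ δ)
    (hC : 0 < C) (hf : CriticalBoundsAt δ C fL fR f) :
    (moments f).IsAdmissible (-1 / 2) (aEll fL fR / 2) (2 * C + 4 * C ^ 2 / aCrit fL fR)
      (aCrit fL fR / (4 * C)) := by
  have henergy : energyNorm f = density f + ∫ v, f v * ‖v‖ ^ 2 := by
    rw [energyNorm_of_nonneg h.nonneg, density, ← integral_add h.finite.integrable
      h.finite.integrable_mul_norm_sq]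
    simp only [mul_add, mul_one]
  refine h.finite.isAdmissible_moments (half_pos (aEll_pos h.data)) (h.density_ge_half hδ) ?_
    fun κ hκ => h.le_quadForm_of_criticalBoundsAt hδ hC hf hκ
  linarith [hf.2.1, h.density_le_of_criticalBoundsAt hδ hC hf]

theorem NearAbove.abs_momentum_le_of_fluxDiscrepancy_le
    (h : NearAbove η (freeTransport δ τ (glue fL fR) x) f) (hP : P1 fL fR) (hP2 : P2 fL fR)
    (hs : 0 ≤ s) (hE : energyNorm (glue fL fR) ≤ C) (hC : 0 < C)
    (hη : η ≤ s / 4) (hflux : fluxDiscrepancy fL fR ≤ s / 4) (hτs : 1 / τ ≤ s / (4 * C))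
    (hδs : 1 - δ ≤ s / (4 * C)) (hδ : δ ≤ 1) (hτ : 0 < τ) (hx : x ∈ Icc (0 : ℝ) 1) (i : Fin 3) :
    |∫ v, f v * v i| ≤ s := by
  rcases eq_or_ne i 0 with rfl | hi
  · have hloss : (1 - δ + 1 / τ) * energyNorm (glue fL fR) ≤ s / 2 :=
      calc (1 - δ + 1 / τ) * energyNorm (glue fL fR)
          ≤ (s / (4 * C) + s / (4 * C)) * C :=
            mul_le_mul (add_le_add hδs hτs) hE (energyNorm_nonneg _) (by positivity)
        _ = s / 2 := by
            field_simp
            ring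
    linarith [h.abs_normal_momentum_le hP hδ hτ hx]
  · linarith [h.abs_transverse_momentum_le hP hP2 hτ.le hx hi]

theorem NearAbove.criticalBoundsAt (h : NearAbove η (freeTransport δ τ (glue fL fR) x) f)
    (hP : P1 fL fR) (hE : energyNorm (glue fL fR) + η ≤ C / 2) (hδ : 1 / 2 ≤ δ) (hδ₁ : δ ≤ 1)
    (hτ : 1 ≤ τ) (hx : x ∈ Icc (0 : ℝ) 1) (hs : ∀ i, |∫ v, f v * v i| ≤ s)
    (hsmall : 24 * s ^ 2 ≤ aEll fL fR * aCrit fL fR) : CriticalBoundsAt δ C fL fR f := by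
  have habove := h.aboveData hP (by linarith) hτ hx
  have hρ := habove.density_pos (by linarith)
  have henergy : energyNorm f ≤ C / 2 := (h.energyNorm_le_of_freeTransport hP.hasFiniteEnergy
    hP.nonneg (by linarith) hδ₁ (by linarith) hx).trans hE
  have hkinetic : ∫ v, f v * ‖v‖ ^ 2 ≤ 2 * C := by
    linarith [habove.finite.integral_mul_norm_sq_le, habove.finite.density_le]
  exact ⟨habove.density_ge, hkinetic, fun κ hκ =>
    ⟨habove.le_quadForm_critical hδ henergy hs hsmall hκ,
      habove.quadForm_critical_le hδ henergy hκ⟩⟩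

theorem exists_critical_solution {θ₀ θ₁ : ℝ} (hθ₀ : 0 < θ₀) (hθ₁ : 0 < θ₁) {a b : ℝ}
    (hC : 0 < C) (ha : 0 < a) (hb : 0 < b) :
    ∃ K₁ > (0 : ℝ), ∃ ε₁ > (0 : ℝ), ∃ ε₂ > (0 : ℝ), ∀ fL fR : V → ℝ, P1 fL fR → P2 fL fR →
      CLR θ₀ θ₁ fL fR = C → aEll fL fR = a → aCrit fL fR = b →
      ∀ τ δ₁ δ₂ δ₃ : ℝ, 0 ≤ δ₁ → 0 ≤ δ₂ → 0 ≤ δ₃ → δ₁ + δ₂ + δ₃ = 1 → K₁ < τ → δ₂ + δ₃ < ε₁ →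
        fluxDiscrepancy fL fR ≤ ε₂ →
        ExistsUniqueMildSolution (-1 / 2) τ δ₁ δ₂ δ₃ θ₀ θ₁ fL fR
          (CriticalBounds δ₁ θ₀ θ₁ fL fR) := by
  obtain ⟨s, hs, hs2⟩ : ∃ s > 0, 24 * s ^ 2 = a * b :=
    ⟨√(a * b / 24), by positivity, by rw [Real.sq_sqrt (by positivity)]; ring⟩
  have hη : 0 < min (C / 4) (s / 4) := by positivity
  obtain ⟨hηC, hηs⟩ := le_min_iff.1 (le_refl (min (C / 4) (s / 4)))
  obtain ⟨Ψ, ε, hε, K, hK, hweak⟩ := exists_weakInteraction (ν := -1 / 2)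
    (B := 2 * C + 4 * C ^ 2 / b) (half_pos ha) (c := b / (4 * C)) (by positivity)
    (glue_wallMaxwellian_nonneg hθ₀ hθ₁) (hasFiniteEnergy_glue_wallMaxwellian hθ₀ hθ₁) hC hη
  refine ⟨max K (max 1 (4 * C / s)), by positivity, min ε (min (1 / 2) (s / (4 * C))),
    by positivity, s / 4, by positivity, ?_⟩
  rintro fL fR hP hP2 rfl rfl rfl τ δ₁ δ₂ δ₃ hδ₁ hδ₂ hδ₃ hsum hτ hδ hflux
  obtain ⟨hδε, hδhalf, hδs⟩ := (lt_min_iff.1 hδ).imp_right lt_min_iff.1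
  obtain ⟨hτK, hτ1, hτs⟩ := (max_lt_iff.1 hτ).imp_right max_lt_iff.1
  have hdata := four_mul_energyNorm_le_CLR hθ₀ hθ₁ hP
  have hinv : 1 / τ ≤ s / (4 * CLR θ₀ θ₁ fL fR) := by
    simpa only [one_div_div] using one_div_le_one_div_of_le (by positivity) hτs.le
  have H := hweak _ hP.nonneg hP.hasFiniteEnergy (by linarith) τ δ₁ δ₂ δ₃ hδ₁ hδ₂ hδ₃ hsum hτK hδε
  exact H.existsUniqueMildSolution hθ₀ hθ₁ hP hτ1.le
    (S := CriticalBoundsAt δ₁ (CLR θ₀ θ₁ fL fR) fL fR)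
    (fun x hx f hf => hf.criticalBoundsAt hP (by linarith) (by linarith) H.inflow_le_one hτ1.le hx
      (hf.abs_momentum_le_of_fluxDiscrepancy_le hP hP2 hs.le (by linarith) hC hηs hflux hinv
        (by linarith) H.inflow_le_one (by linarith) hx) hs2.le)
    fun f hf hS => hf.isAdmissible_of_criticalBoundsAt (by linarith) hC hS

end Critical

end ESBGK

end

theorem theorem1p1_general {θ₀ θ₁ : ℝ} (hθ₀ : 0 < θ₀) (hθ₁ : 0 < θ₁) :
    (∀ ν : ℝ, -1 / 2 < ν → ν < 1 → ∀ C a b : ℝ,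
      ∃ K₁ > (0 : ℝ), ∃ ε > (0 : ℝ), ∀ fL fR : V → ℝ, P1 fL fR →
        CLR θ₀ θ₁ fL fR = C → aEll fL fR = a → aCrit fL fR = b →
        ((¬ ∀ᵐ v : V, 0 < v 0 → fL v = 0) → (¬ ∀ᵐ v : V, v 0 < 0 → fR v = 0) →
          0 < gammaEll fL fR) ∧
        ∀ τ δ₁ δ₂ δ₃ : ℝ, 0 ≤ δ₁ → 0 ≤ δ₂ → 0 ≤ δ₃ → δ₁ + δ₂ + δ₃ = 1 →
          K₁ < τ → δ₂ + δ₃ < ε →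
          ExistsUniqueMildSolution ν τ δ₁ δ₂ δ₃ θ₀ θ₁ fL fR
            (NoncriticalBounds ν δ₁ θ₀ θ₁ fL fR)) ∧
    (∀ C a b : ℝ,
      ∃ K₁ > (0 : ℝ), ∃ ε₁ > (0 : ℝ), ∃ ε₂ > (0 : ℝ), ∀ fL fR : V → ℝ, P1 fL fR → P2 fL fR →
        CLR θ₀ θ₁ fL fR = C → aEll fL fR = a → aCrit fL fR = b →
        0 < aCrit fL fR ∧
        ∀ τ δ₁ δ₂ δ₃ : ℝ, 0 ≤ δ₁ → 0 ≤ δ₂ → 0 ≤ δ₃ → δ₁ + δ₂ + δ₃ = 1 →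
          K₁ < τ → δ₂ + δ₃ < ε₁ → fluxDiscrepancy fL fR ≤ ε₂ →
          ExistsUniqueMildSolution (-1 / 2) τ δ₁ δ₂ δ₃ θ₀ θ₁ fL fR
            (CriticalBounds δ₁ θ₀ θ₁ fL fR)) := by
  -- Prescribed values that are not all positive are attained by no data.
  have hvalues : ∀ {C a b : ℝ} {fL fR : V → ℝ}, P1 fL fR → CLR θ₀ θ₁ fL fR = C →
      aEll fL fR = a → aCrit fL fR = b → 0 < C ∧ 0 < a ∧ 0 < b := by
    rintro _ _ _ fL fR hP rfl rfl rfl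
    exact ⟨CLR_pos hθ₀ hθ₁ hP, aEll_pos hP, aCrit_pos hP⟩
  refine ⟨fun ν hν hν1 C a b => ?_, fun C a b => ?_⟩
  all_goals by_cases h : 0 < C ∧ 0 < a ∧ 0 < b
  · obtain ⟨K₁, hK₁, ε, hε, H⟩ := exists_noncritical_solution hθ₀ hθ₁ hν hν1 h.1 h.2.1 h.2.2
    exact ⟨K₁, hK₁, ε, hε, fun fL fR hP hC ha hb => ⟨gammaEll_pos hP, H fL fR hP hC ha hb⟩⟩
  · exact ⟨1, one_pos, 1, one_pos, fun _ _ hP hC ha hb => absurd (hvalues hP hC ha hb) h⟩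
  · obtain ⟨K₁, hK₁, ε₁, hε₁, ε₂, hε₂, H⟩ := exists_critical_solution hθ₀ hθ₁ h.1 h.2.1 h.2.2
    exact ⟨K₁, hK₁, ε₁, hε₁, ε₂, hε₂, fun fL fR hP hP2 hC ha hb =>
      ⟨aCrit_pos hP, H fL fR hP hP2 hC ha hb⟩⟩
  · exact ⟨1, one_pos, 1, one_pos, 1, one_pos, fun _ _ hP _ hC ha hb =>
      absurd (hvalues hP hC ha hb) h⟩

theorem theorem1p1 (θ₀ θ₁ : ℝ) (hθ₀ : 0 < θ₀) (hθ₁ : 0 < θ₁) :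
    -- non-critical case
    (∀ ν : ℝ, -1 / 2 < ν → ν < 1 → ∀ C a γ b : ℝ,
      ∃ K₁ > (0 : ℝ), ∃ ε > (0 : ℝ),
        ∀ fL fR : V → ℝ, P1 fL fR → P2 fL fR →
          CLR θ₀ θ₁ fL fR = C → aEll fL fR = a → gammaEll fL fR = γ → aCrit fL fR = b →
          ((¬ ∀ᵐ v : V, 0 < v 0 → fL v = 0) → (¬ ∀ᵐ v : V, v 0 < 0 → fR v = 0) →
            0 < gammaEll fL fR) ∧
          ∀ τ δ₁ δ₂ δ₃ : ℝ, 0 ≤ δ₁ → 0 ≤ δ₂ → 0 ≤ δ₃ → δ₁ + δ₂ + δ₃ = 1 →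
            K₁ < τ → δ₂ + δ₃ < ε →
            ∃ f : ℝ → V → ℝ,
              (IsMildSolution ν τ δ₁ δ₂ δ₃ θ₀ θ₁ fL fR f ∧ Nonneg f ∧
                NoncriticalBounds ν δ₁ θ₀ θ₁ fL fR f) ∧
              ∀ g : ℝ → V → ℝ,
                IsMildSolution ν τ δ₁ δ₂ δ₃ θ₀ θ₁ fL fR g → Nonneg g →
                NoncriticalBounds ν δ₁ θ₀ θ₁ fL fR g → SameSolution g f) ∧
    -- critical case
    (∀ C a b : ℝ,
      ∃ K₁ > (0 : ℝ), ∃ ε₁ > (0 : ℝ), ∃ ε₂ > (0 : ℝ),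
        ∀ fL fR : V → ℝ, P1 fL fR → P2 fL fR →
          CLR θ₀ θ₁ fL fR = C → aEll fL fR = a → aCrit fL fR = b →
          0 < aCrit fL fR ∧
          ∀ τ δ₁ δ₂ δ₃ : ℝ, 0 ≤ δ₁ → 0 ≤ δ₂ → 0 ≤ δ₃ → δ₁ + δ₂ + δ₃ = 1 →
            K₁ < τ → δ₂ + δ₃ < ε₁ → fluxDiscrepancy fL fR ≤ ε₂ →
            ∃ f : ℝ → V → ℝ,
              (IsMildSolution (-1 / 2) τ δ₁ δ₂ δ₃ θ₀ θ₁ fL fR f ∧ Nonneg f ∧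
                CriticalBounds δ₁ θ₀ θ₁ fL fR f) ∧
              ∀ g : ℝ → V → ℝ,
                IsMildSolution (-1 / 2) τ δ₁ δ₂ δ₃ θ₀ θ₁ fL fR g → Nonneg g →
                CriticalBounds δ₁ θ₀ θ₁ fL fR g → SameSolution g f) :=
  ⟨fun ν hν hν1 C a _ b =>
    let ⟨K₁, hK₁, ε, hε, H⟩ := (theorem1p1_general hθ₀ hθ₁).1 ν hν hν1 C a b
    ⟨K₁, hK₁, ε, hε, fun fL fR hP _ hC ha _ hb => H fL fR hP hC ha hb⟩,
    (theorem1p1_general hθ₀ hθ₁).2⟩
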